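/- Let $N\ge 3$ be an integer and let $\mathbb K$ be $\mathbb R$, $\mathbb C$, the quaternions $\mathbb H$, or, only if $N=3$, the octonions $\mathbb O$. Let $V$ be the real vector space of Hermitian $N\times N$ matrices with entries in $\mathbb K$, let $C\subset V$ be the open cone of positive-definite matrices, and let $\Omega\subset \mathrm P(V)$ be its projectivisation. (For $\mathbb K=\mathbb O$, positive-definiteness and rank are those of the Jordan algebra $V$ with product $X\circ Y=\frac12(XY+YX)$: every $X\in V$ can be written $X=\sum_k\lambda_kc_k$, with $\lambda_k\in\mathbb R$ and $c_1,\dots,c_N$ nonzero, pairwise orthogonal idempotents with sum the identity matrix; $X$ is positive-definite if all $\lambda_k$ are positive, and its rank is the number of nonzero $\lambda_k$.) Let $\mathrm{Aut}(C)\subset\mathrm{GL}(V)$ be the group of linear automorphisms of $V$ preserving $C$, let $G=\mathrm{Aut}(\Omega)$ be its quotient by the homotheties it contains, with the quotient topology, and let $G_0$ be the identity component of $G$. Endow $\Omega$ with the Hilbert metric $d_\Omega(x,y)=\frac12\log[a,x,y,b]$, where $a,b\in\partial\Omega$ are such that $a,x,y,b$ are aligned in this order, and the cross-ratio is normalised by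 $[0,1,t,\infty]=t$. For a unit tangent vector $v\in T^1\Omega$, let $c_v:\mathbb R\to\Omega$ be the isometric parametrisation of the intersection of $\Omega$ with the projective line tangent to $v$ such that $c_v'(0)=v$. Write $\pi v=c_v(0)$, $\varphi_t v=c_v'(t)$ (this is the geodesic flow), and $\varphi_{\pm\infty}v=\lim_{t\to\pm\infty}c_v(t)\in\partial\Omega$. Topologise $T^1\Omega$ by pointwise convergence of the geodesics $c_v$ (this is its usual topology). The space of straight geodesics $\mathrm{Geod}(\Omega)=T^1\Omega/(\varphi_t)_{t\in\mathbb R}$ is identified, through $v\mapsto(\varphi_{-\infty}v,\varphi_\infty v)$, with the set of pairs $(x,y)\in\partial\Omega^2$ such that $x\ne y$ and the projective line through $x$ and $y$ meets $\Omega$, and it has the topology induced by $\partial\Omega^2$. For $1\le i,j\le N-1$, let $T^1\Omega_{i,j}$ be the set of $v\in T^1\Omega$ such that $\varphi_{-\infty}v$ and $\varphi_\infty v$ have ranks $i$ and $j$ respectively, and let $\mathrm{Geod}(\Omega)_{i,j}$ be its image in $\mathrm{Geod}(\Omega)$. 1. For $1\le i,j\le N-1$, the set $T^1\Omega_{i,j}$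 is non-empty if and only if $i+j\ge N$. 2. Let $1\le i\le N-1$. The group $G_0$ preserves $T^1\Omega_{i,N-i}$ and acts transitively on it. There is $v_0\in T^1\Omega_{i,N-i}$ such that $\pi v_0$, $\varphi_{-\infty}v_0$ and $\varphi_\infty v_0$ are the classes of, respectively, the identity matrix, $\mathrm{diag}(I_i,0)$ and $\mathrm{diag}(0,I_{N-i})$. For $t\in\mathbb R$, the transformation $X\mapsto D_tXD_t$ of $V$, where $D_t=\mathrm{diag}(e^{-t/2}I_i,\,e^{t/2}I_{N-i})$, belongs to $\mathrm{Aut}(C)$, and its class $a_t\in G$ belongs to $G_0$. The stabiliser $K_{i,N-i}$ of $v_0$ in $G_0$ satisfies $a_t^{-1}K_{i,N-i}\,a_t\subset K_{i,N-i}$ for all $t$. The orbit map $g\mapsto g\cdot v_0$ induces a homeomorphism $G_0/K_{i,N-i}\to T^1\Omega_{i,N-i}$, and through it the geodesic flow becomes right multiplication by $(a_t)_{t\in\mathbb R}$: $\varphi_t(g\cdot v_0)=(ga_t)\cdot v_0$ for all $g\in G_0$ and $t\in\mathbb R$. 3. Let $\mathrm{NW}(\mathrm{Geod}(\Omega),G)$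 be the set of $x\in\mathrm{Geod}(\Omega)$ such that, for every compact neighbourhood $U$ of $x$ in $\mathrm{Geod}(\Omega)$, the set $\{g\in G: gU\cap U\ne\emptyset\}$ is not compact. Then $$\mathrm{NW}(\mathrm{Geod}(\Omega),G)=\bigcup_{1\le i\le N-1}\mathrm{Geod}(\Omega)_{i,N-i}.$$ -/

import Mathlib

open Filter Topology Matrix
open scoped LinearAlgebra.Projectivization Pointwise

noncomputable section

/-! ### Convex projective geometry -/

namespace ConvProj

variable {V : Type*} [NormedAddCommGroup V] [NormedSpace ℝ V]

/-- The topology of the projective space `P(V)`: the quotient topology of `V ∖ {0}`. -/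
instance projTopology : TopologicalSpace (ℙ ℝ V) :=
  inferInstanceAs (TopologicalSpace (Quotient (projectivizationSetoid ℝ V)))

/-- The nonzero vector `v` represents the point `x` of `P(V)`, i.e. `x = [v]`. -/
def Rep (x : ℙ ℝ V) (v : V) : Prop :=
  ∃ h : v ≠ 0, Projectivization.mk ℝ v h = x

/-- The projectivisation `Ω = P(C)` of a cone `C`. -/
def dom (C : Set V) : Set (ℙ ℝ V) := {x | ∃ v ∈ C, Rep x v}

/-- `[a, x, y, b] = r`: the cross-ratio of four aligned points with `a ≠ b`, normalised by
`[0, 1, t, ∞] = t`. In the coordinate `z ↦ [A + z B]` on the line through `a = [A]` and `b = [B]`,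
the points `a, x, y, b` are `0, 1, r, ∞`. -/
def CrossRatioEq (a x y b : ℙ ℝ V) (r : ℝ) : Prop :=
  a ≠ b ∧ ∃ A B : V, Rep a A ∧ Rep b B ∧ Rep x (A + B) ∧ Rep y (A + r • B)

/-- `d_Ω(x, y) = d` for the Hilbert metric of `Ω = P(C)`: there are `a, b ∈ ∂Ω` such that
`a, x, y, b` are aligned in this order (i.e. the cross-ratio is at least `1`) and
`d = (1/2) log [a, x, y, b]`. -/
def HilbertDistEq (C : Set V) (x y : ℙ ℝ V) (d : ℝ) : Prop :=
  x ∈ dom C ∧ y ∈ dom C ∧ ∃ a ∈ frontier (dom C), ∃ b ∈ frontier (dom C), ∃ r : ℝ,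
    1 ≤ r ∧ CrossRatioEq a x y b r ∧ d = (1 / 2) * Real.log r

/-- The unit tangent bundle `T¹Ω`. A unit tangent vector `v` is encoded by the parametrised straight
geodesic `c : ℝ → Ω` with `c'(0) = v`, that is, by the unique isometric embedding `c` of `ℝ` into
`(Ω, d_Ω)` whose image lies in a projective line and which satisfies `c'(0) = v`.
Footpoints are `π v = c 0`. As a subset of `ℝ → P(V)`, it carries the topology of
pointwise convergence of geodesics, which is the topology of the unit tangent bundle. -/
def unitTangent (C : Set V) : Set (ℝ → ℙ ℝ V) :=
  {c | (∀ t, c t ∈ dom C) ∧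
    (∀ s t, HilbertDistEq C (c s) (c t) |s - t|) ∧
    ∃ L : Submodule ℝ V, Module.finrank ℝ L = 2 ∧ ∀ t, (c t).submodule ≤ L}

/-- The geodesic flow: the vector `φ_t v = c'(t)` is encoded by the geodesic `s ↦ c (s + t)`. -/
def geodFlow {X : Type*} (t : ℝ) (c : ℝ → X) : ℝ → X := fun s => c (s + t)

/-- The space `Geod(Ω)` of straight geodesics, as the set of pairs `(φ_{-∞} v, φ_∞ v)`: the pairs of
distinct points `x, y ∈ ∂Ω` such that the projective line through `x` and `y` meets `Ω`. -/
def geod (C : Set V) : Set (ℙ ℝ V × ℙ ℝ V) :=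
  {p | p.1 ∈ frontier (dom C) ∧ p.2 ∈ frontier (dom C) ∧ p.1 ≠ p.2 ∧
    ∃ z ∈ dom C, z.submodule ≤ p.1.submodule ⊔ p.2.submodule}

/-- `Aut(C)`: the linear automorphisms of `V` preserving `C`. -/
abbrev AutCone (C : Set V) : Subgroup (V →L[ℝ] V)ˣ := MulAction.stabilizer (V →L[ℝ] V)ˣ C

/-- The homotheties in `Aut(C)`. -/
def homotheties (C : Set V) : Subgroup (AutCone C) where
  carrier := {g | ∃ r : ℝ, r ≠ 0 ∧ ∀ v : V, g • v = r • v}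
  one_mem' := ⟨1, one_ne_zero, fun v => by simp⟩
  mul_mem' := by
    rintro g h ⟨r, hr, hg⟩ ⟨s, hs, hh⟩
    exact ⟨r * s, mul_ne_zero hr hs, fun v => by rw [mul_smul, hh, hg, mul_smul]⟩
  inv_mem' := by
    rintro g ⟨r, hr, hg⟩
    refine ⟨r⁻¹, inv_ne_zero hr, fun v => ?_⟩
    rw [inv_smul_eq_iff, hg, smul_smul, mul_inv_cancel₀ hr, one_smul]

instance homotheties_normal (C : Set V) : (homotheties C).Normal where
  conj_mem := by
    rintro g ⟨r, hr, hg⟩ h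
    refine ⟨r, hr, fun v => ?_⟩
    rw [mul_smul, mul_smul, hg, smul_comm h r, smul_inv_smul]

/-- The automorphism group `G = Aut(Ω) = Aut(C)/ℝ^*` of `Ω = P(C)`, with its quotient topology. -/
abbrev AutDom (C : Set V) : Type _ := AutCone C ⧸ homotheties C

/-- The action of `Aut(Ω)` on `P(V)`, as a homomorphism to the permutations of `P(V)`. -/
def autDomPerm (C : Set V) : AutDom C →* Equiv.Perm (ℙ ℝ V) :=
  QuotientGroup.lift (homotheties C) (MulAction.toPermHom (AutCone C) (ℙ ℝ V)) (by
    rintro g ⟨r, hr, hg⟩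
    ext x
    induction x using Projectivization.ind with
    | h v hv =>
      simp only [MulAction.toPermHom_apply, MulAction.toPerm_apply, Equiv.Perm.coe_one, id_eq]
      exact (Projectivization.mk_eq_mk_iff' ℝ _ _ _ _).mpr ⟨r, (hg v).symm⟩)

instance autDomAction (C : Set V) : MulAction (AutDom C) (ℙ ℝ V) :=
  MulAction.compHom _ (autDomPerm C)

/-- The action of `Aut(Ω)` on `P(V)` is induced by that of `Aut(C)` on `V`. -/
theorem autDom_smul_mk (C : Set V) (g : AutCone C) (v : V) (hv : v ≠ 0) :
    (g : AutDom C) • Projectivization.mk ℝ v hv =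
      Projectivization.mk ℝ (g • v) ((smul_ne_zero_iff_ne g).mpr hv) := rfl

/-- The identity component `G₀` of `G = Aut(Ω)`. -/
abbrev autDomId (C : Set V) : Subgroup (AutDom C) := Subgroup.connectedComponentOfOne (AutDom C)

/-- The non-wandering set `NW(X, G)` of an action of a topological group `G` on an invariant subset
`X` (with the induced topology) of a space `Y`: the points `x ∈ X` such that for every compact
neighbourhood `U` of `x` in `X`, the set `{g ∈ G | g U ∩ U ≠ ∅}` is not compact. -/
def nonWandering (G : Type*) [Group G] [TopologicalSpace G] {Y : Type*} [TopologicalSpace Y]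
    [MulAction G Y] (X : Set Y) : Set Y :=
  {x | x ∈ X ∧ ∀ U : Set Y, U ⊆ X → IsCompact U → U ∈ 𝓝[X] x →
    ¬ IsCompact {g : G | ((g • U) ∩ U).Nonempty}}

end ConvProj

/-! ### Octonions and the four algebras -/

/-- The octonions, as the Cayley-Dickson double of the quaternions. -/
def Octonion : Type := WithLp 2 (Quaternion ℝ × Quaternion ℝ)

namespace Octonion

instance : NormedAddCommGroup Octonion :=
  inferInstanceAs (NormedAddCommGroup (WithLp 2 (Quaternion ℝ × Quaternion ℝ)))

instance : NormedSpace ℝ Octonion :=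
  inferInstanceAs (NormedSpace ℝ (WithLp 2 (Quaternion ℝ × Quaternion ℝ)))

/-- The octonion `(a, b)`. -/
def mk (a b : Quaternion ℝ) : Octonion := WithLp.toLp 2 (a, b)

/-- First quaternionic component. -/
def fst (x : Octonion) : Quaternion ℝ := (WithLp.ofLp x).1

/-- Second quaternionic component. -/
def snd (x : Octonion) : Quaternion ℝ := (WithLp.ofLp x).2

theorem ext' {x y : Octonion} (h₁ : x.fst = y.fst) (h₂ : x.snd = y.snd) : x = y :=
  WithLp.ofLp_injective 2 (Prod.ext h₁ h₂)

@[simp] theorem fst_mk (a b : Quaternion ℝ) : (mk a b).fst = a := rfl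
@[simp] theorem snd_mk (a b : Quaternion ℝ) : (mk a b).snd = b := rfl
@[simp] theorem fst_add (x y : Octonion) : (x + y).fst = x.fst + y.fst := rfl
@[simp] theorem snd_add (x y : Octonion) : (x + y).snd = x.snd + y.snd := rfl
@[simp] theorem fst_zero : (0 : Octonion).fst = 0 := rfl
@[simp] theorem snd_zero : (0 : Octonion).snd = 0 := rfl
@[simp] theorem fst_smul (r : ℝ) (x : Octonion) : (r • x).fst = r • x.fst := rfl
@[simp] theorem snd_smul (r : ℝ) (x : Octonion) : (r • x).snd = r • x.snd := rfl

instance : One Octonion := ⟨mk 1 0⟩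

/-- Cayley-Dickson product `(a, b)(c, d) = (a c - d̄ b, d a + b c̄)`. -/
instance : Mul Octonion :=
  ⟨fun x y => mk (x.fst * y.fst - star y.snd * x.snd) (y.snd * x.fst + x.snd * star y.fst)⟩

/-- Conjugation `(a, b) ↦ (ā, -b)`. -/
instance : Star Octonion := ⟨fun x => mk (star x.fst) (-x.snd)⟩

@[simp] theorem fst_one : (1 : Octonion).fst = 1 := rfl
@[simp] theorem snd_one : (1 : Octonion).snd = 0 := rfl
@[simp] theorem fst_mul (x y : Octonion) :
    (x * y).fst = x.fst * y.fst - star y.snd * x.snd := rfl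
@[simp] theorem snd_mul (x y : Octonion) :
    (x * y).snd = y.snd * x.fst + x.snd * star y.fst := rfl
@[simp] theorem fst_star (x : Octonion) : (star x).fst = star x.fst := rfl
@[simp] theorem snd_star (x : Octonion) : (star x).snd = -x.snd := rfl

instance : NonAssocRing Octonion where
  __ := (inferInstance : AddCommGroup Octonion)
  left_distrib x y z := ext' (by simp [mul_add, add_mul]; abel) (by simp [mul_add, add_mul]; abel)
  right_distrib x y z := ext' (by simp [mul_add, add_mul]; abel) (by simp [mul_add, add_mul]; abel)
  zero_mul x := ext' (by simp) (by simp)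
  mul_zero x := ext' (by simp) (by simp)
  one_mul x := ext' (by simp) (by simp)
  mul_one x := ext' (by simp) (by simp)

instance : StarRing Octonion where
  star_involutive x := ext' (by simp) (by simp)
  star_mul x y := ext' (by simp) (by simp)
  star_add x y := ext' (by simp) (by simp; abel)

instance : StarModule ℝ Octonion where
  star_smul r x := ext' (by simp) (by simp)

end Octonion

/-- Normed real vector spaces with a (possibly non-associative) unital product and a conjugation.
This only bundles existing notions, so as to treat `ℝ`, `ℂ`, `ℍ` and `𝕆` together. -/
class NormedStarAlg (K : Type) extends NonAssocRing K, NormedAddCommGroup K, StarRing K,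
  NormedSpace ℝ K, StarModule ℝ K

instance : NormedStarAlg ℝ where
  __ := (inferInstance : NonAssocRing ℝ)
  __ := (inferInstance : NormedAddCommGroup ℝ)
  __ := (inferInstance : StarRing ℝ)
  __ := (inferInstance : NormedSpace ℝ ℝ)
  __ := (inferInstance : StarModule ℝ ℝ)

instance : NormedStarAlg ℂ where
  __ := (inferInstance : NonAssocRing ℂ)
  __ := (inferInstance : NormedAddCommGroup ℂ)
  __ := (inferInstance : StarRing ℂ)
  __ := (inferInstance : NormedSpace ℝ ℂ)
  __ := (inferInstance : StarModule ℝ ℂ)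

instance : NormedStarAlg (Quaternion ℝ) where
  __ := (inferInstance : NonAssocRing (Quaternion ℝ))
  __ := (inferInstance : NormedAddCommGroup (Quaternion ℝ))
  __ := (inferInstance : StarRing (Quaternion ℝ))
  __ := (inferInstance : NormedSpace ℝ (Quaternion ℝ))
  star_smul r x := by simp

instance : NormedStarAlg Octonion where
  __ := (inferInstance : NonAssocRing Octonion)
  __ := (inferInstance : NormedAddCommGroup Octonion)
  __ := (inferInstance : StarRing Octonion)
  __ := (inferInstance : NormedSpace ℝ Octonion)
  __ := (inferInstance : StarModule ℝ Octonion)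


/-- Labels for the four algebras. -/
inductive DivAlg
  | real
  | complex
  | quaternion
  | octonion

/-- The algebra `𝕂 = ℝ, ℂ, ℍ` or `𝕆`. -/
def DivAlg.Carrier : DivAlg → Type
  | .real => ℝ
  | .complex => ℂ
  | .quaternion => Quaternion ℝ
  | .octonion => Octonion

instance : ∀ 𝔸 : DivAlg, NormedStarAlg 𝔸.Carrier
  | .real => inferInstanceAs (NormedStarAlg ℝ)
  | .complex => inferInstanceAs (NormedStarAlg ℂ)
  | .quaternion => inferInstanceAs (NormedStarAlg (Quaternion ℝ))
  | .octonion => inferInstanceAs (NormedStarAlg Octonion)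

/-! ### Hermitian matrices -/

section Hermitian

attribute [local instance] Matrix.normedAddCommGroup Matrix.normedSpace

variable (K : Type) [NormedStarAlg K] (N : ℕ)

/-- The real vector space of Hermitian matrices of size `N` with entries in `K` (normed by the
largest norm of an entry). -/
def Herm : Type := selfAdjoint.submodule ℝ (Matrix (Fin N) (Fin N) K)

instance : NormedAddCommGroup (Herm K N) :=
  inferInstanceAs (NormedAddCommGroup (selfAdjoint.submodule ℝ (Matrix (Fin N) (Fin N) K)))

instance : NormedSpace ℝ (Herm K N) :=
  inferInstanceAs (NormedSpace ℝ (selfAdjoint.submodule ℝ (Matrix (Fin N) (Fin N) K)))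

end Hermitian

namespace Herm

variable {K : Type} [NormedStarAlg K] {N : ℕ}

/-- The matrix underlying a Hermitian matrix. -/
def mat (X : Herm K N) : Matrix (Fin N) (Fin N) K := X.1

/-- The diagonal matrix with given real entries. -/
def diag (d : Fin N → ℝ) : Herm K N :=
  ⟨Matrix.diagonal fun k => d k • (1 : K), by
    change star _ = _
    rw [Matrix.star_eq_conjTranspose, Matrix.diagonal_conjTranspose]
    congr 1
    funext k
    simp⟩

/-- Positive-definiteness through the Hermitian form `⟨x, y⟩ = ∑ x̄_i y_i`: the number `⟨x, X x⟩` is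
real and positive for every nonzero `x ∈ K^N`. -/
def FormPosDef (X : Herm K N) : Prop :=
  ∀ x : Fin N → K, x ≠ 0 → ∃ r : ℝ, 0 < r ∧ star x ⬝ᵥ (X.mat *ᵥ x) = r • (1 : K)

/-- Rank of `X` when `K` is associative: the dimension over `K` of the image of `x ↦ X x`. -/
def ImageRank (X : Herm K N) (r : ℕ) : Prop :=
  Module.finrank ℝ (Submodule.span ℝ (Set.range fun x : Fin N → K => X.mat *ᵥ x)) =
    r * Module.finrank ℝ K

/-- A Jordan frame: `N` nonzero Hermitian matrices with sum `1`, which are idempotent and mutually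
orthogonal for the Jordan product `X ∘ Y = (X Y + Y X) / 2`. -/
def IsJordanFrame (c : Fin N → Herm K N) : Prop :=
  (∀ k, c k ≠ 0) ∧ (∑ k, c k = diag 1) ∧
    ∀ k l, (1 / 2 : ℝ) • ((c k).mat * (c l).mat + (c l).mat * (c k).mat) =
      if k = l then (c k).mat else 0

/-- `l` lists the eigenvalues of `X` in a spectral decomposition `X = ∑ l_k c_k`, where `(c_k)` is
a Jordan frame. -/
def IsSpectrum (X : Herm K N) (l : Fin N → ℝ) : Prop :=
  ∃ c : Fin N → Herm K N, IsJordanFrame c ∧ X = ∑ k, l k • c k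

/-- Positive-definiteness through the spectral decomposition: all eigenvalues are positive. -/
def SpecPosDef (X : Herm K N) : Prop := ∃ l, IsSpectrum X l ∧ ∀ k, 0 < l k

/-- Rank through the spectral decomposition: the number of nonzero eigenvalues. -/
def SpecRank (X : Herm K N) (r : ℕ) : Prop :=
  ∃ l, IsSpectrum X l ∧ (Finset.univ.filter fun k => l k ≠ 0).card = r

end Herm

/-- The space `V_{N,𝕂}`. -/
abbrev HermV (𝔸 : DivAlg) (N : ℕ) : Type := Herm 𝔸.Carrier N

/-- Positive-definiteness. Over `𝕆`, where `𝕂^N` is not a module and matrices do not act on it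
associatively, it is understood, as usual, in the Jordan algebra of Hermitian matrices. -/
def IsPosDef : (𝔸 : DivAlg) → {N : ℕ} → HermV 𝔸 N → Prop
  | .real, _, X => X.FormPosDef
  | .complex, _, X => X.FormPosDef
  | .quaternion, _, X => X.FormPosDef
  | .octonion, _, X => X.SpecPosDef

/-- `HasRank 𝔸 X r`: the Hermitian matrix `X` has rank `r`. Over `𝕆`, it is understood,
as usual, in the Jordan algebra of Hermitian matrices. -/
def HasRank : (𝔸 : DivAlg) → {N : ℕ} → HermV 𝔸 N → ℕ → Prop
  | .real, _, X, r => X.ImageRank r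
  | .complex, _, X, r => X.ImageRank r
  | .quaternion, _, X, r => X.ImageRank r
  | .octonion, _, X, r => X.SpecRank r

/-- The cone `C_{N,𝕂}` of positive-definite Hermitian matrices; `Ω_{N,𝕂}` is `ConvProj.dom` of it. -/
def posCone (𝔸 : DivAlg) (N : ℕ) : Set (HermV 𝔸 N) := {X | IsPosDef 𝔸 X}

/-- The rank of a point of `P(V)` is the rank of its representatives. -/
def PointHasRank (𝔸 : DivAlg) {N : ℕ} (x : ℙ ℝ (HermV 𝔸 N)) (r : ℕ) : Prop :=
  ∃ X, ConvProj.Rep x X ∧ HasRank 𝔸 X r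

/-- The stratum `T¹Ω_{i,j}`: the unit vectors `v` such that the ranks of
`φ_{-∞} v` and `φ_∞ v` are `i` and `j`. -/
def unitTangentStratum (𝔸 : DivAlg) (N i j : ℕ) : Set (ℝ → ℙ ℝ (HermV 𝔸 N)) :=
  {v | v ∈ ConvProj.unitTangent (posCone 𝔸 N) ∧ ∃ x y, Tendsto v atBot (𝓝 x) ∧
    Tendsto v atTop (𝓝 y) ∧ PointHasRank 𝔸 x i ∧ PointHasRank 𝔸 y j}

/-- The set `Geod(Ω)_{i,j}` of straight geodesics (identified with the pairs of their endpoints)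
tangent to the vectors of `T¹Ω_{i,j}`. -/
def geodStratum (𝔸 : DivAlg) (N i j : ℕ) : Set (ℙ ℝ (HermV 𝔸 N) × ℙ ℝ (HermV 𝔸 N)) :=
  {p | ∃ v ∈ unitTangentStratum 𝔸 N i j, Tendsto v atBot (𝓝 p.1) ∧ Tendsto v atTop (𝓝 p.2)}

/-- The real diagonal vector with `i` entries `a` followed by `N - i` entries `b`. -/
def blockVec {N : ℕ} (i : ℕ) (a b : ℝ) : Fin N → ℝ := fun k => if (k : ℕ) < i then a else b

/-- The element `g` of `Aut(C)` is the action `X ↦ D X D` of the real diagonal matrix `D = diag d`. -/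
def IsDiagAction {𝔸 : DivAlg} {N : ℕ} (d : Fin N → ℝ)
    (g : ConvProj.AutCone (posCone 𝔸 N)) : Prop :=
  ∀ X : HermV 𝔸 N, (g • X).mat =
    (Herm.diag d : HermV 𝔸 N).mat * X.mat * (Herm.diag d : HermV 𝔸 N).mat

end

/-! ### Topology of projective space and continuity of the action of Aut(Ω). -/

noncomputable section

namespace ConvProj

section Points

variable {V : Type*} [NormedAddCommGroup V] [NormedSpace ℝ V]

/-! A straight geodesic of Ω is a chord: a pair of vectors A, B on the boundary of the cone C with A
+ B in C, up to positive scalars. Everything rests on simultaneous diagonalisation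
(`SymCone.exists_diag_pair`): an automorphism in the identity component carries A + B to the
identity matrix, and another one, fixing the identity, diagonalises A; then B = 1 - A is diagonal
too. Up to the group, a chord is therefore a pair of nonnegative vectors l, m with l + m = 1, and
the ranks of its ends are the sizes of the supports of l and m. The supports cover the N indices, so
i + j ≥ N. If i + j = N they are complementary, l and m are 0-1 vectors, and permutations of the
indices give transitivity on the stratum. The orbit map is a homeomorphism because Aut(Ω) acts
properly on Ω. The flow becomes right multiplication because it commutes with the group and is
induced by a_t at v₀.

For the non-wandering set, if i + j = N, a conjugate of (a_t) fixes the pair of endpoints and moves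
the points of the chord to the boundary, so the set of returning elements is not compact. If i + j >
N, consider the polynomial s ↦ det(A + sB) (`linePoly`). Its coefficients of degree between N - i
and j are positive, and here there are at least two consecutive ones c_k, c_{k+1}. They remain
positive for nearby pairs, and (A, B) ↦ [A + (c_k/c_{k+1})B] is well defined, continuous and
equivariant, with values in Ω. Properness on Ω then gives compactness of the set of returning
elements (`SymCone.notMem_nonWandering`).

To treat the octonions with the rest, the determinant is replaced by a power of the Haar volume of
the order interval between 0 and X. It is multiplied by a constant under each automorphism, and
equals the product of the entries on diagonal matrices (`coneNorm_dg`). The same norm shows that the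
rank is invariant (`card_zero_le`).

All of this uses only the axioms of `SymCone`. For Hermitian matrices they come from plane rotations
with a coefficient in 𝕂: these are Jordan automorphisms by the alternative and Moufang identities,
provided that 𝕂 is associative or N ≤ 3 (`Herm.rot_sq`). Jacobi's method then diagonalises every
matrix inside a compact connected group. The cone is obtained as the dual of the set of positive
elements of rank one, which X ↦ DXD preserves because the minors of order two of such elements
vanish. It remains to match this cone and the rank with the definitions by forms and images, or by
Jordan frames. -/

theorem isOpenQuotientMap_mk' :
    IsOpenQuotientMap (Projectivization.mk' ℝ : {v : V // v ≠ 0} → ℙ ℝ V) where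
  surjective := Quotient.mk''_surjective
  continuous := continuous_quotient_mk'
  isOpenMap := by
    intro U hU
    change IsOpen (Projectivization.mk' ℝ ⁻¹' (Projectivization.mk' ℝ '' U))
    -- The saturation of U is a union of preimages of U under homotheties, hence open.
    have : Projectivization.mk' ℝ ⁻¹' (Projectivization.mk' ℝ '' U) =
        ⋃ r : ℝˣ, (fun v : {v : V // v ≠ 0} =>
          (⟨(r : ℝ) • v.1, smul_ne_zero r.ne_zero v.2⟩ : {v : V // v ≠ 0})) ⁻¹' U := by
      ext v
      simp only [Set.mem_preimage, Set.mem_image, Set.mem_iUnion]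
      constructor
      · rintro ⟨u, hu, huv⟩
        rw [Projectivization.mk'_eq_mk, Projectivization.mk'_eq_mk,
          Projectivization.mk_eq_mk_iff] at huv
        obtain ⟨r, hr⟩ := huv
        refine ⟨r, ?_⟩
        convert hu using 1
        exact Subtype.ext hr
      · rintro ⟨r, hr⟩
        refine ⟨_, hr, ?_⟩
        rw [Projectivization.mk'_eq_mk, Projectivization.mk'_eq_mk,
          Projectivization.mk_eq_mk_iff]
        exact ⟨r, rfl⟩
    rw [this]
    refine isOpen_iUnion fun r => hU.preimage ?_
    exact Continuous.subtype_mk (continuous_subtype_val.const_smul _) _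

/-- For an open quotient map, being Hausdorff amounts to the relation being closed. Nonzero v, w are
proportional exactly when ‖w‖v = ±‖v‖w, which is a closed condition. -/
instance t2Space_proj : T2Space (ℙ ℝ V) := by
  rw [t2Space_iff_of_isOpenQuotientMap isOpenQuotientMap_mk']
  have : {q : {v : V // v ≠ 0} × {v : V // v ≠ 0} |
      Projectivization.mk' ℝ q.1 = Projectivization.mk' ℝ q.2} =
      {q | ‖q.2.1‖ • q.1.1 = ‖q.1.1‖ • q.2.1} ∪ {q | ‖q.2.1‖ • q.1.1 = -(‖q.1.1‖ • q.2.1)} := by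
    ext ⟨v, w⟩
    simp only [Set.mem_ofPred_eq, Set.mem_union]
    rw [Projectivization.mk'_eq_mk, Projectivization.mk'_eq_mk, Projectivization.mk_eq_mk_iff']
    constructor
    · rintro ⟨r, hr⟩
      rcases le_total 0 r with h | h
      · left
        rw [← hr, norm_smul, Real.norm_of_nonneg h, smul_smul, mul_comm]
      · right
        rw [← hr, norm_smul, Real.norm_of_nonpos h, smul_smul, mul_comm, ← neg_smul, neg_mul,
          neg_neg]
    · have hw : ‖w.1‖ ≠ 0 := norm_ne_zero_iff.mpr w.2
      rintro (h | h)
      · exact ⟨‖w.1‖⁻¹ * ‖v.1‖, by rw [mul_smul, ← h, inv_smul_smul₀ hw]⟩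
      · exact ⟨-(‖w.1‖⁻¹ * ‖v.1‖), by
          rw [neg_smul, mul_smul, ← smul_neg, ← h, inv_smul_smul₀ hw]⟩
  rw [this]
  refine IsClosed.union (isClosed_eq ?_ ?_) (isClosed_eq ?_ ?_) <;> fun_prop

theorem autCone_smul_def {C : Set V} (g : AutCone C) (v : V) :
    g • v = ((g : (V →L[ℝ] V)ˣ) : V →L[ℝ] V) v := rfl

instance autCone_continuousSMul (C : Set V) : ContinuousSMul (AutCone C) V where
  continuous_smul := by
    change Continuous fun p : AutCone C × V => ((p.1 : (V →L[ℝ] V)ˣ) : V →L[ℝ] V) p.2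
    have h : Continuous fun p : AutCone C × V => ((p.1 : (V →L[ℝ] V)ˣ) : V →L[ℝ] V) :=
      Units.continuous_val.comp (continuous_subtype_val.comp continuous_fst)
    exact h.clm_apply continuous_snd

/-- A product of open quotient maps is a quotient map, so joint continuity can be tested on
representatives. -/
instance autDom_continuousSMul (C : Set V) : ContinuousSMul (AutDom C) (ℙ ℝ V) where
  continuous_smul := by
    have hq : IsOpenQuotientMap (Prod.map (QuotientGroup.mk : AutCone C → AutDom C)
        (Projectivization.mk' ℝ : {v : V // v ≠ 0} → ℙ ℝ V)) :=
      QuotientGroup.isOpenQuotientMap_mk.prodMap isOpenQuotientMap_mk'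
    rw [hq.isQuotientMap.continuous_iff]
    have : (fun p : AutDom C × ℙ ℝ V => p.1 • p.2) ∘
        (Prod.map (QuotientGroup.mk : AutCone C → AutDom C)
        (Projectivization.mk' ℝ : {v : V // v ≠ 0} → ℙ ℝ V)) =
        fun p => (Projectivization.mk' ℝ (⟨p.1 • p.2.1, (smul_ne_zero_iff_ne p.1).mpr p.2.2⟩ :
          {v : V // v ≠ 0}) : ℙ ℝ V) := by
      ext p
      rfl
    rw [this]
    refine isOpenQuotientMap_mk'.continuous.comp (Continuous.subtype_mk ?_ _)
    exact continuous_fst.smul (continuous_subtype_val.comp continuous_snd)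

variable [Nontrivial V]

instance nonempty_proj : Nonempty (ℙ ℝ V) :=
  (exists_ne (0 : V)).elim fun v hv => ⟨Projectivization.mk ℝ v hv⟩

open Classical in
/-- The class `[v]` of a vector `v` in `P(V)`, with a junk value if `v = 0`. -/
def pt (v : V) : ℙ ℝ V :=
  if h : v ≠ 0 then Projectivization.mk ℝ v h else Classical.arbitrary _

theorem pt_of_ne {v : V} (h : v ≠ 0) : pt v = Projectivization.mk ℝ v h := dif_pos h

theorem rep_iff {x : ℙ ℝ V} {v : V} : Rep x v ↔ v ≠ 0 ∧ pt v = x := by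
  constructor
  · rintro ⟨h, rfl⟩
    exact ⟨h, pt_of_ne h⟩
  · rintro ⟨h, rfl⟩
    exact ⟨h, (pt_of_ne h).symm⟩

theorem rep_pt {v : V} (h : v ≠ 0) : Rep (pt v) v := rep_iff.mpr ⟨h, rfl⟩

theorem exists_pt (x : ℙ ℝ V) : ∃ v, v ≠ 0 ∧ pt v = x :=
  ⟨x.rep, x.rep_nonzero, by rw [pt_of_ne x.rep_nonzero, Projectivization.mk_rep]⟩

theorem pt_eq_pt_iff {v w : V} (hv : v ≠ 0) (hw : w ≠ 0) :
    pt v = pt w ↔ ∃ r : ℝ, r ≠ 0 ∧ v = r • w := by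
  rw [pt_of_ne hv, pt_of_ne hw, Projectivization.mk_eq_mk_iff']
  constructor
  · rintro ⟨r, hr⟩
    refine ⟨r, ?_, hr.symm⟩
    rintro rfl
    exact hv (by rw [← hr, zero_smul])
  · rintro ⟨r, -, hr⟩
    exact ⟨r, hr.symm⟩

theorem pt_smul {r : ℝ} (hr : r ≠ 0) (v : V) : pt (r • v) = pt v := by
  by_cases hv : v = 0
  · rw [hv, smul_zero]
  · exact (pt_eq_pt_iff (smul_ne_zero hr hv) hv).mpr ⟨r, hr, rfl⟩

theorem pt_submodule {v : V} (hv : v ≠ 0) : (pt v).submodule = Submodule.span ℝ {v} := by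
  rw [pt_of_ne hv, Projectivization.submodule_mk]

theorem continuousOn_pt : ContinuousOn (pt : V → ℙ ℝ V) {v | v ≠ 0} := by
  rw [continuousOn_iff_continuous_domRestrict]
  have : Set.domRestrict {v : V | v ≠ 0} pt = Projectivization.mk' ℝ := by
    ext v
    exact pt_of_ne v.2
  rw [this]
  exact isOpenQuotientMap_mk'.continuous

theorem continuousAt_pt {v : V} (hv : v ≠ 0) : ContinuousAt (pt : V → ℙ ℝ V) v :=
  continuousOn_pt.continuousAt (isOpen_ne.mem_nhds hv)

theorem isOpen_image_pt {U : Set V} (hU : IsOpen U) (h0 : (0 : V) ∉ U) : IsOpen (pt '' U) := by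
  have : pt '' U = Projectivization.mk' ℝ '' ((Subtype.val : {v : V // v ≠ 0} → V) ⁻¹' U) := by
    ext x
    constructor
    · rintro ⟨v, hv, rfl⟩
      have h : v ≠ 0 := fun h => h0 (h ▸ hv)
      exact ⟨⟨v, h⟩, hv, (pt_of_ne h).symm⟩
    · rintro ⟨v, hv, rfl⟩
      exact ⟨v.1, hv, pt_of_ne v.2⟩
  rw [this]
  exact isOpenQuotientMap_mk'.isOpenMap _ (hU.preimage continuous_subtype_val)

theorem autDom_smul_pt {C : Set V} (g : AutCone C) {v : V} (hv : v ≠ 0) :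
    (g : AutDom C) • pt v = pt (g • v) := by
  rw [pt_of_ne hv, pt_of_ne ((smul_ne_zero_iff_ne g).mpr hv)]
  rfl

end Points

end ConvProj

end

/-! ### Sharp cones and their chords. -/

noncomputable section

set_option linter.unusedSectionVars false

namespace ConvProj

section Cone

variable {V : Type*} [NormedAddCommGroup V] [NormedSpace ℝ V]

/-- A nonempty open convex cone `C`, with a linear form `τ` which is positive on `closure C ∖ 0`. -/
structure IsSharpCone (C : Set V) (τ : V →L[ℝ] ℝ) : Prop where
  isOpen : IsOpen C
  nonempty : C.Nonempty
  add_mem : ∀ {X Y}, X ∈ C → Y ∈ closure C → X + Y ∈ C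
  smul_mem : ∀ {r : ℝ} {X}, 0 < r → X ∈ C → r • X ∈ C
  trace_pos : ∀ {X}, X ∈ closure C → X ≠ 0 → 0 < τ X
  zero_notMem : (0 : V) ∉ C

/-- The vectors `A`, `B` represent the endpoints of a chord of `Ω = P(C)`. -/
structure IsChord (C : Set V) (A B : V) : Prop where
  left_mem : A ∈ closure C
  right_mem : B ∈ closure C
  left_notMem : A ∉ C
  right_notMem : B ∉ C
  add_mem : A + B ∈ C

namespace IsSharpCone

variable {C : Set V} {τ : V →L[ℝ] ℝ} (h : IsSharpCone C τ)
include h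

theorem ne_zero {X : V} (hX : X ∈ C) : X ≠ 0 := fun h0 => h.zero_notMem (h0 ▸ hX)

theorem tendsto_add_smul (X P : V) :
    Tendsto (fun ε : ℝ => X + ε • P) (𝓝[>] 0) (𝓝 X) := by
  have : Tendsto (fun ε : ℝ => X + ε • P) (𝓝 0) (𝓝 (X + (0 : ℝ) • P)) :=
    (Continuous.tendsto (by fun_prop) 0)
  rw [zero_smul, add_zero] at this
  exact this.mono_left nhdsWithin_le_nhds

theorem mem_closure_of_forall {X P : V} (hX : ∀ ε : ℝ, 0 < ε → X + ε • P ∈ C) : X ∈ closure C :=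
  mem_closure_of_tendsto (h.tendsto_add_smul X P) (by
    filter_upwards [self_mem_nhdsWithin] with ε hε using hX ε hε)

/-- Testing the closure along one ray towards an interior point turns limits into algebra with the
cone. -/
theorem mem_closure_iff {X P : V} (hP : P ∈ C) :
    X ∈ closure C ↔ ∀ ε : ℝ, 0 < ε → X + ε • P ∈ C :=
  ⟨fun hX ε hε => by rw [add_comm]; exact h.add_mem (h.smul_mem hε hP) hX,
    h.mem_closure_of_forall⟩

theorem closure_add {X Y : V} (hX : X ∈ closure C) (hY : Y ∈ closure C) : X + Y ∈ closure C := by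
  obtain ⟨P, hP⟩ := h.nonempty
  refine h.mem_closure_of_forall (P := P) fun ε hε => ?_
  have := h.add_mem ((h.mem_closure_iff hP).mp hX ε hε) hY
  convert this using 1
  abel

theorem closure_smul_pos {r : ℝ} {X : V} (hr : 0 < r) (hX : X ∈ closure C) :
    r • X ∈ closure C := by
  obtain ⟨P, hP⟩ := h.nonempty
  refine h.mem_closure_of_forall (P := P) fun ε hε => ?_
  have := h.smul_mem hr ((h.mem_closure_iff hP).mp hX (r⁻¹ * ε) (by positivity))
  rwa [smul_add, smul_smul, mul_inv_cancel_left₀ hr.ne'] at this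

theorem zero_mem_closure : (0 : V) ∈ closure C := by
  obtain ⟨P, hP⟩ := h.nonempty
  refine h.mem_closure_of_forall (P := P) fun ε hε => ?_
  rw [zero_add]
  exact h.smul_mem hε hP

theorem closure_smul {r : ℝ} {X : V} (hr : 0 ≤ r) (hX : X ∈ closure C) : r • X ∈ closure C := by
  rcases hr.eq_or_lt with rfl | hr
  · rw [zero_smul]
    exact h.zero_mem_closure
  · exact h.closure_smul_pos hr hX

theorem mem_of_interior {X P : V} (hP : P ∈ C) {ε : ℝ} (hε : 0 < ε)
    (hX : X - ε • P ∈ closure C) : X ∈ C := by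
  have := h.add_mem (h.smul_mem hε hP) hX
  rwa [add_sub_cancel] at this

/-- An interior point of the closure can be pushed back a little along -P; adding the P-part again
lands in C. This is what makes preserving C a closed condition in `isClosed_autCone`. -/
theorem interior_closure : interior (closure C) = C := by
  refine Set.Subset.antisymm (fun X hX => ?_) (interior_maximal subset_closure h.isOpen)
  obtain ⟨P, hP⟩ := h.nonempty
  have h1 : Tendsto (fun ε : ℝ => X + ε • (-P)) (𝓝[>] 0) (𝓝 X) := h.tendsto_add_smul X (-P)
  have h2 := (h1.eventually (isOpen_interior.mem_nhds hX)).and self_mem_nhdsWithin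
  obtain ⟨ε, h3, h4⟩ := h2.exists
  refine h.mem_of_interior hP h4 ?_
  have := interior_subset h3
  rwa [smul_neg, ← sub_eq_add_neg] at this

theorem trace_nonneg {X : V} (hX : X ∈ closure C) : 0 ≤ τ X := by
  rcases eq_or_ne X 0 with rfl | hX0
  · simp
  · exact (h.trace_pos hX hX0).le

theorem trace_pos' {X : V} (hX : X ∈ C) : 0 < τ X := h.trace_pos (subset_closure hX) (h.ne_zero hX)

theorem eq_zero_of_neg_mem {X : V} (hX : X ∈ closure C) (hX' : -X ∈ closure C) : X = 0 := by
  by_contra h0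
  have h1 := h.trace_pos hX h0
  have h2 := h.trace_nonneg hX'
  rw [map_neg] at h2
  linarith

theorem neg_notMem_closure {X : V} (hX : X ∈ C) : -X ∉ closure C := fun hX' =>
  h.ne_zero hX (h.eq_zero_of_neg_mem (subset_closure hX) hX')

theorem mem_of_smul_mem {r : ℝ} {X : V} (hr : 0 < r) (hX : r • X ∈ C) : X ∈ C := by
  have := h.smul_mem (inv_pos.mpr hr) hX
  rwa [inv_smul_smul₀ hr.ne'] at this

theorem chord_symm {A B : V} (c : IsChord C A B) : IsChord C B A :=
  ⟨c.2, c.1, c.4, c.3, by rw [add_comm]; exact c.5⟩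

theorem chord_left_ne_zero {A B : V} (c : IsChord C A B) : A ≠ 0 := by
  rintro rfl
  exact c.right_notMem (by simpa using c.add_mem)

/-- If α ≤ 0, adding -αA would leave βB in C, which is impossible for β > 0 because B is on the
boundary, and for β ≤ 0 because C contains no line. Conversely, min(α, β)(A + B) is in C and the
rest is in the closure. -/
theorem chord_comb_mem_iff {A B : V} (c : IsChord C A B) {α β : ℝ} :
    α • A + β • B ∈ C ↔ 0 < α ∧ 0 < β := by
  have key : ∀ {A B : V}, IsChord C A B → ∀ {α β : ℝ}, α • A + β • B ∈ C → 0 < α := by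
    intro A B c α β hm
    by_contra! hα
    have h1 : β • B ∈ C := by
      have := h.add_mem hm (h.closure_smul (neg_nonneg.mpr hα) c.left_mem)
      convert this using 1
      rw [neg_smul]
      abel
    rcases lt_or_ge 0 β with hβ | hβ
    · exact c.right_notMem (h.mem_of_smul_mem hβ h1)
    · refine h.neg_notMem_closure h1 ?_
      rw [← neg_smul]
      exact h.closure_smul (neg_nonneg.mpr hβ) c.right_mem
  constructor
  · intro hm
    refine ⟨key c hm, key (h.chord_symm c) (β := α) ?_⟩
    rwa [add_comm]
  · rintro ⟨hα, hβ⟩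
    have : α • A + β • B = (min α β) • (A + B) + ((α - min α β) • A + (β - min α β) • B) := by
      module
    rw [this]
    refine h.add_mem (h.smul_mem (lt_min hα hβ) c.add_mem) (h.closure_add ?_ ?_)
    · exact h.closure_smul (sub_nonneg.mpr (min_le_left _ _)) c.left_mem
    · exact h.closure_smul (sub_nonneg.mpr (min_le_right _ _)) c.right_mem

theorem chord_comb_closure {A B : V} (c : IsChord C A B) {α β : ℝ}
    (hm : α • A + β • B ∈ closure C) : 0 ≤ α ∧ 0 ≤ β := by
  have key : ∀ ε : ℝ, 0 < ε → 0 < α + ε ∧ 0 < β + ε := by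
    intro ε hε
    rw [← h.chord_comb_mem_iff c]
    have := (h.mem_closure_iff c.add_mem).mp hm ε hε
    convert this using 1
    module
  exact ⟨le_of_forall_pos_le_add fun ε hε => (key ε hε).1.le,
    le_of_forall_pos_le_add fun ε hε => (key ε hε).2.le⟩

theorem chord_smul {A B : V} (c : IsChord C A B) {α β : ℝ} (hα : 0 < α) (hβ : 0 < β) :
    IsChord C (α • A) (β • B) :=
  ⟨h.closure_smul hα.le c.1, h.closure_smul hβ.le c.2, fun hm => c.3 (h.mem_of_smul_mem hα hm),
    fun hm => c.4 (h.mem_of_smul_mem hβ hm), (h.chord_comb_mem_iff c).mpr ⟨hα, hβ⟩⟩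

/-- Zero is in the closed cone, so `chord_comb_closure` applies to a vanishing combination and to
its opposite. -/
theorem chord_linearIndependent {A B : V} (c : IsChord C A B) {α β : ℝ}
    (h0 : α • A + β • B = 0) : α = 0 ∧ β = 0 := by
  have h1 := h.chord_comb_closure c (by rw [h0]; exact h.zero_mem_closure)
  have h2 := h.chord_comb_closure c (α := -α) (β := -β) (by
    rw [neg_smul, neg_smul, ← neg_add, h0, neg_zero]; exact h.zero_mem_closure)
  constructor <;> linarith [h1.1, h1.2, h2.1, h2.2]

theorem chord_comb_eq {A B : V} (c : IsChord C A B) {α β α' β' : ℝ}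
    (h0 : α • A + β • B = α' • A + β' • B) : α = α' ∧ β = β' := by
  have := h.chord_linearIndependent c (α := α - α') (β := β - β') (by
    rw [← sub_eq_zero] at h0
    rw [← h0]
    module)
  constructor <;> linarith [this.1, this.2]

theorem mem_smul_of_autCone (g : AutCone C) {X : V} : g • X ∈ C ↔ X ∈ C := by
  have h1 : ((g : (V →L[ℝ] V)ˣ) • C) = C := g.2
  have h2 : (g : (V →L[ℝ] V)ˣ) • X ∈ ((g : (V →L[ℝ] V)ˣ) • C) ↔ X ∈ C :=
    Set.smul_mem_smul_set_iff
  rw [h1] at h2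
  exact h2

theorem mem_closure_smul_of_autCone (g : AutCone C) {X : V} : g • X ∈ closure C ↔ X ∈ closure C := by
  have key : ∀ (g : AutCone C) {X : V}, X ∈ closure C → g • X ∈ closure C := by
    intro g X hX
    exact map_mem_closure (continuous_const_smul g) hX fun Y hY => (h.mem_smul_of_autCone g).mpr hY
  refine ⟨fun hX => ?_, key g⟩
  have := key g⁻¹ hX
  rwa [inv_smul_smul] at this

theorem chord_autCone (g : AutCone C) {A B : V} (c : IsChord C A B) :
    IsChord C (g • A) (g • B) :=
  ⟨(h.mem_closure_smul_of_autCone g).mpr c.1, (h.mem_closure_smul_of_autCone g).mpr c.2,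
    fun hm => c.3 ((h.mem_smul_of_autCone g).mp hm),
    fun hm => c.4 ((h.mem_smul_of_autCone g).mp hm), by
      rw [← smul_add]; exact (h.mem_smul_of_autCone g).mpr c.5⟩

variable [Nontrivial V]

theorem dom_eq : dom C = pt '' C := by
  ext x
  constructor
  · rintro ⟨v, hv, hr⟩
    exact ⟨v, hv, (rep_iff.mp hr).2⟩
  · rintro ⟨v, hv, rfl⟩
    exact ⟨v, hv, rep_pt (h.ne_zero hv)⟩

theorem isOpen_dom : IsOpen (dom C) := by
  rw [h.dom_eq]
  exact isOpen_image_pt h.isOpen h.zero_notMem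

theorem pt_mem_dom {v : V} (hv : v ∈ C) : pt v ∈ dom C := by
  rw [h.dom_eq]
  exact ⟨v, hv, rfl⟩

theorem pt_mem_dom_iff {v : V} (hv : v ≠ 0) : pt v ∈ dom C ↔ v ∈ C ∨ -v ∈ C := by
  rw [h.dom_eq]
  constructor
  · rintro ⟨w, hw, hwv⟩
    obtain ⟨r, hr, rfl⟩ := (pt_eq_pt_iff (h.ne_zero hw) hv).mp hwv
    rcases lt_or_gt_of_ne hr with hr | hr
    · right
      refine h.mem_of_smul_mem (neg_pos.mpr hr) ?_
      rwa [neg_smul_neg]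
    · left
      exact h.mem_of_smul_mem hr hw
  · rintro (hv | hv)
    · exact ⟨v, hv, rfl⟩
    · refine ⟨-v, hv, ?_⟩
      rw [← neg_one_smul ℝ v]
      exact pt_smul (by norm_num) v

theorem pt_mem_closure_dom_iff {v : V} (hv : v ≠ 0) :
    pt v ∈ closure (dom C) ↔ v ∈ closure C ∨ -v ∈ closure C := by
  constructor
  · intro hm
    by_contra! hcon
    -- Off the two closed cones ±`closure C`, vectors form an open set whose image is a
    -- neighbourhood of [v] disjoint from Ω.
    set U : Set V := (closure C ∪ -closure C)ᶜ with hU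
    have hUo : IsOpen U := (isClosed_closure.union isClosed_closure.neg).isOpen_compl
    have h0 : (0 : V) ∉ U := by
      simp [hU, h.zero_mem_closure]
    have hvU : v ∈ U := by
      simp only [hU, Set.mem_compl_iff, Set.mem_union, Set.mem_neg, not_or]
      exact hcon
    obtain ⟨x, ⟨u, hu, rfl⟩, hx⟩ :=
      _root_.mem_closure_iff.mp hm _ (isOpen_image_pt hUo h0) ⟨v, hvU, rfl⟩
    have hu0 : u ≠ 0 := fun h' => h0 (h' ▸ hu)
    simp only [hU, Set.mem_compl_iff, Set.mem_union, Set.mem_neg, not_or] at hu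
    rcases (h.pt_mem_dom_iff hu0).mp hx with h1 | h1
    · exact hu.1 (subset_closure h1)
    · exact hu.2 (subset_closure h1)
  · have key : ∀ {v : V}, v ≠ 0 → v ∈ closure C → pt v ∈ closure (dom C) := by
      intro v hv hm
      have := mem_closure_image (continuousAt_pt hv) hm
      rwa [← h.dom_eq] at this
    rintro (hm | hm)
    · exact key hv hm
    · have := key (neg_ne_zero.mpr hv) hm
      rwa [← neg_one_smul ℝ v, pt_smul (by norm_num)] at this

theorem mem_frontier_iff {x : ℙ ℝ V} :
    x ∈ frontier (dom C) ↔ ∃ A, A ∈ closure C ∧ A ∉ C ∧ A ≠ 0 ∧ pt A = x := by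
  rw [frontier, h.isOpen_dom.interior_eq]
  constructor
  · rintro ⟨h1, h2⟩
    obtain ⟨v, hv, rfl⟩ := exists_pt x
    rw [h.pt_mem_closure_dom_iff hv] at h1
    rw [h.pt_mem_dom_iff hv] at h2
    push Not at h2
    rcases h1 with h1 | h1
    · exact ⟨v, h1, h2.1, hv, rfl⟩
    · refine ⟨-v, h1, h2.2, neg_ne_zero.mpr hv, ?_⟩
      rw [← neg_one_smul ℝ v]
      exact pt_smul (by norm_num) v
  · rintro ⟨A, h1, h2, h0, rfl⟩
    refine ⟨(h.pt_mem_closure_dom_iff h0).mpr (Or.inl h1), fun hm => ?_⟩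
    rcases (h.pt_mem_dom_iff h0).mp hm with h3 | h3
    · exact h2 h3
    · exact h0 (h.eq_zero_of_neg_mem h1 (subset_closure h3))

theorem chord_left_frontier {A B : V} (c : IsChord C A B) : pt A ∈ frontier (dom C) :=
  h.mem_frontier_iff.mpr ⟨A, c.1, c.3, h.chord_left_ne_zero c, rfl⟩

theorem chord_pt_ne {A B : V} (c : IsChord C A B) : pt A ≠ pt B := by
  intro he
  obtain ⟨r, hr, hA⟩ := (pt_eq_pt_iff (h.chord_left_ne_zero c)
    (h.chord_left_ne_zero (h.chord_symm c))).mp he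
  have := h.chord_linearIndependent c (α := 1) (β := -r) (by rw [hA]; module)
  exact one_ne_zero this.1

/-- Normalisation of representatives of a pair of points of the frontier whose line meets `Ω`. -/
theorem chord_of_frontier {A B : V} (hA : pt A ∈ frontier (dom C)) (hB : pt B ∈ frontier (dom C))
    (hA0 : A ≠ 0) (hB0 : B ≠ 0) (hAB : A + B ∈ C) : IsChord C A B := by
  have hA' : ∃ s : ℝ, s ≠ 0 ∧ s • A ∈ closure C ∧ s • A ∉ C := by
    obtain ⟨A', h1, h2, h3, h4⟩ := h.mem_frontier_iff.mp hA
    obtain ⟨r, hr, rfl⟩ := (pt_eq_pt_iff h3 hA0).mp h4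
    exact ⟨r, hr, h1, h2⟩
  have hB' : ∃ s : ℝ, s ≠ 0 ∧ s • B ∈ closure C ∧ s • B ∉ C := by
    obtain ⟨A', h1, h2, h3, h4⟩ := h.mem_frontier_iff.mp hB
    obtain ⟨r, hr, rfl⟩ := (pt_eq_pt_iff h3 hB0).mp h4
    exact ⟨r, hr, h1, h2⟩
  -- The frontier gives A and B only up to a nonzero scalar. If the scalar of A were negative, -A
  -- would be in the closure and B = (A + B) + (-A) in C, although some multiple of B is a boundary
  -- vector.
  have key : ∀ A B : V, A + B ∈ C → (∃ s : ℝ, s ≠ 0 ∧ s • A ∈ closure C ∧ s • A ∉ C) →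
      (∃ s : ℝ, s ≠ 0 ∧ s • B ∈ closure C ∧ s • B ∉ C) → A ∈ closure C ∧ A ∉ C := by
    rintro A B hAB ⟨r, hr, hA1, hA2⟩ ⟨s, hs, hB1, hB2⟩
    rcases lt_or_gt_of_ne hr with hr | hr
    · exfalso
      have hA3 : -A ∈ closure C := by
        have := h.closure_smul (r := (-r)⁻¹) (by rw [inv_nonneg]; linarith) hA1
        rwa [smul_smul, inv_neg, neg_mul, inv_mul_cancel₀ hr.ne, neg_one_smul] at this
      have hB3 : B ∈ C := by
        have := h.add_mem hAB hA3
        rwa [add_neg_cancel_comm] at this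
      rcases lt_or_gt_of_ne hs with hs | hs
      · refine h.neg_notMem_closure hB3 ?_
        have := h.closure_smul (r := (-s)⁻¹) (by rw [inv_nonneg]; linarith) hB1
        rwa [smul_smul, inv_neg, neg_mul, inv_mul_cancel₀ hs.ne, neg_one_smul] at this
      · exact hB2 (h.smul_mem hs hB3)
    · constructor
      · have := h.closure_smul (inv_nonneg.mpr hr.le) hA1
        rwa [inv_smul_smul₀ hr.ne'] at this
      · exact fun hm => hA2 (h.smul_mem hr hm)
  have h1 := key A B hAB hA' hB'
  have h2 := key B A (by rwa [add_comm]) hB' hA'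
  exact ⟨h1.1, h2.1, h1.2, h2.2, hAB⟩

end IsSharpCone

end Cone

end ConvProj

end

/-! ### Straight geodesics of the Hilbert metric are parametrised chords. -/

noncomputable section

set_option linter.unusedSectionVars false

namespace ConvProj

section Geodesics

variable {V : Type*} [NormedAddCommGroup V] [NormedSpace ℝ V] [Nontrivial V]

/-- The parametrised straight geodesic from `[A]` to `[B]` with footpoint `[A + B]`. -/
def chordGeod (A B : V) : ℝ → ℙ ℝ V := fun t => pt (Real.exp (-t) • A + Real.exp t • B)

theorem chordGeod_zero (A B : V) : chordGeod A B 0 = pt (A + B) := by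
  simp [chordGeod]

theorem chordGeod_eq (A B : V) (t : ℝ) : chordGeod A B t = pt (A + Real.exp (2 * t) • B) := by
  have : Real.exp (-t) • A + Real.exp t • B = Real.exp (-t) • (A + Real.exp (2 * t) • B) := by
    rw [smul_add, smul_smul, ← Real.exp_add]
    congr 3
    ring
  rw [chordGeod, this, pt_smul (Real.exp_pos _).ne']

theorem chordGeod_neg (A B : V) (t : ℝ) : chordGeod A B (-t) = chordGeod B A t := by
  rw [chordGeod, chordGeod, neg_neg, add_comm]

theorem geodFlow_chordGeod (A B : V) (t : ℝ) :
    geodFlow t (chordGeod A B) = chordGeod (Real.exp (-t) • A) (Real.exp t • B) := by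
  funext s
  simp only [geodFlow, chordGeod, smul_smul, ← Real.exp_add, neg_add]

namespace IsSharpCone

variable {C : Set V} {τ : V →L[ℝ] ℝ} (h : IsSharpCone C τ)
include h

theorem chordGeod_mem {A B : V} (c : IsChord C A B) (t : ℝ) :
    Real.exp (-t) • A + Real.exp t • B ∈ C :=
  (h.chord_comb_mem_iff c).mpr ⟨Real.exp_pos _, Real.exp_pos _⟩

theorem smul_chordGeod (g : AutCone C) {A B : V} (c : IsChord C A B) :
    (g : AutDom C) • chordGeod A B = chordGeod (g • A) (g • B) := by
  funext t
  change (g : AutDom C) • chordGeod A B t = _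
  rw [chordGeod, autDom_smul_pt g (h.ne_zero (h.chordGeod_mem c t)), chordGeod, smul_add,
    smul_comm g, smul_comm g]

theorem tendsto_chordGeod_atBot {A B : V} (c : IsChord C A B) :
    Tendsto (chordGeod A B) atBot (𝓝 (pt A)) := by
  have h1 : Tendsto (fun t : ℝ => A + Real.exp (2 * t) • B) atBot (𝓝 (A + (0 : ℝ) • B)) := by
    refine tendsto_const_nhds.add (Tendsto.smul_const ?_ B)
    exact Real.tendsto_exp_atBot.comp (tendsto_id.const_mul_atBot (by norm_num))
  rw [zero_smul, add_zero] at h1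
  have := (continuousAt_pt (h.chord_left_ne_zero c)).tendsto.comp h1
  refine this.congr fun t => ?_
  rw [chordGeod_eq]
  rfl

theorem tendsto_chordGeod_atTop {A B : V} (c : IsChord C A B) :
    Tendsto (chordGeod A B) atTop (𝓝 (pt B)) := by
  have := (h.tendsto_chordGeod_atBot (h.chord_symm c)).comp tendsto_neg_atTop_atBot
  refine this.congr fun t => ?_
  rw [Function.comp_apply, chordGeod_neg]

theorem hilbertDistEq_of_le {A B : V} (c : IsChord C A B) {ρ σ : ℝ} (hρ : 0 < ρ) (hσ : ρ ≤ σ) :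
    HilbertDistEq C (pt (A + ρ • B)) (pt (A + σ • B)) ((1 / 2) * Real.log (σ / ρ)) := by
  have key : ∀ {ρ : ℝ}, 0 < ρ → A + ρ • B ∈ C := by
    intro ρ hρ
    have := (h.chord_comb_mem_iff c (α := 1)).mpr ⟨one_pos, hρ⟩
    rwa [one_smul] at this
  have hσ0 := hρ.trans_le hσ
  refine ⟨h.pt_mem_dom (key hρ), h.pt_mem_dom (key hσ0), pt A, h.chord_left_frontier c, pt B,
    h.chord_left_frontier (h.chord_symm c), σ / ρ, (one_le_div hρ).mpr hσ, ?_, rfl⟩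
  -- With ρB as representative of the second end, the first point has parameter 1 and the second one
  -- σ/ρ.
  refine ⟨h.chord_pt_ne c, A, ρ • B, rep_pt (h.chord_left_ne_zero c), ?_, ?_, ?_⟩
  · rw [rep_iff]
    exact ⟨smul_ne_zero hρ.ne' (h.chord_left_ne_zero (h.chord_symm c)), pt_smul hρ.ne' _⟩
  · exact rep_pt (h.ne_zero (key hρ))
  · rw [smul_smul, div_mul_cancel₀ _ hρ.ne']
    exact rep_pt (h.ne_zero (key hσ0))

theorem HilbertDistEq_symm {x y : ℙ ℝ V} {d : ℝ} (hd : HilbertDistEq C x y d) :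
    HilbertDistEq C y x d := by
  obtain ⟨hx, hy, a, ha, b, hb, r, hr, ⟨hab, A, B, hA, hB, hAB, hAB'⟩, rfl⟩ := hd
  have hr0 : 0 < r := by linarith
  rw [rep_iff] at hA hB hAB hAB'
  refine ⟨hy, hx, b, hb, a, ha, r, hr, ⟨hab.symm, r • B, A, ?_, ?_, ?_, ?_⟩, rfl⟩
  · rw [rep_iff, pt_smul hr0.ne']
    exact ⟨smul_ne_zero hr0.ne' hB.1, hB.2⟩
  · rwa [rep_iff]
  · rwa [rep_iff, add_comm]
  · rw [rep_iff, ← smul_add, pt_smul hr0.ne', add_comm]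
    exact ⟨smul_ne_zero hr0.ne' hAB.1, hAB.2⟩

theorem exists_chord_of_hilbertDistEq {x y : ℙ ℝ V} {d : ℝ} (hd : HilbertDistEq C x y d) :
    ∃ A B : V, ∃ r : ℝ, IsChord C A B ∧ 1 ≤ r ∧ x = pt (A + B) ∧ y = pt (A + r • B) ∧
      d = (1 / 2) * Real.log r := by
  obtain ⟨hx, hy, a, ha, b, hb, r, hr, ⟨hab, A, B, hA, hB, hAB, hAB'⟩, rfl⟩ := hd
  rw [rep_iff] at hA hB hAB hAB'
  obtain ⟨hA0, rfl⟩ := hA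
  obtain ⟨hB0, rfl⟩ := hB
  obtain ⟨h0, rfl⟩ := hAB
  obtain ⟨-, rfl⟩ := hAB'
  have hneg : ∀ v : V, pt (-v) = pt v := fun v => by
    rw [← neg_one_smul ℝ v]
    exact pt_smul (by norm_num) v
  rcases (h.pt_mem_dom_iff h0).mp hx with h1 | h1
  · exact ⟨A, B, r, h.chord_of_frontier ha hb hA0 hB0 h1, hr, rfl, rfl, rfl⟩
  · refine ⟨-A, -B, r, h.chord_of_frontier ?_ ?_ (neg_ne_zero.mpr hA0) (neg_ne_zero.mpr hB0) ?_,
      hr, ?_, ?_, rfl⟩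
    · rwa [hneg]
    · rwa [hneg]
    · rwa [← neg_add]
    · rw [← neg_add, hneg]
    · rw [smul_neg, ← neg_add, hneg]

theorem chordGeod_mem_unitTangent {A B : V} (c : IsChord C A B) :
    chordGeod A B ∈ unitTangent C := by
  refine ⟨fun t => h.pt_mem_dom (h.chordGeod_mem c t), fun s t => ?_,
    Submodule.span ℝ (Set.range ![A, B]), ?_, fun t => ?_⟩
  · have key : ∀ s t : ℝ, s ≤ t → HilbertDistEq C (chordGeod A B s) (chordGeod A B t) (t - s) := by
      intro s t hst
      rw [chordGeod_eq, chordGeod_eq]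
      have := h.hilbertDistEq_of_le c (Real.exp_pos (2 * s))
        (Real.exp_le_exp.mpr (by linarith : 2 * s ≤ 2 * t))
      rw [← Real.exp_sub, Real.log_exp] at this
      convert this using 1
      ring
    rcases le_total s t with hst | hst
    · rw [abs_sub_comm, abs_of_nonneg (sub_nonneg.mpr hst)]
      exact key s t hst
    · rw [abs_of_nonneg (sub_nonneg.mpr hst)]
      exact h.HilbertDistEq_symm (key t s hst)
  · have hli : LinearIndependent ℝ ![A, B] :=
      LinearIndependent.pair_iff.mpr fun s t => h.chord_linearIndependent c
    rw [finrank_span_eq_card hli, Fintype.card_fin]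
  · rw [chordGeod, pt_submodule (h.ne_zero (h.chordGeod_mem c t)), Submodule.span_singleton_le_iff_mem]
    refine Submodule.add_mem _ (Submodule.smul_mem _ _ ?_) (Submodule.smul_mem _ _ ?_)
    · exact Submodule.subset_span ⟨0, rfl⟩
    · exact Submodule.subset_span ⟨1, rfl⟩

/-- The definition of the distance allows any a, b on the frontier, so they have to be identified
with the ends of the given chord. The points are distinct since d ≠ 0, hence A', B' are combinations
of A, B; being on the boundary, each has a zero coordinate. For d = 0 the line through the two
points would not be determined. -/
theorem log_ratio_of_hilbertDistEq {A B : V} (c : IsChord C A B) {ρ σ d : ℝ} (hρ : 0 < ρ)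
    (hσ : 0 < σ) (hd : HilbertDistEq C (pt (A + ρ • B)) (pt (A + σ • B)) d) (hd0 : d ≠ 0) :
    |(1 / 2) * Real.log σ - (1 / 2) * Real.log ρ| = d := by
  obtain ⟨A', B', r, c', hr, hx, hy, rfl⟩ := h.exists_chord_of_hilbertDistEq hd
  have hr1 : r ≠ 1 := by
    rintro rfl
    simp at hd0
  have hr0 : 0 < r := by linarith
  have hmem : ∀ {ρ : ℝ}, 0 < ρ → A + ρ • B ≠ 0 := by
    intro ρ hρ
    have := (h.chord_comb_mem_iff c (α := 1)).mpr ⟨one_pos, hρ⟩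
    rw [one_smul] at this
    exact h.ne_zero this
  have hmem' : ∀ {ρ : ℝ}, 0 < ρ → A' + ρ • B' ≠ 0 := by
    intro ρ hρ
    have := (h.chord_comb_mem_iff c' (α := 1)).mpr ⟨one_pos, hρ⟩
    rw [one_smul] at this
    exact h.ne_zero this
  obtain ⟨κ, hκ, e1⟩ := (pt_eq_pt_iff (h.ne_zero c'.add_mem) (hmem hρ)).mp hx.symm
  obtain ⟨κ', hκ', e2⟩ := (pt_eq_pt_iff (hmem' hr0) (hmem hσ)).mp hy.symm
  have hr1' : r - 1 ≠ 0 := sub_ne_zero.mpr hr1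
  -- coordinates of `A'` and `B'` in the basis `A, B`
  have eB : B' = ((r - 1)⁻¹ * (κ' - κ)) • A + ((r - 1)⁻¹ * (κ' * σ - κ * ρ)) • B := by
    have : (r - 1) • B' = (A' + r • B') - (A' + B') := by module
    rw [e1, e2] at this
    rw [← inv_smul_smul₀ hr1' B', this]
    module
  have eA : A' = (κ - (r - 1)⁻¹ * (κ' - κ)) • A +
      (κ * ρ - (r - 1)⁻¹ * (κ' * σ - κ * ρ)) • B := by
    have : A' = (A' + B') - B' := by module
    rw [this, e1, eB]
    module
  generalize (r - 1)⁻¹ * (κ' - κ) = γ at eA eB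
  generalize (r - 1)⁻¹ * (κ' * σ - κ * ρ) = δ at eA eB
  generalize κ - γ = α at eA
  generalize κ * ρ - δ = β at eA
  have f1 : κ = α + γ ∧ κ * ρ = β + δ := by
    apply h.chord_comb_eq c
    rw [mul_smul, ← smul_add, ← e1, eA, eB]
    module
  have f2 : κ' = α + r * γ ∧ κ' * σ = β + r * δ := by
    apply h.chord_comb_eq c
    rw [mul_smul, ← smul_add, ← e2, eA, eB]
    module
  have key : ∀ {α β : ℝ} {X : V}, X = α • A + β • B → X ∈ closure C → X ∉ C →
      0 ≤ α ∧ 0 ≤ β ∧ (α = 0 ∨ β = 0) := by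
    rintro α β X rfl h1 h2
    obtain ⟨h3, h4⟩ := h.chord_comb_closure c h1
    refine ⟨h3, h4, ?_⟩
    by_contra! h5
    exact h2 ((h.chord_comb_mem_iff c).mpr ⟨lt_of_le_of_ne h3 h5.1.symm, lt_of_le_of_ne h4 h5.2.symm⟩)
  obtain ⟨hα, hβ, hαβ⟩ := key eA c'.1 c'.3
  obtain ⟨hγ, hδ, hγδ⟩ := key eB c'.2 c'.4
  have hlog : 0 ≤ Real.log r := Real.log_nonneg hr
  -- If A' and B' were multiples of the same end, A' + B' would not be in C. The two remaining cases
  -- are the two orientations of the chord; the reversed one accounts for the absolute value.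
  rcases hαβ with rfl | rfl <;> rcases hγδ with rfl | rfl
  · exact absurd (by linarith [f1.1]) hκ
  · have hγ0 : γ ≠ 0 := by
      rintro rfl
      exact hκ (by linarith [f1.1])
    have g1 : γ * ρ = β := by
      have := f1.2
      rw [f1.1] at this
      linarith
    have g2 : r * γ * σ = β := by
      have := f2.2
      rw [f2.1] at this
      linarith
    have : ρ = r * σ := mul_left_cancel₀ hγ0 (by linarith)
    rw [this, Real.log_mul hr0.ne' hσ.ne', show (1 / 2) * Real.log σ - 1 / 2 * (Real.log r +
      Real.log σ) = - (1 / 2 * Real.log r) by ring, abs_neg, abs_of_nonneg (by positivity)]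
  · have hα0 : α ≠ 0 := by
      rintro rfl
      exact hκ (by linarith [f1.1])
    have g1 : α * ρ = δ := by
      have := f1.2
      rw [f1.1] at this
      linarith
    have g2 : α * σ = r * δ := by
      have := f2.2
      rw [f2.1] at this
      linarith
    have : σ = r * ρ := mul_left_cancel₀ hα0 (by rw [g2, ← g1]; ring)
    rw [this, Real.log_mul hr0.ne' hρ.ne', show 1 / 2 * (Real.log r + Real.log ρ) -
      (1 / 2) * Real.log ρ = (1 / 2 * Real.log r) by ring, abs_of_nonneg (by positivity)]
  · have := mul_ne_zero hκ hρ.ne'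
    exact absurd (by linarith [f1.2]) this

/-- The points c(0), c(1) are at distance 1, so they determine a chord with cross-ratio of logarithm
2. This chord spans the plane L of the geodesic, and half the logarithm of the coordinate ρ is an
isometric parameter on it. -/
theorem exists_chord_of_mem_unitTangent {c : ℝ → ℙ ℝ V} (hc : c ∈ unitTangent C) :
    ∃ A B, IsChord C A B ∧ c = chordGeod A B := by
  obtain ⟨h1, h2, L, hL, h3⟩ := hc
  obtain ⟨A, B, r, ch, hr, h0, h01, hd⟩ := h.exists_chord_of_hilbertDistEq (h2 0 1)
  have hlogr : Real.log r = 2 := by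
    norm_num at hd
    linarith
  have hr0 : 0 < r := by linarith
  have hr1 : r - 1 ≠ 0 := by
    intro hr1
    rw [sub_eq_zero] at hr1
    rw [hr1, Real.log_one] at hlogr
    norm_num at hlogr
  have hABL : A + B ∈ L := by
    have := h3 0
    rwa [h0, pt_submodule (h.ne_zero ch.add_mem), Submodule.span_singleton_le_iff_mem] at this
  have hArC : A + r • B ∈ C := by
    have := (h.chord_comb_mem_iff ch (α := 1)).mpr ⟨one_pos, hr0⟩
    rwa [one_smul] at this
  have hArL : A + r • B ∈ L := by
    have := h3 1
    rwa [h01, pt_submodule (h.ne_zero hArC), Submodule.span_singleton_le_iff_mem] at this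
  have hBL : B ∈ L := by
    have := L.smul_mem (r - 1)⁻¹ (L.sub_mem hArL hABL)
    rwa [show A + r • B - (A + B) = (r - 1) • B by module, inv_smul_smul₀ hr1] at this
  have hAL : A ∈ L := by
    have := L.sub_mem hABL hBL
    rwa [add_sub_cancel_right] at this
  have hspan : Submodule.span ℝ (Set.range ![A, B]) = L := by
    have : FiniteDimensional ℝ L := Module.finite_of_finrank_pos (by omega)
    refine Submodule.eq_of_le_of_finrank_eq ?_ ?_
    · rw [Submodule.span_le]
      rintro _ ⟨i, rfl⟩
      fin_cases i
      · exact hAL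
      · exact hBL
    · have hli : LinearIndependent ℝ ![A, B] :=
        LinearIndependent.pair_iff.mpr fun s t => h.chord_linearIndependent ch
      rw [finrank_span_eq_card hli, Fintype.card_fin, hL]
  have hex : ∀ t, ∃ ρ : ℝ, 0 < ρ ∧ c t = pt (A + ρ • B) := by
    intro t
    have ht := h1 t
    rw [h.dom_eq] at ht
    obtain ⟨v, hv, hvt⟩ := ht
    have hvL : v ∈ L := by
      have := h3 t
      rwa [← hvt, pt_submodule (h.ne_zero hv), Submodule.span_singleton_le_iff_mem] at this
    rw [← hspan, Matrix.range_cons, Matrix.range_cons, Matrix.range_empty, Set.union_empty,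
      Set.singleton_union, Submodule.mem_span_pair] at hvL
    obtain ⟨α, β, rfl⟩ := hvL
    obtain ⟨hα, hβ⟩ := (h.chord_comb_mem_iff ch).mp hv
    refine ⟨β / α, by positivity, ?_⟩
    rw [← hvt, ← pt_smul hα.ne' (A + (β / α) • B), smul_add, smul_smul, mul_div_cancel₀ _ hα.ne']
  choose ρ hρ hcρ using hex
  have hinj : ∀ {x y : ℝ}, 0 < x → 0 < y → pt (A + x • B) = pt (A + y • B) → x = y := by
    intro x y hx hy hxy
    have hmem : ∀ {ρ : ℝ}, 0 < ρ → A + ρ • B ≠ 0 := by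
      intro ρ hρ
      have := (h.chord_comb_mem_iff ch (α := 1)).mpr ⟨one_pos, hρ⟩
      rw [one_smul] at this
      exact h.ne_zero this
    obtain ⟨k, hk, e⟩ := (pt_eq_pt_iff (hmem hx) (hmem hy)).mp hxy
    have := h.chord_comb_eq ch (α := 1) (β := x) (α' := k) (β' := k * y) (by
      rw [one_smul, e]; module)
    rw [this.2, ← this.1, one_mul]
  have hρ0 : ρ 0 = 1 := hinj (hρ 0) one_pos (by rw [← hcρ, h0, one_smul])
  have hρ1 : ρ 1 = r := hinj (hρ 1) hr0 (by rw [← hcρ, h01])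
  have hiso : ∀ s t, |(1 / 2) * Real.log (ρ t) - (1 / 2) * Real.log (ρ s)| = |s - t| := by
    intro s t
    rcases eq_or_ne s t with rfl | hst
    · simp
    · refine h.log_ratio_of_hilbertDistEq ch (hρ s) (hρ t) ?_ (abs_ne_zero.mpr (sub_ne_zero.mpr hst))
      rw [← hcρ, ← hcρ]
      exact h2 s t
  refine ⟨A, B, ch, funext fun t => ?_⟩
  have i0 := hiso 0 t
  have i1 := hiso 1 t
  rw [hρ0, Real.log_one, mul_zero, sub_zero, zero_sub, abs_neg] at i0
  rw [hρ1, hlogr, abs_sub_comm 1 t] at i1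
  -- An isometry of the real line fixing 0 and 1 is the identity: subtract the squares of the two
  -- distances.
  have hlog : Real.log (ρ t) = 2 * t := by
    have q0 := sq_eq_sq_iff_abs_eq_abs _ _ |>.mpr i0
    have q1 := sq_eq_sq_iff_abs_eq_abs _ _ |>.mpr i1
    nlinarith
  rw [hcρ, chordGeod_eq, ← hlog, Real.exp_log (hρ t)]

theorem mem_unitTangent_iff {c : ℝ → ℙ ℝ V} :
    c ∈ unitTangent C ↔ ∃ A B, IsChord C A B ∧ c = chordGeod A B :=
  ⟨h.exists_chord_of_mem_unitTangent, by
    rintro ⟨A, B, ch, rfl⟩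
    exact h.chordGeod_mem_unitTangent ch⟩

theorem mem_geod_iff {p : ℙ ℝ V × ℙ ℝ V} :
    p ∈ geod C ↔ ∃ A B, IsChord C A B ∧ p = (pt A, pt B) := by
  constructor
  · rintro ⟨h1, h2, h3, z, hz, hzp⟩
    obtain ⟨A, a1, a2, a3, a4⟩ := h.mem_frontier_iff.mp h1
    obtain ⟨B, b1, b2, b3, b4⟩ := h.mem_frontier_iff.mp h2
    rw [h.dom_eq] at hz
    obtain ⟨v, hv, rfl⟩ := hz
    rw [pt_submodule (h.ne_zero hv), ← a4, ← b4, pt_submodule a3, pt_submodule b3,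
      Submodule.span_singleton_le_iff_mem, ← Submodule.span_union, Set.singleton_union,
      Submodule.mem_span_pair] at hzp
    obtain ⟨α, β, rfl⟩ := hzp
    have hβ : ∀ {X : V} {r : ℝ}, X ∉ C → r • X ∈ C → r < 0 := by
      intro X r h1 h2
      by_contra! h3
      rcases h3.eq_or_lt with rfl | h3
      · rw [zero_smul] at h2
        exact h.zero_notMem h2
      · exact h1 (h.mem_of_smul_mem h3 h2)
    have hα0 : α ≠ 0 := by
      rintro rfl
      rw [zero_smul, zero_add] at hv
      have := hβ b2 hv
      refine h.neg_notMem_closure hv ?_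
      rw [← neg_smul]
      exact h.closure_smul (by linarith) b1
    have hβ0 : β ≠ 0 := by
      rintro rfl
      rw [zero_smul, add_zero] at hv
      have := hβ a2 hv
      refine h.neg_notMem_closure hv ?_
      rw [← neg_smul]
      exact h.closure_smul (by linarith) a1
    -- The signs of α and β are left open here; `chord_of_frontier` settles them.
    refine ⟨α • A, β • B, h.chord_of_frontier ?_ ?_ (smul_ne_zero hα0 a3) (smul_ne_zero hβ0 b3) hv, ?_⟩
    · rwa [pt_smul hα0, a4]
    · rwa [pt_smul hβ0, b4]
    · rw [pt_smul hα0, pt_smul hβ0, a4, b4]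
  · rintro ⟨A, B, ch, rfl⟩
    have hA := h.chord_left_ne_zero ch
    have hB := h.chord_left_ne_zero (h.chord_symm ch)
    refine ⟨h.chord_left_frontier ch, h.chord_left_frontier (h.chord_symm ch), h.chord_pt_ne ch,
      pt (A + B), h.pt_mem_dom ch.add_mem, ?_⟩
    rw [pt_submodule (h.ne_zero ch.add_mem), pt_submodule hA, pt_submodule hB,
      Submodule.span_singleton_le_iff_mem, ← Submodule.span_union, Set.singleton_union,
      Submodule.mem_span_pair]
    exact ⟨1, 1, by simp⟩

end IsSharpCone

end Geodesics

end ConvProj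

end

/-! ### Aut(Ω) acts properly on Ω. -/

noncomputable section

set_option linter.unusedSectionVars false

namespace ConvProj

/-- The units carry the topology of the closed embedding u ↦ (u, u⁻¹), so both u and its inverse
have to be bounded. -/
theorem isCompact_units_of_norm_le {A : Type*} [NormedRing A] [ProperSpace A] {S : Set Aˣ}
    (hS : IsClosed S) (M : ℝ) (h1 : ∀ u ∈ S, ‖(u : A)‖ ≤ M) (h2 : ∀ u ∈ S, ‖((u⁻¹ : Aˣ) : A)‖ ≤ M) :
    IsCompact S := by
  have hK : IsCompact ((Metric.closedBall (0 : A) M) ×ˢ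
      (MulOpposite.op '' Metric.closedBall (0 : A) M)) :=
    (isCompact_closedBall _ _).prod
      ((isCompact_closedBall _ _).image MulOpposite.continuous_op)
  refine (Units.isClosedEmbedding_embedProduct.isCompact_preimage hK).of_isClosed_subset hS ?_
  intro u hu
  refine ⟨mem_closedBall_zero_iff.mpr (h1 u hu), ((u⁻¹ : Aˣ) : A),
    mem_closedBall_zero_iff.mpr (h2 u hu), rfl⟩

section Proper

variable {V : Type*} [NormedAddCommGroup V] [NormedSpace ℝ V]

namespace IsSharpCone

variable {C : Set V} {τ : V →L[ℝ] ℝ} (h : IsSharpCone C τ)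
include h

/-- The homotheties of positive ratio. -/
theorem exists_homothety {r : ℝ} (hr : 0 < r) : ∃ g : AutCone C, g ∈ homotheties C ∧
    ∀ X : V, g • X = r • X := by
  set u : (V →L[ℝ] V)ˣ := Units.map (algebraMap ℝ (V →L[ℝ] V)).toMonoidHom (Units.mk0 r hr.ne')
    with hu
  have hux : ∀ X : V, u • X = r • X := fun X => rfl
  have hu' : u ∈ AutCone C := by
    change u • C = C
    ext X
    rw [Set.mem_smul_set]
    constructor
    · rintro ⟨Y, hY, rfl⟩
      rw [hux]
      exact h.smul_mem hr hY
    · intro hX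
      refine ⟨r⁻¹ • X, h.smul_mem (inv_pos.mpr hr) hX, ?_⟩
      rw [hux, smul_inv_smul₀ hr.ne']
  exact ⟨⟨u, hu'⟩, ⟨r, hr.ne', hux⟩, hux⟩

/-- Any two points of an open cone dominate each other up to a factor, and the same factor works
nearby; compactness makes it uniform. -/
theorem exists_bounds_of_isCompact {K : Set V} (hK : IsCompact K) (hKC : K ⊆ C) {P : V}
    (hP : P ∈ C) : ∃ c : ℝ, 0 < c ∧ ∀ X ∈ K, c • X - P ∈ C ∧ c • P - X ∈ C := by
  have hmono : ∀ {c c' : ℝ} {X Y : V}, c ≤ c' → X ∈ C → c • X - Y ∈ C → c' • X - Y ∈ C := by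
    intro c c' X Y hc hX hY
    have := h.add_mem hY (h.closure_smul (sub_nonneg.mpr hc) (subset_closure hX))
    convert this using 1
    module
  refine IsCompact.induction_on hK (p := fun S : Set V => ∃ c : ℝ, 0 < c ∧ ∀ X ∈ S, X ∈ C →
      c • X - P ∈ C ∧ c • P - X ∈ C) ⟨1, one_pos, fun X hX => absurd hX (Set.notMem_empty X)⟩
      ?_ ?_ ?_ |>.imp fun c hc => ⟨hc.1, fun X hX => hc.2 X hX (hKC hX)⟩
  · rintro s t hst ⟨c, hc, hct⟩
    exact ⟨c, hc, fun X hX => hct X (hst hX)⟩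
  · rintro s t ⟨c, hc, hcs⟩ ⟨c', hc', hct⟩
    refine ⟨max c c', lt_max_of_lt_left hc, ?_⟩
    rintro X (hX | hX) hXC
    · exact ⟨hmono (le_max_left _ _) hXC (hcs X hX hXC).1,
        hmono (le_max_left _ _) hP (hcs X hX hXC).2⟩
    · exact ⟨hmono (le_max_right _ _) hXC (hct X hX hXC).1,
        hmono (le_max_right _ _) hP (hct X hX hXC).2⟩
  · intro X hX
    have hXC := hKC hX
    have key : ∀ {X Y : V}, X ∈ C → ∃ c : ℝ, 0 < c ∧ c • X - Y ∈ C := by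
      intro X Y hX
      have h1 : Tendsto (fun ε : ℝ => X + ε • (-Y)) (𝓝[>] 0) (𝓝 X) := h.tendsto_add_smul X (-Y)
      obtain ⟨ε, h2, h3⟩ := ((h1.eventually (h.isOpen.mem_nhds hX)).and self_mem_nhdsWithin).exists
      have h3 : 0 < ε := h3
      refine ⟨ε⁻¹, inv_pos.mpr h3, ?_⟩
      have := h.smul_mem (inv_pos.mpr h3) h2
      rwa [smul_add, smul_neg, smul_neg, inv_smul_smul₀ h3.ne', ← sub_eq_add_neg] at this
    obtain ⟨c, hc, h1⟩ := key (Y := P) hXC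
    obtain ⟨c', hc', h2⟩ := key (Y := X) hP
    have e1 : ∀ᶠ Y in 𝓝 X, c • Y - P ∈ C :=
      (Continuous.continuousAt (by fun_prop)).eventually (h.isOpen.mem_nhds h1)
    have e2 : ∀ᶠ Y in 𝓝 X, c' • P - Y ∈ C :=
      (Continuous.continuousAt (by fun_prop)).eventually (h.isOpen.mem_nhds h2)
    refine ⟨_, mem_nhdsWithin_of_mem_nhds (e1.and e2), max c c', lt_max_of_lt_left hc, ?_⟩
    rintro Y ⟨h3, h4⟩ hY
    exact ⟨hmono (le_max_left _ _) hY h3, hmono (le_max_right _ _) hP h4⟩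

/-- Preserving the open set C is not visibly a closed condition, but preserving its closure, by g
and g⁻¹, is; and C is the interior of its closure. -/
theorem isClosed_autCone : IsClosed ((AutCone C : Subgroup (V →L[ℝ] V)ˣ) : Set (V →L[ℝ] V)ˣ) := by
  have : ((AutCone C : Subgroup (V →L[ℝ] V)ˣ) : Set (V →L[ℝ] V)ˣ) =
      ⋂ X ∈ closure C, {g : (V →L[ℝ] V)ˣ | (g : V →L[ℝ] V) X ∈ closure C} ∩
        {g : (V →L[ℝ] V)ˣ | ((g⁻¹ : (V →L[ℝ] V)ˣ) : V →L[ℝ] V) X ∈ closure C} := by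
    ext g
    simp only [SetLike.mem_coe, Set.mem_iInter, Set.mem_inter_iff, Set.mem_ofPred_eq]
    constructor
    · intro hg X hX
      exact ⟨(h.mem_closure_smul_of_autCone ⟨g, hg⟩).mpr hX,
        (h.mem_closure_smul_of_autCone ⟨g, hg⟩⁻¹).mpr hX⟩
    · intro hg
      have h1 : g • closure C = closure C := by
        ext X
        rw [Set.mem_smul_set_iff_inv_smul_mem]
        refine ⟨fun hX => ?_, fun hX => (hg X hX).2⟩
        have := (hg _ hX).1
        change g • g⁻¹ • X ∈ closure C at this
        rwa [smul_inv_smul] at this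
      change g • C = C
      rw [← h.interior_closure]
      conv_rhs => rw [← h1]
      exact (interior_smul g (closure C)).symm
  rw [this]
  refine isClosed_biInter fun X _ => IsClosed.inter ?_ ?_
  · refine isClosed_closure.preimage ?_
    exact Units.continuous_val.clm_apply continuous_const
  · refine isClosed_closure.preimage ?_
    exact (Units.continuous_val.comp continuous_inv).clm_apply continuous_const

variable [FiniteDimensional ℝ V]

/-- The form τ has a positive minimum on the unit vectors of the closed cone, which form a compact
set. -/
theorem exists_norm_le_trace : ∃ K : ℝ, 0 ≤ K ∧ ∀ X ∈ closure C, ‖X‖ ≤ K * τ X := by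
  have hcomp : IsCompact (closure C ∩ Metric.sphere (0 : V) 1) :=
    (isCompact_sphere _ _).inter_left isClosed_closure
  rcases (closure C ∩ Metric.sphere (0 : V) 1).eq_empty_or_nonempty with he | hne
  · refine ⟨0, le_rfl, fun X hX => ?_⟩
    by_contra! hX'
    rw [zero_mul, norm_pos_iff] at hX'
    have : (‖X‖⁻¹ • X) ∈ closure C ∩ Metric.sphere (0 : V) 1 :=
      ⟨h.closure_smul (by positivity) hX, by simp [norm_smul, hX']⟩
    rw [he] at this
    exact this
  · obtain ⟨Y, hY, hmin⟩ := hcomp.exists_isMinOn hne τ.continuous.continuousOn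
    have hY0 : Y ≠ 0 := by
      rintro rfl
      simpa using hY.2
    have hτ := h.trace_pos hY.1 hY0
    refine ⟨(τ Y)⁻¹, by positivity, fun X hX => ?_⟩
    rcases eq_or_ne X 0 with rfl | hX0
    · simp
    have : (‖X‖⁻¹ • X) ∈ closure C ∩ Metric.sphere (0 : V) 1 :=
      ⟨h.closure_smul (by positivity) hX, by simp [norm_smul, hX0]⟩
    have h1 : τ Y ≤ τ (‖X‖⁻¹ • X) := hmin this
    have hX1 : 0 < ‖X‖ := norm_pos_iff.mpr hX0
    rw [map_smul, smul_eq_mul, le_inv_mul_iff₀ hX1] at h1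
    rw [le_inv_mul_iff₀ hτ]
    linarith

/-- A set of automorphisms which distort a point of the cone by a bounded amount is compact. -/
theorem isCompact_bounded_autCone {P : V} (hP : P ∈ C) (c : ℝ) :
    IsCompact {g : AutCone C | c • P - g • P ∈ closure C ∧ c • P - g⁻¹ • P ∈ closure C} := by
  obtain ⟨K, hK0, hK⟩ := h.exists_norm_le_trace
  obtain ⟨ε, hε, hball⟩ := Metric.isOpen_iff.mp h.isOpen P hP
  have hbound : ∀ g : AutCone C, c • P - g • P ∈ closure C →
      ‖((g : (V →L[ℝ] V)ˣ) : V →L[ℝ] V)‖ ≤ |K * (c * τ P)| / (ε / 4) := by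
    intro g hg
    -- It is enough to treat the shell ε/4 ≤ ‖Z‖ < ε/2, where P ± Z is in C. Then cP ± gZ are in the
    -- closed cone, so their norms are bounded by their traces, whose sum is 2cτ(P); gZ is half
    -- their difference.
    refine ContinuousLinearMap.opNorm_le_of_shell' (ε := ε / 2) (by positivity) (by positivity)
      (c := (1 / 2 : ℝ)) (by norm_num) fun Z hZ1 hZ2 => ?_
    rw [← autCone_smul_def]
    have hpm : ∀ Z : V, ‖Z‖ < ε → c • P + g • Z ∈ closure C := by
      intro Z hZ
      have h1 : P + Z ∈ C := hball (by simpa using hZ)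
      have h2 := h.closure_add hg (subset_closure ((h.mem_smul_of_autCone g).mpr h1))
      rw [smul_add] at h2
      convert h2 using 1
      abel
    have h1 := hpm Z (by linarith)
    have h2 := hpm (-Z) (by rw [norm_neg]; linarith)
    have h3 := hK _ h1
    have h4 := hK _ h2
    have h5 : g • Z = (1 / 2 : ℝ) • ((c • P + g • Z) - (c • P + g • (-Z))) := by
      rw [smul_neg]
      generalize g • Z = W
      module
    have h6 : ‖g • Z‖ ≤ K * (c * τ P) := by
      rw [h5, norm_smul]
      have := norm_sub_le (c • P + g • Z) (c • P + g • (-Z))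
      have h7 : τ (c • P + g • Z) + τ (c • P + g • (-Z)) = 2 * (c * τ P) := by
        rw [smul_neg, map_add, map_add, map_neg, map_smul, smul_eq_mul]
        ring
      rw [Real.norm_of_nonneg (by norm_num : (0 : ℝ) ≤ 1 / 2)]
      have h8 : K * τ (c • P + g • Z) + K * τ (c • P + g • (-Z)) = 2 * (K * (c * τ P)) := by
        rw [← mul_add, h7]
        ring
      linarith
    have hZ3 : ε / 2 / 2 ≤ ‖Z‖ := by
      rw [Real.norm_of_nonneg (by norm_num : (0 : ℝ) ≤ 1 / 2)] at hZ1
      linarith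
    calc ‖g • Z‖ ≤ |K * (c * τ P)| := h6.trans (le_abs_self _)
      _ = |K * (c * τ P)| / (ε / 4) * (ε / 4) := by field_simp
      _ ≤ |K * (c * τ P)| / (ε / 4) * ‖Z‖ := by
        refine mul_le_mul_of_nonneg_left (by linarith) (by positivity)
  have hcl : IsClosed {g : AutCone C | c • P - g • P ∈ closure C ∧ c • P - g⁻¹ • P ∈ closure C} := by
    refine IsClosed.and ?_ ?_
    · exact isClosed_closure.preimage (by fun_prop)
    · exact isClosed_closure.preimage (by fun_prop)
  have hemb : IsClosedEmbedding (Subtype.val : AutCone C → (V →L[ℝ] V)ˣ) :=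
    h.isClosed_autCone.isClosedEmbedding_subtypeVal
  rw [hemb.isInducing.isCompact_iff]
  refine isCompact_units_of_norm_le (hemb.isClosedMap _ hcl) (|K * (c * τ P)| / (ε / 4)) ?_ ?_
  · rintro _ ⟨g, hg, rfl⟩
    exact hbound g hg.1
  · rintro _ ⟨g, hg, rfl⟩
    exact hbound g⁻¹ hg.2

theorem isCompact_slice : IsCompact {X ∈ closure C | τ X = 1} := by
  obtain ⟨K, hK0, hK⟩ := h.exists_norm_le_trace
  refine (isCompact_closedBall (0 : V) K).of_isClosed_subset ?_ ?_
  · exact isClosed_closure.and (isClosed_eq τ.continuous continuous_const)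
  · rintro X ⟨h1, h2⟩
    have := hK X h1
    rw [h2, mul_one] at this
    simpa using this

variable [Nontrivial V]

theorem slice_ne_zero {X : V} (hX : τ X = 1) : X ≠ 0 := by
  rintro rfl
  simp at hX

theorem pt_injOn_slice {X Y : V} (hX : τ X = 1) (hY : τ Y = 1) (hXY : pt X = pt Y) : X = Y := by
  obtain ⟨r, hr, rfl⟩ := (pt_eq_pt_iff (h.slice_ne_zero hX) (h.slice_ne_zero hY)).mp hXY
  rw [map_smul, hY, smul_eq_mul, mul_one] at hX
  rw [hX, one_smul]

theorem exists_slice {X : V} (hX : X ∈ closure C) (hX0 : X ≠ 0) :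
    (τ X)⁻¹ • X ∈ closure C ∧ τ ((τ X)⁻¹ • X) = 1 ∧ pt ((τ X)⁻¹ • X) = pt X := by
  have := h.trace_pos hX hX0
  refine ⟨h.closure_smul (by positivity) hX, ?_, pt_smul (by positivity) _⟩
  rw [map_smul, smul_eq_mul, inv_mul_cancel₀ this.ne']

/-- `Aut(Ω)` acts properly on `Ω`. -/
theorem exists_isCompact_autDom {L : Set (ℙ ℝ V)} (hL : IsCompact L) (hLC : L ⊆ dom C) :
    ∃ T : Set (AutDom C), IsCompact T ∧ ∀ g : AutDom C, (∃ x ∈ L, g • x ∈ L) → g ∈ T := by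
  set K : Set V := {X ∈ closure C | τ X = 1} ∩ pt ⁻¹' L with hKdef
  have hKcomp : IsCompact K := by
    refine h.isCompact_slice.of_isClosed_subset ?_ Set.inter_subset_left
    refine ContinuousOn.preimage_isClosed_of_isClosed ?_ h.isCompact_slice.isClosed hL.isClosed
    exact continuousOn_pt.mono fun X hX => h.slice_ne_zero hX.2
  have hKC : K ⊆ C := by
    rintro X ⟨⟨h1, h2⟩, h3⟩
    rcases (h.pt_mem_dom_iff (h.slice_ne_zero h2)).mp (hLC h3) with h4 | h4
    · exact h4
    · exact absurd (h.eq_zero_of_neg_mem h1 (subset_closure h4)) (h.slice_ne_zero h2)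
  have hlift : ∀ x ∈ L, ∃ X ∈ K, pt X = x := by
    intro x hx
    have hxd := hLC hx
    rw [h.dom_eq] at hxd
    obtain ⟨X, hX, rfl⟩ := hxd
    obtain ⟨h1, h2, h3⟩ := h.exists_slice (subset_closure hX) (h.ne_zero hX)
    refine ⟨(τ X)⁻¹ • X, ⟨⟨h1, h2⟩, ?_⟩, h3⟩
    rwa [Set.mem_preimage, h3]
  obtain ⟨P, hP⟩ := h.nonempty
  obtain ⟨c, hc, hcK⟩ := h.exists_bounds_of_isCompact hKcomp hKC hP
  -- In the order of the cone, if Y = gX with X, Y in K, then gP ≤ c gX = cY ≤ c²P; hence the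
  -- constant `c * c`.
  refine ⟨_, (h.isCompact_bounded_autCone hP (c * c)).image continuous_quotient_mk', ?_⟩
  rintro g ⟨x, hx, hgx⟩
  obtain ⟨g, rfl⟩ := QuotientGroup.mk_surjective g
  obtain ⟨X, hX, rfl⟩ := hlift x hx
  obtain ⟨Y, hY, hYX⟩ := hlift _ hgx
  have hXC := hKC hX
  have hYC := hKC hY
  have hgX : g • X ∈ C := (h.mem_smul_of_autCone g).mpr hXC
  rw [autDom_smul_pt g (h.ne_zero hXC)] at hYX
  obtain ⟨r, hr, hYr⟩ := (pt_eq_pt_iff (h.ne_zero hYC) (h.ne_zero hgX)).mp hYX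
  have hr0 : 0 < r := by
    by_contra! hr0
    have h1 : -Y ∈ closure C := by
      rw [hYr, ← neg_smul]
      exact h.closure_smul (neg_nonneg.mpr hr0) (subset_closure hgX)
    exact h.neg_notMem_closure hYC h1
  -- A homothety is trivial in Aut(Ω), so g can be corrected to send X exactly to Y.
  obtain ⟨k, hk, hkX⟩ := h.exists_homothety hr0
  have hkg : (k * g) • X = Y := by rw [mul_smul, hkX, hYr]
  have hkg' : (k * g)⁻¹ • Y = X := by rw [inv_smul_eq_iff, hkg]
  have key : ∀ (g : AutCone C) {X Y : V}, X ∈ K → Y ∈ K → g • X = Y →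
      (c * c) • P - g • P ∈ closure C := by
    intro g X Y hX hY hgX
    have h1 := (h.mem_closure_smul_of_autCone g).mpr (subset_closure (hcK X hX).1)
    have h2 := h.closure_smul hc.le (subset_closure (hcK Y hY).2)
    have h3 := h.closure_add h1 h2
    rw [smul_sub, smul_comm g c X, hgX, smul_sub, smul_smul] at h3
    convert h3 using 1
    abel
  refine ⟨k * g, ⟨key _ hX hY hkg, key _ hY hX hkg'⟩, ?_⟩
  change ((k * g : AutCone C) : AutDom C) = (g : AutDom C)
  rw [QuotientGroup.mk_mul, (QuotientGroup.eq_one_iff k).mpr hk, one_mul]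

end IsSharpCone

end Proper

end ConvProj

end

/-! ### Symmetric cones, and a norm built from the volume of order intervals. -/

noncomputable section

set_option linter.unusedSectionVars false

namespace ConvProj

section Volume

variable {V : Type*} [NormedAddCommGroup V] [NormedSpace ℝ V]

/-- The identity component of `Aut(C)`. -/
abbrev autConeId (C : Set V) : Subgroup (AutCone C) := Subgroup.connectedComponentOfOne (AutCone C)

/-- A sharp cone `C` with a "diagonal" subspace, such that all vectors are diagonalizable by
automorphisms in the identity component fixing `dg 1`, and a compatible notion `rk` of rank. -/
structure SymCone (C : Set V) (N : ℕ) (dg : (Fin N → ℝ) →ₗ[ℝ] V) (τ : V →L[ℝ] ℝ)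
    (rk : V → ℕ → Prop) : Prop extends IsSharpCone C τ where
  dg_mem : ∀ l, dg l ∈ C ↔ ∀ i, 0 < l i
  dg_mem_closure : ∀ l, dg l ∈ closure C ↔ ∀ i, 0 ≤ l i
  spectral : ∀ X, ∃ g ∈ autConeId C, g • dg 1 = dg 1 ∧ ∃ l, g • dg l = X ∧
    ((∀ i, 0 ≤ l i) → ∀ r, rk X r ↔ (Finset.univ.filter fun i => l i ≠ 0).card = r)
  scale : ∀ d : Fin N → ℝ, (∀ i, 0 < d i) → ∃ g ∈ autConeId C, ∀ l, g • dg l = dg (d * l)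
  perm : ∀ σ : Equiv.Perm (Fin N), ∃ g ∈ autConeId C, ∀ l, g • dg l = dg (l ∘ σ)
  rk_smul : ∀ X r (c : ℝ), c ≠ 0 → (rk (c • X) r ↔ rk X r)

/-- The order interval between `0` and `X`. -/
def orderInterval (C : Set V) (X : V) : Set V := {Y | Y ∈ C ∧ X - Y ∈ C}

/-- The volume of the order interval between `0` and `X`. -/
def orderVol (C : Set V) [FiniteDimensional ℝ V] [MeasurableSpace V] [BorelSpace V] (X : V) : ℝ :=
  ((MeasureTheory.Measure.addHaar : MeasureTheory.Measure V) (orderInterval C X)).toReal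

/-- The determinant of a linear automorphism. -/
def autDet {C : Set V} (g : AutCone C) : ℝ :=
  |LinearMap.det (((g : (V →L[ℝ] V)ˣ) : V →L[ℝ] V) : V →ₗ[ℝ] V)|

theorem autDet_pos {C : Set V} (g : AutCone C) : 0 < autDet g := by
  rw [autDet, abs_pos]
  intro h0
  have h1 : LinearMap.det (((g : (V →L[ℝ] V)ˣ) : V →L[ℝ] V) : V →ₗ[ℝ] V) *
      LinearMap.det ((((g⁻¹ : AutCone C) : (V →L[ℝ] V)ˣ) : V →L[ℝ] V) : V →ₗ[ℝ] V) = 1 := by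
    rw [← LinearMap.det_comp]
    convert LinearMap.det_id
    ext X
    exact smul_inv_smul g X
  rw [h0, zero_mul] at h1
  exact zero_ne_one h1

namespace IsSharpCone

variable {C : Set V} {τ : V →L[ℝ] ℝ} (h : IsSharpCone C τ)
  [FiniteDimensional ℝ V] [MeasurableSpace V] [BorelSpace V]
include h

theorem orderInterval_lt_top (X : V) :
    (MeasureTheory.Measure.addHaar : MeasureTheory.Measure V) (orderInterval C X) < ⊤ := by
  obtain ⟨K, hK0, hK⟩ := h.exists_norm_le_trace
  refine Bornology.IsBounded.measure_lt_top ?_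
  refine (Metric.isBounded_closedBall (x := (0 : V)) (r := K * τ X)).subset ?_
  rintro Y ⟨h1, h2⟩
  rw [mem_closedBall_zero_iff]
  refine (hK Y (subset_closure h1)).trans (mul_le_mul_of_nonneg_left ?_ hK0)
  have := h.trace_pos' h2
  rw [map_sub] at this
  linarith

theorem orderVol_pos {X : V} (hX : X ∈ C) : 0 < orderVol C X := by
  refine ENNReal.toReal_pos (ne_of_gt ?_) (h.orderInterval_lt_top X).ne
  refine IsOpen.measure_pos _ ?_ ⟨(1 / 2 : ℝ) • X, h.smul_mem (by norm_num) hX, ?_⟩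
  · exact h.isOpen.and (h.isOpen.preimage (by fun_prop : Continuous fun Y => X - Y))
  · rw [show X - (1 / 2 : ℝ) • X = (1 / 2 : ℝ) • X by module]
    exact h.smul_mem (by norm_num) hX

theorem orderVol_mono {X Y : V} (hXY : Y - X ∈ closure C) : orderVol C X ≤ orderVol C Y := by
  refine ENNReal.toReal_mono (h.orderInterval_lt_top Y).ne (MeasureTheory.measure_mono ?_)
  rintro Z ⟨h1, h2⟩
  refine ⟨h1, ?_⟩
  have := h.add_mem h2 hXY
  rwa [sub_add_sub_cancel'] at this

/-- Automorphisms carry order intervals to order intervals. The volume is thus a relative invariant,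
available without any determinant of matrices. -/
theorem orderVol_smul_aut (g : AutCone C) (X : V) :
    orderVol C (g • X) = autDet g * orderVol C X := by
  have : orderInterval C (g • X) =
      (((g : (V →L[ℝ] V)ˣ) : V →L[ℝ] V) : V →ₗ[ℝ] V) '' orderInterval C X := by
    ext Y
    constructor
    · rintro ⟨h1, h2⟩
      refine ⟨g⁻¹ • Y, ⟨(h.mem_smul_of_autCone g⁻¹).mpr h1, ?_⟩, smul_inv_smul g Y⟩
      have := (h.mem_smul_of_autCone g⁻¹).mpr h2
      rwa [smul_sub, inv_smul_smul] at this
    · rintro ⟨Z, ⟨h1, h2⟩, rfl⟩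
      refine ⟨(h.mem_smul_of_autCone g).mpr h1, ?_⟩
      have := (h.mem_smul_of_autCone g).mpr h2
      rwa [smul_sub] at this
  rw [orderVol, this, MeasureTheory.Measure.addHaar_image_linearMap, ENNReal.toReal_mul,
    ENNReal.toReal_ofReal (abs_nonneg _)]
  rfl

theorem orderVol_smul {r : ℝ} (hr : 0 < r) (X : V) :
    orderVol C (r • X) = r ^ Module.finrank ℝ V * orderVol C X := by
  have : orderInterval C (r • X) = r • orderInterval C X := by
    ext Y
    rw [Set.mem_smul_set_iff_inv_smul_mem₀ hr.ne']
    constructor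
    · rintro ⟨h1, h2⟩
      refine ⟨h.smul_mem (inv_pos.mpr hr) h1, ?_⟩
      have := h.smul_mem (inv_pos.mpr hr) h2
      rwa [smul_sub, inv_smul_smul₀ hr.ne'] at this
    · rintro ⟨h1, h2⟩
      refine ⟨h.mem_of_smul_mem (inv_pos.mpr hr) h1, ?_⟩
      have := h.smul_mem hr h2
      rwa [smul_sub, smul_inv_smul₀ hr.ne'] at this
  rw [orderVol, this, MeasureTheory.Measure.addHaar_smul, ENNReal.toReal_mul,
    ENNReal.toReal_ofReal (abs_nonneg _), abs_of_nonneg (by positivity)]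
  rfl

end IsSharpCone

/-- The generic norm of a vector, normalised to be `1` at `P`. -/
def coneNorm (C : Set V) [FiniteDimensional ℝ V] [MeasurableSpace V] [BorelSpace V] (N : ℕ) (P : V)
    (X : V) : ℝ :=
  (orderVol C X / orderVol C P) ^ ((N : ℝ) / Module.finrank ℝ V)

namespace SymCone

variable {C : Set V} {N : ℕ} {dg : (Fin N → ℝ) →ₗ[ℝ] V} {τ : V →L[ℝ] ℝ} {rk : V → ℕ → Prop}
  (h : SymCone C N dg τ rk)
include h

theorem one_mem : dg 1 ∈ C := (h.dg_mem 1).mpr fun _ => one_pos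

theorem nontrivial : Nontrivial V := ⟨dg 1, 0, h.ne_zero h.one_mem⟩

theorem N_pos : 0 < N := by
  rcases Nat.eq_zero_or_pos N with rfl | h0
  · exfalso
    have : (dg 1 : V) = dg 0 := congrArg dg (Subsingleton.elim _ _)
    have h1 := h.one_mem
    rw [this, map_zero] at h1
    exact h.zero_notMem h1
  · exact h0

/-- Bring A + B to `dg 1` by diagonalising it and rescaling its eigenvalues, then diagonalise A by
an automorphism fixing `dg 1`. Since B is `dg 1` minus A in this frame, it becomes diagonal at the
same time. -/
theorem exists_diag_pair {A B : V} (hA : A ∈ closure C) (hB : B ∈ closure C) (hAB : A + B ∈ C) :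
    ∃ g ∈ autConeId C, ∃ l m : Fin N → ℝ, (∀ i, 0 ≤ l i) ∧ (∀ i, 0 ≤ m i) ∧ (l + m = 1) ∧
      g • dg l = A ∧ g • dg m = B := by
  obtain ⟨k, hk, hk1, d, hd, -⟩ := h.spectral (A + B)
  have hd0 : ∀ i, 0 < d i := by
    rw [← h.dg_mem, ← h.mem_smul_of_autCone k, hd]
    exact hAB
  obtain ⟨s, hs, hsl⟩ := h.scale d hd0
  have hks : (k * s) • dg 1 = A + B := by rw [mul_smul, hsl, mul_one, hd]
  obtain ⟨u, hu, hu1, l, hl, -⟩ := h.spectral ((k * s)⁻¹ • A)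
  have e1 : (k * s * u) • dg l = A := by
    rw [mul_smul, hl, smul_inv_smul]
  have e2 : (k * s * u) • dg (1 - l) = B := by
    rw [map_sub, smul_sub, e1, mul_smul, hu1, hks, add_sub_cancel_left]
  refine ⟨k * s * u, mul_mem (mul_mem hk hs) hu, l, 1 - l, ?_, ?_, by abel, e1, e2⟩
  · rw [← h.dg_mem_closure, ← h.mem_closure_smul_of_autCone (k * s * u), e1]
    exact hA
  · have := h.dg_mem_closure (1 - l)
    rw [← this, ← h.mem_closure_smul_of_autCone (k * s * u), e2]
    exact hB

variable [FiniteDimensional ℝ V] [MeasurableSpace V] [BorelSpace V]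

/-- The scaling by l sends `dg 1` to `dg l` and `dg m` to `dg (l * m)`, multiplying both volumes by
its determinant. -/
theorem orderVol_dg_mul {l m : Fin N → ℝ} (hl : ∀ i, 0 < l i) :
    orderVol C (dg (l * m)) / orderVol C (dg 1) =
      (orderVol C (dg l) / orderVol C (dg 1)) * (orderVol C (dg m) / orderVol C (dg 1)) := by
  obtain ⟨g, -, hg⟩ := h.scale l hl
  have h1 := h.orderVol_pos h.one_mem
  rw [← hg m, ← mul_one l, ← hg 1, h.orderVol_smul_aut, h.orderVol_smul_aut]
  field_simp

/-- The automorphism realising the permutation fixes `dg 1`, so its determinant has modulus 1. -/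
theorem orderVol_dg_comp (l : Fin N → ℝ) (σ : Equiv.Perm (Fin N)) :
    orderVol C (dg (l ∘ σ)) = orderVol C (dg l) := by
  obtain ⟨g, -, hg⟩ := h.perm σ
  have h1 := h.orderVol_pos h.one_mem
  have h2 : autDet g = 1 := by
    have := h.orderVol_smul_aut g (dg 1)
    rw [hg 1, show (1 : Fin N → ℝ) ∘ σ = 1 from rfl] at this
    exact (mul_right_cancel₀ h1.ne' (by rw [one_mul]; exact this)).symm
  rw [← hg, h.orderVol_smul_aut, h2, one_mul]

theorem orderVol_dg_prod {ι : Type*} (s : Finset ι) (l : ι → Fin N → ℝ)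
    (hl : ∀ j i, 0 < l j i) :
    orderVol C (dg (∏ j ∈ s, l j)) / orderVol C (dg 1) =
      ∏ j ∈ s, (orderVol C (dg (l j)) / orderVol C (dg 1)) := by
  classical
  induction s using Finset.induction_on with
  | empty =>
    rw [Finset.prod_empty, Finset.prod_empty, div_self (h.orderVol_pos h.one_mem).ne']
  | insert a s ha ih =>
    rw [Finset.prod_insert ha, Finset.prod_insert ha, h.orderVol_dg_mul (hl a), ih]

/-- Being multiplicative and symmetric in the entries, the normalised volume is a product of f(l_i)
for a single function f. Scalar vectors give f(t)^N = t^(dim V), since the volume is homogeneous of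
degree dim V. -/
theorem orderVol_dg {l : Fin N → ℝ} (hl : ∀ i, 0 < l i) :
    (orderVol C (dg l) / orderVol C (dg 1)) ^ N = (∏ i, l i) ^ Module.finrank ℝ V := by
  classical
  have hone := h.orderVol_pos h.one_mem
  let i0 : Fin N := ⟨0, h.N_pos⟩
  have hupd : ∀ (i : Fin N) (t : ℝ), orderVol C (dg (Function.update 1 i t)) =
      orderVol C (dg (Function.update 1 i0 t)) := by
    intro i t
    rw [← h.orderVol_dg_comp (Function.update 1 i0 t) (Equiv.swap i i0)]
    congr 2
    funext j
    simp only [Function.comp_apply, Function.update_apply, Pi.one_apply, Equiv.swap_apply_eq_iff,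
      Equiv.swap_apply_right]
  have hprod : ∀ m : Fin N → ℝ, ∏ i, Function.update (1 : Fin N → ℝ) i (m i) = m := by
    intro m
    funext j
    rw [Finset.prod_apply, Finset.prod_eq_single j]
    · simp
    · intro b _ hb
      rw [Function.update_of_ne hb.symm]
      rfl
    · simp
  have hpos : ∀ {m : Fin N → ℝ}, (∀ i, 0 < m i) → ∀ j i, 0 < Function.update (1 : Fin N → ℝ) j (m j) i := by
    intro m hm j i
    rw [Function.update_apply]
    split_ifs
    · exact hm j
    · exact one_pos
  have key : ∀ {m : Fin N → ℝ}, (∀ i, 0 < m i) → orderVol C (dg m) / orderVol C (dg 1) =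
      ∏ i, (orderVol C (dg (Function.update 1 i0 (m i))) / orderVol C (dg 1)) := by
    intro m hm
    conv_lhs => rw [← hprod m]
    rw [h.orderVol_dg_prod _ _ (hpos hm)]
    exact Finset.prod_congr rfl fun i _ => by rw [hupd]
  have hpow : ∀ t : ℝ, 0 < t →
      (orderVol C (dg (Function.update 1 i0 t)) / orderVol C (dg 1)) ^ N =
        t ^ Module.finrank ℝ V := by
    intro t ht
    have h1 := key (m := fun _ => t) fun _ => ht
    rw [Finset.prod_const, Finset.card_univ, Fintype.card_fin] at h1
    rw [← h1, show (fun _ : Fin N => t) = t • (1 : Fin N → ℝ) by ext; simp, map_smul,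
      h.orderVol_smul ht, mul_div_cancel_right₀ _ hone.ne']
  rw [key hl, ← Finset.prod_pow, ← Finset.prod_pow]
  exact Finset.prod_congr rfl fun i _ => hpow _ (hl i)

theorem finrank_pos : 0 < Module.finrank ℝ V := by
  have := h.nontrivial
  exact Module.finrank_pos

/-- The exponent N / dim V in `coneNorm` is the one that turns `orderVol_dg` into the usual formula
for the determinant. -/
theorem coneNorm_dg {l : Fin N → ℝ} (hl : ∀ i, 0 < l i) : coneNorm C N (dg 1) (dg l) = ∏ i, l i := by
  have h1 := div_pos (h.orderVol_pos ((h.dg_mem l).mpr hl)) (h.orderVol_pos h.one_mem)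
  have h2 : 0 ≤ ∏ i, l i := Finset.prod_nonneg fun i _ => (hl i).le
  have h3 := h.finrank_pos
  rw [coneNorm, div_eq_mul_inv (N : ℝ), Real.rpow_mul h1.le, Real.rpow_natCast, h.orderVol_dg hl]
  exact Real.pow_rpow_inv_natCast h2 h3.ne'

theorem coneNorm_smul_aut (g : AutCone C) : ∃ χ : ℝ, 0 < χ ∧ ∀ X ∈ C,
    coneNorm C N (dg 1) (g • X) = χ * coneNorm C N (dg 1) X := by
  refine ⟨autDet g ^ ((N : ℝ) / Module.finrank ℝ V), Real.rpow_pos_of_pos (autDet_pos g) _, ?_⟩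
  intro X hX
  rw [coneNorm, coneNorm, h.orderVol_smul_aut, mul_div_assoc, Real.mul_rpow (autDet_pos g).le]
  exact (div_pos (h.orderVol_pos hX) (h.orderVol_pos h.one_mem)).le

theorem coneNorm_mono {X Y : V} (hX : X ∈ C) (hXY : Y - X ∈ closure C) :
    coneNorm C N (dg 1) X ≤ coneNorm C N (dg 1) Y := by
  have h1 := h.orderVol_pos h.one_mem
  have h2 := h.orderVol_pos hX
  have h3 := h.orderVol_mono hXY
  exact Real.rpow_le_rpow (by positivity) (by gcongr) (by positivity)

theorem coneNorm_smul {r : ℝ} (hr : 0 < r) {X : V} (hX : X ∈ C) :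
    coneNorm C N (dg 1) (r • X) = r ^ N * coneNorm C N (dg 1) X := by
  have h1 := div_pos (h.orderVol_pos hX) (h.orderVol_pos h.one_mem)
  have h3 : (Module.finrank ℝ V : ℝ) ≠ 0 := by exact_mod_cast h.finrank_pos.ne'
  rw [coneNorm, h.orderVol_smul hr, mul_div_assoc, Real.mul_rpow (by positivity) h1.le, coneNorm,
    ← Real.rpow_natCast, ← Real.rpow_mul hr.le, mul_div_cancel₀ _ h3, Real.rpow_natCast]

/-- The norm is monotone and homogeneous, and vectors close to X lie between (1 - ε)X and (1 + ε)X
in the order of the cone. -/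
theorem continuousAt_coneNorm {X : V} (hX : X ∈ C) : ContinuousAt (coneNorm C N (dg 1)) X := by
  set D := coneNorm C N (dg 1) with hD
  have hlim : ∀ s : ℝ, Tendsto (fun ε : ℝ => (1 + ε * s) ^ N * D X) (𝓝[>] 0) (𝓝 (D X)) := by
    intro s
    have : Tendsto (fun ε : ℝ => (1 + ε * s) ^ N * D X) (𝓝 0) (𝓝 ((1 + 0 * s) ^ N * D X)) :=
      Continuous.tendsto (by fun_prop) 0
    rw [zero_mul, add_zero, one_pow, one_mul] at this
    exact this.mono_left nhdsWithin_le_nhds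
  refine tendsto_order.mpr ⟨fun a ha => ?_, fun a ha => ?_⟩
  · have e1 := (hlim (-1)).eventually (lt_mem_nhds ha)
    have e2 : ∀ᶠ ε : ℝ in 𝓝[>] 0, ε < 1 := mem_nhdsWithin_of_mem_nhds (gt_mem_nhds one_pos)
    obtain ⟨ε, ⟨h1, h2⟩, h3⟩ := ((e1.and e2).and self_mem_nhdsWithin).exists
    have h3 : 0 < ε := h3
    have hp : 0 < 1 + ε * (-1) := by linarith
    have hm : X - (1 + ε * (-1)) • X ∈ C := by
      rw [show X - (1 + ε * (-1)) • X = ε • X by module]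
      exact h.smul_mem h3 hX
    have e3 : ∀ᶠ Y in 𝓝 X, Y - (1 + ε * (-1)) • X ∈ C :=
      (Continuous.continuousAt (by fun_prop : Continuous fun Y => Y - (1 + ε * (-1)) • X)).eventually
        (h.isOpen.mem_nhds hm)
    filter_upwards [e3] with Y hY
    rw [← h.coneNorm_smul hp hX] at h1
    exact h1.trans_le (h.coneNorm_mono (h.smul_mem hp hX) (subset_closure hY))
  · obtain ⟨ε, h1, h3⟩ := (((hlim 1).eventually (gt_mem_nhds ha)).and self_mem_nhdsWithin).exists
    have h3 : 0 < ε := h3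
    have hp : 0 < 1 + ε * 1 := by linarith
    have hm : (1 + ε * 1) • X - X ∈ C := by
      rw [show (1 + ε * 1) • X - X = ε • X by module]
      exact h.smul_mem h3 hX
    have e3 : ∀ᶠ Y in 𝓝 X, (1 + ε * 1) • X - Y ∈ C :=
      (Continuous.continuousAt (by fun_prop : Continuous fun Y => (1 + ε * 1) • X - Y)).eventually
        (h.isOpen.mem_nhds hm)
    filter_upwards [e3, h.isOpen.mem_nhds hX] with Y hY hYC
    rw [← h.coneNorm_smul hp hX] at h1
    exact (h.coneNorm_mono hYC (subset_closure hY)).trans_lt h1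

end SymCone

end Volume

end ConvProj

end

/-! ### Invariance of the rank under automorphisms of the cone. -/

noncomputable section

set_option linter.unusedSectionVars false

namespace ConvProj

namespace SymCone

section Rank

variable {V : Type*} [NormedAddCommGroup V] [NormedSpace ℝ V]
variable {C : Set V} {N : ℕ} {dg : (Fin N → ℝ) →ₗ[ℝ] V} {τ : V →L[ℝ] ℝ} {rk : V → ℕ → Prop}
  (h : SymCone C N dg τ rk)
variable [FiniteDimensional ℝ V]
include h

/-- Compare orders of vanishing as s → 0. If g(1) ≤ c·1 in the order of the cone, then g(l + s1) ≤
l' + sc1, and monotonicity of the norm gives χ ∏(l_i + s) ≤ ∏(l'_i + sc). The left side decays like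
s^z and the right side like s^z', where z and z' count the zeros of l and l'; so z' ≤ z. -/
theorem card_zero_le {g : AutCone C} {l l' : Fin N → ℝ} (hl : ∀ i, 0 ≤ l i) (hl' : ∀ i, 0 ≤ l' i)
    (hg : g • dg l = dg l') :
    (Finset.univ.filter fun i => l' i = 0).card ≤ (Finset.univ.filter fun i => l i = 0).card := by
  borelize V
  set z := (Finset.univ.filter fun i => l i = 0).card with hz
  set z' := (Finset.univ.filter fun i => l' i = 0).card with hz'
  obtain ⟨χ, hχ, hD⟩ := h.coneNorm_smul_aut g
  have hP : g • dg 1 ∈ C := (h.mem_smul_of_autCone g).mpr h.one_mem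
  obtain ⟨c, hc, hcP⟩ := h.exists_bounds_of_isCompact (isCompact_singleton (x := g • dg 1))
    (Set.singleton_subset_iff.mpr hP) h.one_mem
  have hcP := (hcP _ rfl).2
  have hineq : ∀ s : ℝ, 0 < s → χ * ∏ i, (l i + s) ≤ ∏ i, (l' i + s * c) := by
    intro s hs
    have p1 : ∀ i, 0 < (l + s • (1 : Fin N → ℝ)) i := fun i => by
      have := hl i
      simp only [Pi.add_apply, Pi.smul_apply, Pi.one_apply, smul_eq_mul]
      positivity
    have p2 : ∀ i, 0 < (l' + (s * c) • (1 : Fin N → ℝ)) i := fun i => by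
      have := hl' i
      simp only [Pi.add_apply, Pi.smul_apply, Pi.one_apply, smul_eq_mul]
      positivity
    have e1 := h.coneNorm_dg p1
    have e2 := h.coneNorm_dg p2
    have e3 := hD _ ((h.dg_mem _).mpr p1)
    simp only [Pi.add_apply, Pi.smul_apply, Pi.one_apply, smul_eq_mul, mul_one] at e1 e2
    rw [e1] at e3
    rw [← e2, ← e3]
    refine h.coneNorm_mono ((h.mem_smul_of_autCone g).mpr ((h.dg_mem _).mpr p1)) ?_
    have := h.closure_smul hs.le (subset_closure hcP)
    rw [map_add, map_add, map_smul, map_smul, smul_add, hg, smul_comm g]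
    rw [smul_sub, smul_smul] at this
    convert this using 1
    abel
  set K1 := χ * ∏ i ∈ Finset.univ.filter (fun i => ¬ l i = 0), l i with hK1
  set K2 := c ^ z' * ∏ i ∈ Finset.univ.filter (fun i => ¬ l' i = 0), (l' i + c) with hK2
  have hK1pos : 0 < K1 := by
    refine mul_pos hχ (Finset.prod_pos fun i hi => ?_)
    exact lt_of_le_of_ne (hl i) (Ne.symm (Finset.mem_filter.mp hi).2)
  have hK2nn : 0 ≤ K2 := by
    refine mul_nonneg (by positivity) (Finset.prod_nonneg fun i hi => ?_)
    have := hl' i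
    positivity
  have hineq2 : ∀ s : ℝ, 0 < s → s ≤ 1 → K1 * s ^ z ≤ K2 * s ^ z' := by
    intro s hs hs1
    have h1 : K1 * s ^ z ≤ χ * ∏ i, (l i + s) := by
      rw [hK1, mul_assoc]
      refine mul_le_mul_of_nonneg_left ?_ hχ.le
      rw [← Finset.prod_filter_mul_prod_filter_not Finset.univ (fun i => l i = 0), mul_comm]
      refine mul_le_mul ?_ ?_ ?_ ?_
      · rw [hz, ← Finset.prod_const]
        refine le_of_eq (Finset.prod_congr rfl fun i hi => ?_)
        rw [(Finset.mem_filter.mp hi).2, zero_add]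
      · exact Finset.prod_le_prod (fun i _ => hl i) fun i _ => by linarith
      · exact Finset.prod_nonneg fun i _ => hl i
      · exact Finset.prod_nonneg fun i _ => by linarith [hl i]
    have h2 : ∏ i, (l' i + s * c) ≤ K2 * s ^ z' := by
      rw [hK2, ← Finset.prod_filter_mul_prod_filter_not Finset.univ (fun i => l' i = 0),
        mul_right_comm, ← mul_pow]
      refine mul_le_mul ?_ ?_ ?_ (by positivity)
      · rw [hz', ← Finset.prod_const]
        refine le_of_eq (Finset.prod_congr rfl fun i hi => ?_)
        rw [(Finset.mem_filter.mp hi).2, zero_add, mul_comm]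
      · refine Finset.prod_le_prod (fun i _ => ?_) fun i _ => ?_
        · have := hl' i
          positivity
        · have : s * c ≤ 1 * c := by gcongr
          linarith
      · refine Finset.prod_nonneg fun i _ => ?_
        have := hl' i
        positivity
    exact h1.trans ((hineq s hs).trans h2)
  by_contra! hlt
  obtain ⟨k, hk⟩ : ∃ k, z' = z + 1 + k := ⟨z' - z - 1, by omega⟩
  -- If z' > z, the inequality forces K1 ≤ K2 s for all s in (0, 1]; this value of s violates it.
  have hs0 : 0 < K1 / (K1 + K2) := by positivity
  have hs1 : K1 / (K1 + K2) ≤ 1 := (div_le_one (by positivity)).mpr (by linarith)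
  have h3 := hineq2 _ hs0 hs1
  set s := K1 / (K1 + K2) with hs
  have h4 : s ^ z' ≤ s ^ z * s := by
    rw [hk, pow_add, pow_succ]
    exact mul_le_of_le_one_right (by positivity) (pow_le_one₀ hs0.le hs1)
  have h5 : K1 * s ^ z ≤ (K2 * s) * s ^ z := by
    calc K1 * s ^ z ≤ K2 * s ^ z' := h3
      _ ≤ K2 * (s ^ z * s) := by gcongr
      _ = (K2 * s) * s ^ z := by ring
  have h6 : K1 ≤ K2 * s := le_of_mul_le_mul_right h5 (by positivity)
  have h7 : s * (K1 + K2) = K1 := div_mul_cancel₀ _ (by positivity)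
  nlinarith [mul_pos hs0 hK1pos]

theorem card_ne_zero_eq {g g' : AutCone C} {l l' : Fin N → ℝ} (hl : ∀ i, 0 ≤ l i)
    (hl' : ∀ i, 0 ≤ l' i) (hg : g • dg l = g' • dg l') :
    (Finset.univ.filter fun i => l i ≠ 0).card = (Finset.univ.filter fun i => l' i ≠ 0).card := by
  have h1 : (g'⁻¹ * g) • dg l = dg l' := by rw [mul_smul, hg, inv_smul_smul]
  have h2 : (g⁻¹ * g') • dg l' = dg l := by rw [mul_smul, ← hg, inv_smul_smul]
  have h3 := h.card_zero_le hl hl' h1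
  have h4 := h.card_zero_le hl' hl h2
  have h5 := Finset.card_filter_add_card_filter_not (s := Finset.univ) (fun i => l i = 0)
  have h6 := Finset.card_filter_add_card_filter_not (s := Finset.univ) (fun i => l' i = 0)
  simp only [ne_eq]
  omega

/-- The axiom `spectral` gives the rank for one diagonalisation only; invariance of the number of
zeros extends it to all of them. -/
theorem rk_smul_dg_iff (g : AutCone C) {l : Fin N → ℝ} (hl : ∀ i, 0 ≤ l i) (r : ℕ) :
    rk (g • dg l) r ↔ (Finset.univ.filter fun i => l i ≠ 0).card = r := by
  obtain ⟨k, -, -, m, hm, hrk⟩ := h.spectral (g • dg l)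
  have hm0 : ∀ i, 0 ≤ m i := by
    rw [← h.dg_mem_closure, ← h.mem_closure_smul_of_autCone k, hm, h.mem_closure_smul_of_autCone,
      h.dg_mem_closure]
    exact hl
  rw [hrk hm0, h.card_ne_zero_eq hm0 hl hm]

theorem rk_dg_iff {l : Fin N → ℝ} (hl : ∀ i, 0 ≤ l i) (r : ℕ) :
    rk (dg l) r ↔ (Finset.univ.filter fun i => l i ≠ 0).card = r := by
  have := h.rk_smul_dg_iff 1 hl r
  rwa [one_smul] at this

theorem exists_diag {X : V} (hX : X ∈ closure C) :
    ∃ g ∈ autConeId C, ∃ l : Fin N → ℝ, (∀ i, 0 ≤ l i) ∧ g • dg l = X := by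
  obtain ⟨k, hk, -, m, hm, -⟩ := h.spectral X
  refine ⟨k, hk, m, ?_, hm⟩
  rw [← h.dg_mem_closure, ← h.mem_closure_smul_of_autCone k, hm]
  exact hX

theorem rk_aut_iff (g : AutCone C) {X : V} (hX : X ∈ closure C) (r : ℕ) :
    rk (g • X) r ↔ rk X r := by
  obtain ⟨k, -, l, hl, rfl⟩ := h.exists_diag hX
  rw [← mul_smul, h.rk_smul_dg_iff _ hl, h.rk_smul_dg_iff _ hl]

/-- The rank of an element of the boundary. -/
theorem exists_rk {X : V} (hX : X ∈ closure C) (hX0 : X ≠ 0) (hXC : X ∉ C) :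
    ∃ r, 1 ≤ r ∧ r ≤ N - 1 ∧ rk X r := by
  obtain ⟨k, -, l, hl, rfl⟩ := h.exists_diag hX
  refine ⟨_, ?_, ?_, (h.rk_smul_dg_iff k hl _).mpr rfl⟩
  · rw [Nat.one_le_iff_ne_zero, Finset.card_ne_zero]
    by_contra! he
    rw [Finset.filter_eq_empty_iff] at he
    apply hX0
    have : l = 0 := funext fun i => not_not.mp (he (Finset.mem_univ i))
    rw [this, map_zero, smul_zero]
  · have : (Finset.univ.filter fun i => l i ≠ 0).card < N := by
      conv_rhs => rw [← Fintype.card_fin N, ← Finset.card_univ]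
      refine Finset.card_lt_card (Finset.filter_ssubset.mpr ?_)
      by_contra! hne
      refine hXC ((h.mem_smul_of_autCone k).mpr ((h.dg_mem l).mpr fun i => ?_))
      exact lt_of_le_of_ne (hl i) (hne i (Finset.mem_univ i)).symm
    omega

end Rank

end SymCone

/-! ### The polynomial s ↦ det(A + sB) and its coefficients. -/

section Coefficients

variable {V : Type*} [NormedAddCommGroup V] [NormedSpace ℝ V]
variable [FiniteDimensional ℝ V] [MeasurableSpace V] [BorelSpace V]

/-- The polynomial which interpolates `s ↦ coneNorm (A + s B)` at `1, …, N + 1`. -/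
def linePoly (C : Set V) (N : ℕ) (P A B : V) : Polynomial ℝ :=
  Lagrange.interpolate Finset.univ (fun j : Fin (N + 1) => ((j : ℕ) : ℝ) + 1)
    (fun j => coneNorm C N P (A + (((j : ℕ) : ℝ) + 1) • B))

namespace SymCone

open Polynomial

variable {C : Set V} {N : ℕ} {dg : (Fin N → ℝ) →ₗ[ℝ] V} {τ : V →L[ℝ] ℝ} {rk : V → ℕ → Prop}
  (h : SymCone C N dg τ rk)
include h

/-- On a diagonalised pair the norm of A + sB is χ ∏(l_i + m_i s), of degree at most N in s, so
interpolation at N + 1 nodes returns it. The nodes start at 1 and not at 0 because A itself need not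
be in C. -/
theorem exists_linePoly_smul_dg (g : AutCone C) : ∃ χ : ℝ, 0 < χ ∧ ∀ l m : Fin N → ℝ,
    (∀ i, 0 ≤ l i) → (∀ i, 0 ≤ m i) → (∀ i, 0 < l i + m i) →
    linePoly C N (dg 1) (g • dg l) (g • dg m) =
      Polynomial.C χ * ∏ i, (Polynomial.C (l i) + Polynomial.C (m i) * X) := by
  obtain ⟨χ, hχ, hD⟩ := h.coneNorm_smul_aut g
  refine ⟨χ, hχ, fun l m hl hm hlm => ?_⟩
  symm
  rw [linePoly]
  have hinj : Set.InjOn (fun j : Fin (N + 1) => ((j : ℕ) : ℝ) + 1) (Finset.univ : Finset (Fin (N + 1))) := by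
    intro i _ j _ hij
    have : ((i : ℕ) : ℝ) = ((j : ℕ) : ℝ) := by simpa using hij
    exact Fin.ext (by exact_mod_cast this)
  refine Lagrange.eq_interpolate_of_eval_eq _ hinj ?_ ?_
  · rw [Finset.card_univ, Fintype.card_fin]
    have h1 : (∏ i, (Polynomial.C (l i) + Polynomial.C (m i) * X)).degree ≤ ((N : ℕ) : WithBot ℕ) := by
      refine (Polynomial.degree_prod_le _ _).trans ?_
      refine (Finset.sum_le_card_nsmul _ _ 1 fun i _ => ?_).trans ?_
      · rw [add_comm]
        exact Polynomial.degree_linear_le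
      · rw [Finset.card_univ, Fintype.card_fin]
        simp
    rw [Polynomial.degree_C_mul hχ.ne']
    refine lt_of_le_of_lt h1 ?_
    exact_mod_cast Nat.lt_succ_self N
  · intro j _
    set s : ℝ := ((j : ℕ) : ℝ) + 1 with hs
    have hs0 : 0 < s := by positivity
    have hpos : ∀ i, 0 < (l + s • m) i := by
      intro i
      simp only [Pi.add_apply, Pi.smul_apply, smul_eq_mul]
      rcases (hm i).eq_or_lt with h0 | h0
      · have := hlm i
        rw [← h0] at this ⊢
        simpa using this
      · have := hl i
        positivity
    have e1 : g • dg l + s • g • dg m = g • dg (l + s • m) := by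
      rw [map_add, map_smul, smul_add, smul_comm g]
    rw [e1, hD _ ((h.dg_mem _).mpr hpos), h.coneNorm_dg hpos]
    simp only [eval_mul, eval_C, eval_prod, eval_add, eval_X, Pi.add_apply, Pi.smul_apply,
      smul_eq_mul]
    congr 1
    exact Finset.prod_congr rfl fun i _ => by ring

theorem linePoly_smul_aut (g : AutCone C) : ∃ χ : ℝ, 0 < χ ∧ ∀ A B : V, A ∈ closure C →
    B ∈ closure C → A + B ∈ C →
    linePoly C N (dg 1) (g • A) (g • B) = Polynomial.C χ * linePoly C N (dg 1) A B := by
  obtain ⟨χ, hχ, hD⟩ := h.coneNorm_smul_aut g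
  refine ⟨χ, hχ, fun A B hA hB hAB => ?_⟩
  rw [linePoly, linePoly, ← Polynomial.smul_eq_C_mul, ← map_smul]
  congr 1
  funext j
  have hm : A + (((j : ℕ) : ℝ) + 1) • B ∈ C := by
    have := h.add_mem hAB (h.closure_smul (Nat.cast_nonneg (j : ℕ)) hB)
    convert this using 1
    module
  rw [Pi.smul_apply, smul_eq_mul, ← hD _ hm, smul_add, smul_comm g]

/-- Scaling the pair amounts to aA + s bB = a(A + s(b/a)B), together with homogeneity of degree N;
it is read off the factorised form. -/
theorem linePoly_smul_smul {A B : V} (hA : A ∈ closure C) (hB : B ∈ closure C) (hAB : A + B ∈ C)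
    {a b : ℝ} (ha : 0 < a) (hb : 0 < b) :
    linePoly C N (dg 1) (a • A) (b • B) =
      Polynomial.C (a ^ N) * (linePoly C N (dg 1) A B).comp (Polynomial.C (b / a) * X) := by
  obtain ⟨g, -, l, m, hl, hm, hlm, rfl, rfl⟩ := h.exists_diag_pair hA hB hAB
  obtain ⟨χ, -, hχ⟩ := h.exists_linePoly_smul_dg g
  have hlm' : ∀ i, l i + m i = 1 := fun i => congrFun hlm i
  rw [smul_comm a, smul_comm b, ← map_smul dg a, ← map_smul dg b, hχ, hχ l m hl hm fun i => by
    rw [hlm']; exact one_pos]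
  · simp only [mul_comp, prod_comp, add_comp, C_comp, X_comp, Pi.smul_apply, smul_eq_mul]
    rw [mul_left_comm]
    congr 1
    have hN : (Polynomial.C (a ^ N) : ℝ[X]) = ∏ _i : Fin N, Polynomial.C a := by
      rw [Finset.prod_const, Finset.card_univ, Fintype.card_fin, map_pow]
    rw [hN, ← Finset.prod_mul_distrib]
    refine Finset.prod_congr rfl fun i _ => ?_
    rw [mul_add, ← C_mul, ← mul_assoc, ← mul_assoc, ← C_mul, ← C_mul]
    congr 3
    field_simp
  · exact fun i => mul_nonneg ha.le (hl i)
  · exact fun i => mul_nonneg hb.le (hm i)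
  · intro i
    simp only [Pi.smul_apply, smul_eq_mul]
    rcases (hl i).eq_or_lt with h0 | h0
    · have : m i = 1 := by rw [← hlm' i, ← h0, zero_add]
      rw [← h0, this]
      linarith
    · have := mul_pos ha h0
      have := mul_nonneg hb.le (hm i)
      linarith

/-- The coefficients of the interpolating polynomial depend linearly on its values, which are
continuous in the pair. This is why the polynomial is defined by interpolation rather than from a
chosen diagonalisation. -/
theorem continuousAt_linePoly_coeff (k : ℕ) {A B : V} (hAB : A + B ∈ C) (hB : B ∈ closure C) :
    ContinuousAt (fun p : V × V => (linePoly C N (dg 1) p.1 p.2).coeff k) (A, B) := by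
  simp only [linePoly, Lagrange.interpolate_apply, finsetSum_coeff, coeff_C_mul]
  refine tendsto_finsetSum _ fun j _ => ?_
  refine Tendsto.mul_const _ ?_
  have hm : A + (((j : ℕ) : ℝ) + 1) • B ∈ C := by
    have := h.add_mem hAB (h.closure_smul (Nat.cast_nonneg (j : ℕ)) hB)
    convert this using 1
    module
  have h1 := h.continuousAt_coneNorm hm
  have h2 : ContinuousAt (fun p : V × V => p.1 + (((j : ℕ) : ℝ) + 1) • p.2) (A, B) :=
    Continuous.continuousAt (by fun_prop)
  exact ContinuousAt.comp (f := fun p : V × V => p.1 + (((j : ℕ) : ℝ) + 1) • p.2) h1 h2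

/-- The coefficient of s^k in ∏(l_i + m_i s) is a sum of nonnegative terms, one for each set T of k
indices: the product of m over T and of l off T. A term is positive if T contains the N - i zeros of
l and lies in the support of m, which has j elements. -/
theorem linePoly_coeff_pos {A B : V} (hA : A ∈ closure C) (hB : B ∈ closure C) (hAB : A + B ∈ C)
    {i j k : ℕ} (hi : rk A i) (hj : rk B j) (hk : N ≤ k + i) (hkj : k ≤ j) :
    0 < (linePoly C N (dg 1) A B).coeff k := by
  classical
  obtain ⟨g, -, l, m, hl, hm, hlm, rfl, rfl⟩ := h.exists_diag_pair hA hB hAB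
  rw [h.rk_smul_dg_iff g hl] at hi
  rw [h.rk_smul_dg_iff g hm] at hj
  obtain ⟨χ, hχ0, hχ⟩ := h.exists_linePoly_smul_dg g
  have hlm' : ∀ i, l i + m i = 1 := fun i => congrFun hlm i
  rw [hχ l m hl hm fun i => by rw [hlm']; exact one_pos, coeff_C_mul]
  refine mul_pos hχ0 ?_
  rw [Finset.prod_add, finsetSum_coeff]
  have hterm : ∀ S : Finset (Fin N), ((∏ i ∈ S, Polynomial.C (l i)) *
      ∏ i ∈ Finset.univ \ S, (Polynomial.C (m i) * X)).coeff k =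
      if k = (Finset.univ \ S).card then (∏ i ∈ S, l i) * ∏ i ∈ Finset.univ \ S, m i else 0 := by
    intro S
    rw [Finset.prod_mul_distrib, Finset.prod_const, ← map_prod, ← map_prod, ← mul_assoc, ← C_mul,
      coeff_C_mul_X_pow]
  simp only [hterm]
  have hcard := Finset.card_filter_add_card_filter_not (s := Finset.univ) (fun i => l i = 0)
  rw [Finset.card_univ, Fintype.card_fin] at hcard
  -- Zeros of l belong to the support of m because l + m = 1, so a set of size k fits between the
  -- two.
  obtain ⟨T, hT1, hT2, hT3⟩ := Finset.exists_subsuperset_card_eq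
    (s := Finset.univ.filter fun i => l i = 0) (t := Finset.univ.filter fun i => m i ≠ 0) (n := k)
    (by
      intro i
      simp only [Finset.mem_filter, Finset.mem_univ, true_and]
      intro h0
      have := hlm' i
      rw [h0, zero_add] at this
      rw [this]
      exact one_ne_zero)
    (by
      simp only [ne_eq] at hi
      omega) (by omega)
  refine Finset.sum_pos' (fun S _ => ?_) ⟨Finset.univ \ T, Finset.mem_powerset.mpr (Finset.subset_univ _), ?_⟩
  · split_ifs
    · exact mul_nonneg (Finset.prod_nonneg fun i _ => hl i) (Finset.prod_nonneg fun i _ => hm i)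
    · exact le_rfl
  · rw [Finset.sdiff_sdiff_eq_self (Finset.subset_univ T), if_pos hT3.symm]
    refine mul_pos (Finset.prod_pos fun i hi => ?_) (Finset.prod_pos fun i hi => ?_)
    · rw [Finset.mem_sdiff] at hi
      refine lt_of_le_of_ne (hl i) fun h0 => hi.2 (hT1 ?_)
      simp [← h0]
    · have := hT2 hi
      rw [Finset.mem_filter] at this
      exact lt_of_le_of_ne (hm i) this.2.symm

end SymCone

end Coefficients

end ConvProj

end

/-! ### Strata of geodesics: homogeneity and the non-wandering set. -/

noncomputable section

set_option linter.unusedSectionVars false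

namespace ConvProj

section Strata

variable {V : Type*} [NormedAddCommGroup V] [NormedSpace ℝ V]

/-- The rank of a point of `P(V)`. -/
def PtRank (rk : V → ℕ → Prop) (x : ℙ ℝ V) (r : ℕ) : Prop := ∃ X, Rep x X ∧ rk X r

/-- The unit vectors whose endpoints have ranks `i` and `j`. -/
def tangentStratum (C : Set V) (rk : V → ℕ → Prop) (i j : ℕ) : Set (ℝ → ℙ ℝ V) :=
  {v | v ∈ unitTangent C ∧ ∃ x y, Tendsto v atBot (𝓝 x) ∧ Tendsto v atTop (𝓝 y) ∧
    PtRank rk x i ∧ PtRank rk y j}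

/-- The straight geodesics whose endpoints have ranks `i` and `j`. -/
def lineStratum (C : Set V) (rk : V → ℕ → Prop) (i j : ℕ) : Set (ℙ ℝ V × ℙ ℝ V) :=
  {p | ∃ v ∈ tangentStratum C rk i j, Tendsto v atBot (𝓝 p.1) ∧ Tendsto v atTop (𝓝 p.2)}

theorem mk_mem_autDomId {C : Set V} {g : AutCone C} (hg : g ∈ autConeId C) :
    (g : AutDom C) ∈ autDomId C := by
  have h1 : Continuous (QuotientGroup.mk : AutCone C → AutDom C) := continuous_quotient_mk'
  exact h1.image_connectedComponent_subset 1 ⟨g, hg, rfl⟩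

variable {C : Set V} {N : ℕ} {dg : (Fin N → ℝ) →ₗ[ℝ] V} {τ : V →L[ℝ] ℝ} {rk : V → ℕ → Prop}
  [Nontrivial V]

theorem IsSharpCone.exists_isCompact_nhds (h : IsSharpCone C τ) [FiniteDimensional ℝ V] {x : ℙ ℝ V}
    (hx : x ∈ dom C) : ∃ L ∈ 𝓝 x, L ⊆ dom C ∧ IsCompact L := by
  rw [h.dom_eq] at hx
  obtain ⟨X, hX, rfl⟩ := hx
  have : ProperSpace V := FiniteDimensional.proper ℝ V
  obtain ⟨K, hK, hKC, hKc⟩ := local_compact_nhds (h.isOpen.mem_nhds hX)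
  refine ⟨pt '' K, ?_, ?_, ?_⟩
  · have h0 : (0 : V) ∉ interior K := fun h0 => h.zero_notMem (hKC (interior_subset h0))
    exact Filter.mem_of_superset ((isOpen_image_pt isOpen_interior h0).mem_nhds
      ⟨X, mem_interior_iff_mem_nhds.mpr hK, rfl⟩) (Set.image_mono interior_subset)
  · rw [h.dom_eq]
    exact Set.image_mono hKC
  · exact hKc.image_of_continuousOn (continuousOn_pt.mono fun Y hY => h.ne_zero (hKC hY))

namespace SymCone

variable (h : SymCone C N dg τ rk)
include h

theorem ptRank_iff {X : V} (hX : X ≠ 0) (r : ℕ) : PtRank rk (pt X) r ↔ rk X r := by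
  constructor
  · rintro ⟨Y, hY, hr⟩
    obtain ⟨hY0, hYX⟩ := rep_iff.mp hY
    obtain ⟨c, hc, rfl⟩ := (pt_eq_pt_iff hY0 hX).mp hYX
    exact (h.rk_smul X r c hc).mp hr
  · exact fun hr => ⟨X, rep_pt hX, hr⟩

theorem chordGeod_mem_stratum_iff {A B : V} (c : IsChord C A B) (i j : ℕ) :
    chordGeod A B ∈ tangentStratum C rk i j ↔ rk A i ∧ rk B j := by
  have hA := h.chord_left_ne_zero c
  have hB := h.chord_left_ne_zero (h.chord_symm c)
  have h1 := h.tendsto_chordGeod_atBot c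
  have h2 := h.tendsto_chordGeod_atTop c
  constructor
  · rintro ⟨-, x, y, h3, h4, h5, h6⟩
    obtain rfl := tendsto_nhds_unique h1 h3
    obtain rfl := tendsto_nhds_unique h2 h4
    exact ⟨(h.ptRank_iff hA i).mp h5, (h.ptRank_iff hB j).mp h6⟩
  · rintro ⟨h5, h6⟩
    exact ⟨h.chordGeod_mem_unitTangent c, _, _, h1, h2, (h.ptRank_iff hA i).mpr h5,
      (h.ptRank_iff hB j).mpr h6⟩

theorem mem_stratum_iff {v : ℝ → ℙ ℝ V} {i j : ℕ} : v ∈ tangentStratum C rk i j ↔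
    ∃ A B, IsChord C A B ∧ v = chordGeod A B ∧ rk A i ∧ rk B j := by
  constructor
  · intro hv
    obtain ⟨A, B, c, rfl⟩ := h.mem_unitTangent_iff.mp hv.1
    exact ⟨A, B, c, rfl, (h.chordGeod_mem_stratum_iff c i j).mp hv⟩
  · rintro ⟨A, B, c, rfl, hr⟩
    exact (h.chordGeod_mem_stratum_iff c i j).mpr hr

theorem mem_lineStratum_iff {p : ℙ ℝ V × ℙ ℝ V} {i j : ℕ} : p ∈ lineStratum C rk i j ↔
    ∃ A B, IsChord C A B ∧ p = (pt A, pt B) ∧ rk A i ∧ rk B j := by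
  constructor
  · rintro ⟨v, hv, h1, h2⟩
    obtain ⟨A, B, c, rfl, hr⟩ := h.mem_stratum_iff.mp hv
    refine ⟨A, B, c, ?_, hr⟩
    exact Prod.ext (tendsto_nhds_unique h1 (h.tendsto_chordGeod_atBot c))
      (tendsto_nhds_unique h2 (h.tendsto_chordGeod_atTop c))
  · rintro ⟨A, B, c, rfl, hr⟩
    exact ⟨_, h.mem_stratum_iff.mpr ⟨A, B, c, rfl, hr⟩, h.tendsto_chordGeod_atBot c,
      h.tendsto_chordGeod_atTop c⟩

variable [FiniteDimensional ℝ V]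

/-- Since l + m = 1, no index is a zero of both, so the two supports cover all indices. -/
theorem le_add_of_chord {A B : V} (c : IsChord C A B) {i j : ℕ} (hi : rk A i) (hj : rk B j) :
    N ≤ i + j := by
  obtain ⟨g, -, l, m, hl, hm, hlm, rfl, rfl⟩ := h.exists_diag_pair c.1 c.2 c.5
  rw [h.rk_smul_dg_iff g hl] at hi
  rw [h.rk_smul_dg_iff g hm] at hj
  rw [← hi, ← hj]
  calc N = (Finset.univ : Finset (Fin N)).card := by rw [Finset.card_univ, Fintype.card_fin]
    _ ≤ ((Finset.univ.filter fun i => l i ≠ 0) ∪ (Finset.univ.filter fun i => m i ≠ 0)).card := by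
      refine Finset.card_le_card fun k _ => ?_
      simp only [Finset.mem_union, Finset.mem_filter, Finset.mem_univ, true_and]
      by_contra! h0
      have := congrFun hlm k
      rw [Pi.add_apply, h0.1, h0.2] at this
      simp at this
    _ ≤ _ := Finset.card_union_le _ _

omit h [Nontrivial V] in
theorem card_blockVec_left {i : ℕ} (hi : i ≤ N) :
    (Finset.univ.filter fun k : Fin N => (blockVec i 1 0 k : ℝ) ≠ 0).card = i := by
  have : (Finset.univ.filter fun k : Fin N => (blockVec i 1 0 k : ℝ) ≠ 0) =
      Finset.univ.filter fun k : Fin N => (k : ℕ) < i := by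
    ext k
    simp [blockVec]
  rw [this, Fin.card_filter_val_lt, min_eq_right hi]

omit h [Nontrivial V] in
theorem card_blockVec_right {i : ℕ} (hi : i ≤ N) :
    (Finset.univ.filter fun k : Fin N => (blockVec i 0 1 k : ℝ) ≠ 0).card = N - i := by
  have : (Finset.univ.filter fun k : Fin N => (blockVec i 0 1 k : ℝ) ≠ 0) =
      Finset.univ.filter fun k : Fin N => ¬ (k : ℕ) < i := by
    ext k
    simp [blockVec]
  have h1 := Finset.card_filter_add_card_filter_not (s := Finset.univ) (fun k : Fin N => (k : ℕ) < i)
  rw [Fin.card_filter_val_lt, min_eq_right hi, Finset.card_univ, Fintype.card_fin] at h1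
  rw [this]
  omega

/-- The first vector is supported on the first i indices and the second on the last j; they overlap
in i + j - N indices, so this is a model of every stratum and not only of the homogeneous ones. -/
theorem exists_chord_blockVec {i j : ℕ} (hi : i + 1 ≤ N) (hj : j + 1 ≤ N) (hij : N ≤ i + j) :
    IsChord C (dg (blockVec i 1 0)) (dg (blockVec (N - j) 0 1)) ∧ rk (dg (blockVec i 1 0)) i ∧
      rk (dg (blockVec (N - j) 0 1)) j := by
  have nn1 : ∀ k, (0 : ℝ) ≤ (blockVec i 1 0 : Fin N → ℝ) k := fun k => by
    simp only [blockVec]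
    split_ifs <;> norm_num
  have nn2 : ∀ k, (0 : ℝ) ≤ (blockVec (N - j) 0 1 : Fin N → ℝ) k := fun k => by
    simp only [blockVec]
    split_ifs <;> norm_num
  refine ⟨⟨(h.dg_mem_closure _).mpr nn1, (h.dg_mem_closure _).mpr nn2, ?_, ?_, ?_⟩, ?_, ?_⟩
  · rw [h.dg_mem]
    intro h0
    have := h0 ⟨N - 1, by omega⟩
    simp only [blockVec] at this
    rw [if_neg (by omega)] at this
    exact lt_irrefl _ this
  · rw [h.dg_mem]
    intro h0
    have := h0 ⟨0, by omega⟩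
    simp only [blockVec] at this
    rw [if_pos (by omega)] at this
    exact lt_irrefl _ this
  · rw [← map_add, h.dg_mem]
    intro k
    simp only [blockVec, Pi.add_apply]
    split_ifs with h1 h2
    · norm_num
    · norm_num
    · omega
    · norm_num
  · rw [h.rk_dg_iff nn1]
    exact card_blockVec_left (by omega)
  · rw [h.rk_dg_iff nn2, card_blockVec_right (by omega)]
    omega

theorem stratum_nonempty_iff {i j : ℕ} (hi : i + 1 ≤ N) (hj : j + 1 ≤ N) :
    (tangentStratum C rk i j).Nonempty ↔ N ≤ i + j := by
  constructor
  · rintro ⟨v, hv⟩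
    obtain ⟨A, B, c, -, hA, hB⟩ := h.mem_stratum_iff.mp hv
    exact h.le_add_of_chord c hA hB
  · intro hij
    obtain ⟨c, hA, hB⟩ := h.exists_chord_blockVec hi hj hij
    exact ⟨_, h.mem_stratum_iff.mpr ⟨_, _, c, rfl, hA, hB⟩⟩

theorem smul_mem_stratum (g : AutDom C) {v : ℝ → ℙ ℝ V} {i j : ℕ}
    (hv : v ∈ tangentStratum C rk i j) : g • v ∈ tangentStratum C rk i j := by
  obtain ⟨g, rfl⟩ := QuotientGroup.mk_surjective g
  obtain ⟨A, B, c, rfl, hA, hB⟩ := h.mem_stratum_iff.mp hv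
  rw [h.mem_stratum_iff]
  exact ⟨_, _, h.chord_autCone g c, h.smul_chordGeod g c, (h.rk_aut_iff g c.1 i).mpr hA,
    (h.rk_aut_iff g c.2 j).mpr hB⟩

/-- When the ranks add up to N, the covering supports are disjoint, so l and m take only the values
0 and 1. A permutation then moves the support of l to the first i indices. -/
theorem exists_smul_base {A B : V} (c : IsChord C A B) {i : ℕ} (hiN : i ≤ N) (hA : rk A i)
    (hB : rk B (N - i)) : ∃ g ∈ autConeId C, A = g • dg (blockVec i 1 0) ∧
      B = g • dg (blockVec i 0 1) := by
  obtain ⟨g, hg, l, m, hl, hm, hlm, rfl, rfl⟩ := h.exists_diag_pair c.1 c.2 c.5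
  have hlm' : ∀ k, l k + m k = 1 := fun k => congrFun hlm k
  rw [h.rk_smul_dg_iff g hl] at hA
  rw [h.rk_smul_dg_iff g hm] at hB
  have hdisj : (Finset.univ.filter fun i => l i ≠ 0) ∩ (Finset.univ.filter fun i => m i ≠ 0) = ∅ := by
    have hun : (Finset.univ.filter fun i => l i ≠ 0) ∪ (Finset.univ.filter fun i => m i ≠ 0) =
        Finset.univ := by
      ext k
      simp only [Finset.mem_union, Finset.mem_filter, Finset.mem_univ, true_and, iff_true]
      by_contra! h0
      have := hlm' k
      rw [h0.1, h0.2] at this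
      simp at this
    have := Finset.card_union_add_card_inter (Finset.univ.filter fun i => l i ≠ 0)
      (Finset.univ.filter fun i => m i ≠ 0)
    rw [hun, Finset.card_univ, Fintype.card_fin, hA, hB] at this
    rw [← Finset.card_eq_zero]
    omega
  have h01 : ∀ k, l k ≠ 0 → l k = 1 := by
    intro k hk
    by_contra h1
    have hmk : m k ≠ 0 := fun h0 => h1 (by have := hlm' k; rwa [h0, add_zero] at this)
    have : k ∈ (Finset.univ.filter fun i => l i ≠ 0) ∩ (Finset.univ.filter fun i => m i ≠ 0) := by
      simp [hk, hmk]
    rw [hdisj] at this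
    simp at this
  have hcard : Fintype.card {k : Fin N // l k ≠ 0} = Fintype.card {k : Fin N // (k : ℕ) < i} := by
    rw [Fintype.card_subtype, Fintype.card_subtype, hA, Fin.card_filter_val_lt, min_eq_right hiN]
  classical
  -- A bijection from the support of l to the first i indices, extended to a permutation of all of
  -- them.
  let σ : Equiv.Perm (Fin N) := (Fintype.equivOfCardEq hcard).extendSubtype
  have hσ : ∀ k, ((σ k : Fin N) : ℕ) < i ↔ l k ≠ 0 := by
    intro k
    constructor
    · intro h1
      by_contra h2
      exact Equiv.extendSubtype_not_mem (Fintype.equivOfCardEq hcard) k (not_not.mpr h2) h1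
    · exact Equiv.extendSubtype_mem (Fintype.equivOfCardEq hcard) k
  obtain ⟨p, hp, hpl⟩ := h.perm σ
  refine ⟨g * p, mul_mem hg hp, ?_, ?_⟩
  · rw [mul_smul, hpl]
    congr 2
    funext k
    simp only [Function.comp_apply, blockVec, hσ]
    split_ifs with h0
    · exact h01 k h0
    · exact not_not.mp h0
  · rw [mul_smul, hpl]
    congr 2
    funext k
    have := hlm' k
    simp only [Function.comp_apply, blockVec, hσ]
    split_ifs with h0
    · rw [h01 k h0] at this
      linarith
    · rw [not_not.mp h0] at this
      linarith

theorem exists_smul_base_geod {v : ℝ → ℙ ℝ V} {i : ℕ} (hi : 1 ≤ i) (hiN : i + 1 ≤ N)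
    (hv : v ∈ tangentStratum C rk i (N - i)) : ∃ g : autDomId C,
      g • chordGeod (dg (blockVec i 1 0)) (dg (blockVec i 0 1)) = v := by
  obtain ⟨c, -, -⟩ := h.exists_chord_blockVec (j := N - i) hiN (by omega) (by omega)
  rw [Nat.sub_sub_self (by omega)] at c
  obtain ⟨A, B, c', rfl, hA, hB⟩ := h.mem_stratum_iff.mp hv
  obtain ⟨g, hg, rfl, rfl⟩ := h.exists_smul_base c' (by omega) hA hB
  refine ⟨⟨g, mk_mem_autDomId hg⟩, ?_⟩
  exact h.smul_chordGeod g c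

theorem transitive_stratum {v w : ℝ → ℙ ℝ V} {i : ℕ} (hi : 1 ≤ i) (hiN : i + 1 ≤ N)
    (hv : v ∈ tangentStratum C rk i (N - i)) (hw : w ∈ tangentStratum C rk i (N - i)) :
    ∃ g : autDomId C, g • v = w := by
  obtain ⟨g, rfl⟩ := h.exists_smul_base_geod hi hiN hv
  obtain ⟨k, rfl⟩ := h.exists_smul_base_geod hi hiN hw
  exact ⟨k * g⁻¹, by rw [mul_smul, inv_smul_smul]⟩

/-- The orbit map is proper: if g v₀ converges, its footpoint stays in a compact subset of Ω, and
properness of the action on Ω confines g to a compact set. -/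
theorem orbitMap_isClosedMap {v₀ : ℝ → ℙ ℝ V} {i j : ℕ} (hv : v₀ ∈ tangentStratum C rk i j) :
    IsClosedMap fun g : autDomId C =>
      (⟨g • v₀, h.smul_mem_stratum g hv⟩ : tangentStratum C rk i j) := by
  refine IsProperMap.isClosedMap ?_
  have hcont : Continuous fun g : autDomId C =>
      (⟨g • v₀, h.smul_mem_stratum g hv⟩ : tangentStratum C rk i j) := by
    refine Continuous.subtype_mk (continuous_pi fun t => ?_) _
    exact continuous_subtype_val.smul continuous_const
  refine isProperMap_iff_ultrafilter.mpr ⟨hcont, ?_⟩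
  intro 𝒰 y hy
  have hy0 : y.1 0 ∈ dom C := y.2.1.1 0
  have hv0 : v₀ 0 ∈ dom C := hv.1.1 0
  obtain ⟨L, hL, hLC, hLc⟩ := h.exists_isCompact_nhds hy0
  -- The point v₀(0) is added so that one compact set contains both the source and the target of g.
  obtain ⟨T, hT, hTL⟩ := h.exists_isCompact_autDom (hLc.union (isCompact_singleton (x := v₀ 0)))
    (Set.union_subset hLC (Set.singleton_subset_iff.mpr hv0))
  have hev : ∀ᶠ g : autDomId C in 𝒰, (g : AutDom C) • v₀ 0 ∈ L := by
    have h1 : Tendsto (fun g : autDomId C => (g : AutDom C) • v₀ 0) 𝒰 (𝓝 (y.1 0)) :=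
      ((continuous_apply 0).comp continuous_subtype_val).continuousAt.tendsto.comp hy
    exact h1.eventually hL
  have hcl : IsClosed ((autDomId C : Subgroup (AutDom C)) : Set (AutDom C)) :=
    isClosed_connectedComponent
  have hT' : IsCompact ((Subtype.val : autDomId C → AutDom C) ⁻¹' T) :=
    hcl.isClosedEmbedding_subtypeVal.isCompact_preimage hT
  obtain ⟨k, -, hk⟩ := hT'.ultrafilter_le_nhds 𝒰 (by
    rw [Filter.le_principal_iff]
    filter_upwards [hev] with g hg
    exact hTL _ ⟨v₀ 0, Or.inr rfl, Or.inl hg⟩)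
  refine ⟨k, ?_, hk⟩
  exact tendsto_nhds_unique (hcont.continuousAt.tendsto.mono_left hk) hy

/-- The orbit map of a point of a homogeneous stratum is a homeomorphism. -/
theorem exists_homeomorph {v₀ : ℝ → ℙ ℝ V} {i : ℕ} (hi : 1 ≤ i) (hiN : i + 1 ≤ N)
    (hv : v₀ ∈ tangentStratum C rk i (N - i)) :
    ∃ e : (autDomId C ⧸ MulAction.stabilizer (autDomId C) v₀) ≃ₜ tangentStratum C rk i (N - i),
      ∀ g : autDomId C, (e (QuotientGroup.mk g) : ℝ → ℙ ℝ V) = g • v₀ := by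
  let f : (autDomId C ⧸ MulAction.stabilizer (autDomId C) v₀) → tangentStratum C rk i (N - i) :=
    fun q => ⟨MulAction.ofQuotientStabilizer (autDomId C) v₀ q, by
      obtain ⟨g, rfl⟩ := QuotientGroup.mk_surjective q
      exact h.smul_mem_stratum g hv⟩
  have hf : ∀ g : autDomId C, f (QuotientGroup.mk g) = ⟨g • v₀, h.smul_mem_stratum g hv⟩ :=
    fun g => rfl
  have hbij : Function.Bijective f := by
    constructor
    · intro q q' hq
      exact MulAction.injective_ofQuotientStabilizer _ _ (congrArg Subtype.val hq)
    · rintro ⟨w, hw⟩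
      obtain ⟨g, hg⟩ := h.transitive_stratum hi hiN hv hw
      exact ⟨QuotientGroup.mk g, Subtype.ext hg⟩
  have hcont : Continuous f := by
    rw [QuotientGroup.isOpenQuotientMap_mk.isQuotientMap.continuous_iff]
    refine Continuous.subtype_mk (continuous_pi fun t => ?_) _
    exact continuous_subtype_val.smul continuous_const
  have hclosed : IsClosedMap f := by
    intro F hF
    have h1 := h.orbitMap_isClosedMap hv _ (hF.preimage
      (continuous_quotient_mk' : Continuous (QuotientGroup.mk : autDomId C →
        autDomId C ⧸ MulAction.stabilizer (autDomId C) v₀)))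
    convert h1 using 1
    ext w
    constructor
    · rintro ⟨q, hq, rfl⟩
      obtain ⟨g, rfl⟩ := QuotientGroup.mk_surjective q
      exact ⟨g, hq, rfl⟩
    · rintro ⟨g, hg, rfl⟩
      exact ⟨QuotientGroup.mk g, hg, rfl⟩
  exact ⟨(Equiv.ofBijective f hbij).toHomeomorphOfContinuousClosed hcont hclosed, fun g => rfl⟩

/-- A straight geodesic with endpoints of complementary ranks is non-wandering. -/
theorem nonWandering_of_lineStratum
    {p : ℙ ℝ V × ℙ ℝ V} {i : ℕ} (hiN : i ≤ N)
    (hp : p ∈ lineStratum C rk i (N - i)) : p ∈ nonWandering (AutDom C) (geod C) := by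
  obtain ⟨A, B, c, rfl, hA, hB⟩ := h.mem_lineStratum_iff.mp hp
  refine ⟨h.mem_geod_iff.mpr ⟨A, B, c, rfl⟩, fun U hUg hU hUp hcomp => ?_⟩
  have hpU : (pt A, pt B) ∈ U :=
    mem_of_mem_nhdsWithin (h.mem_geod_iff.mpr ⟨A, B, c, rfl⟩) hUp
  obtain ⟨g, -, eA, eB⟩ := h.exists_smul_base c hiN hA hB
  -- Conjugates of diagonal scalings: they fix both endpoints and translate along the geodesic.
  have hb : ∀ t : ℝ, ∃ k : AutCone C, k • A = Real.exp (-t) • A ∧ k • B = Real.exp t • B := by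
    intro t
    obtain ⟨s, -, hs⟩ := h.scale (blockVec i (Real.exp (-t)) (Real.exp t)) (fun k => by
      simp only [blockVec]
      split_ifs <;> exact Real.exp_pos _)
    refine ⟨g * s * g⁻¹, ?_, ?_⟩
    · rw [eA, mul_smul, inv_smul_smul, mul_smul, hs, smul_comm, ← map_smul dg]
      congr 2
      funext k
      simp only [blockVec, Pi.mul_apply, Pi.smul_apply, smul_eq_mul]
      split_ifs <;> simp
    · rw [eB, mul_smul, inv_smul_smul, mul_smul, hs, smul_comm, ← map_smul dg]
      congr 2
      funext k
      simp only [blockVec, Pi.mul_apply, Pi.smul_apply, smul_eq_mul]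
      split_ifs <;> simp
  have hA0 := h.chord_left_ne_zero c
  have hB0 := h.chord_left_ne_zero (h.chord_symm c)
  -- If the returning elements formed a compact set, so would the images of [A + B] under them.
  -- These images contain the whole geodesic, hence would contain its limit [B], which is not in Ω.
  have hcl := (hcomp.image (continuous_id.smul continuous_const :
    Continuous fun g : AutDom C => g • pt (A + B))).isClosed
  have hmem : ∀ t, chordGeod A B t ∈
      (fun g : AutDom C => g • pt (A + B)) '' {g : AutDom C | ((g • U) ∩ U).Nonempty} := by
    intro t
    obtain ⟨k, hkA, hkB⟩ := hb t
    refine ⟨(k : AutDom C), ⟨(pt A, pt B), ?_, hpU⟩, ?_⟩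
    · refine ⟨(pt A, pt B), hpU, ?_⟩
      change ((k : AutDom C) • pt A, (k : AutDom C) • pt B) = _
      rw [autDom_smul_pt k hA0, autDom_smul_pt k hB0, hkA, hkB, pt_smul (Real.exp_pos _).ne',
        pt_smul (Real.exp_pos _).ne']
    · change (k : AutDom C) • pt (A + B) = _
      rw [autDom_smul_pt k (h.ne_zero c.add_mem), smul_add, hkA, hkB]
      rfl
  have hlim := hcl.mem_of_tendsto (h.tendsto_chordGeod_atTop c) (Eventually.of_forall hmem)
  obtain ⟨k, -, hk⟩ := hlim
  obtain ⟨k, rfl⟩ := QuotientGroup.mk_surjective k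
  change (k : AutDom C) • pt (A + B) = pt B at hk
  rw [autDom_smul_pt k (h.ne_zero c.add_mem)] at hk
  have h1 : pt B ∈ dom C := hk ▸ h.pt_mem_dom ((h.mem_smul_of_autCone k).mpr c.add_mem)
  have h2 := h.chord_left_frontier (h.chord_symm c)
  rw [frontier, h.isOpen_dom.interior_eq] at h2
  exact h2.2 h1

/-- It is the projection of a closed subset of G × U along the compact factor U. -/
theorem isClosed_setOf_smul_inter {U : Set (ℙ ℝ V × ℙ ℝ V)} (hU : IsCompact U) :
    IsClosed {g : AutDom C | ((g • U) ∩ U).Nonempty} := by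
  have hUs : CompactSpace U := isCompact_iff_compactSpace.mp hU
  have hF : IsClosed {q : AutDom C × U | q.1 • (q.2 : ℙ ℝ V × ℙ ℝ V) ∈ U} := by
    refine hU.isClosed.preimage ?_
    have hc : Continuous fun q : AutDom C × U =>
        (q.1 • (q.2 : ℙ ℝ V × ℙ ℝ V).1, q.1 • (q.2 : ℙ ℝ V × ℙ ℝ V).2) := by fun_prop
    exact hc
  have := isClosedMap_fst_of_compactSpace (X := AutDom C) (Y := U) _ hF
  convert this using 1
  ext g
  constructor
  · rintro ⟨_, ⟨x, hx, rfl⟩, hgx⟩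
    exact ⟨(g, ⟨x, hx⟩), hgx, rfl⟩
  · rintro ⟨⟨g, x⟩, hgx, rfl⟩
    exact ⟨g • (x : ℙ ℝ V × ℙ ℝ V), ⟨x, x.2, rfl⟩, hgx⟩

/-- Pairs of points of the boundary of a given pair of vectors, normalised by their trace, have a
compact neighbourhood contained in a given neighbourhood. -/
theorem exists_compact_nhds_geod {A B : V} (c : IsChord C A B) (hA : τ A = 1) (hB : τ B = 1)
    {O : Set (V × V)} (hO : O ∈ 𝓝 (A, B)) : ∃ U' ⊆ O, IsCompact U' ∧
      (∀ q ∈ U', IsChord C q.1 q.2 ∧ τ q.1 = 1 ∧ τ q.2 = 1) ∧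
      Prod.map pt pt '' U' ∈ 𝓝[geod C] (pt A, pt B) := by
  have : ProperSpace V := FiniteDimensional.proper ℝ V
  have hO' : O ∩ {q : V × V | q.1 + q.2 ∈ C} ∈ 𝓝 (A, B) := by
    refine inter_mem hO ?_
    exact (h.isOpen.preimage (by fun_prop : Continuous fun q : V × V => q.1 + q.2)).mem_nhds c.add_mem
  obtain ⟨K, hK, hKO, hKc⟩ := local_compact_nhds hO'
  set S : Set V := {X ∈ closure C | τ X = 1} \ C with hS
  have hSc : IsCompact S := h.isCompact_slice.diff h.isOpen
  have hcontS : ContinuousOn (Prod.map pt pt : V × V → ℙ ℝ V × ℙ ℝ V) (S ×ˢ S) := by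
    refine ContinuousOn.prodMap ?_ ?_ <;>
    exact continuousOn_pt.mono fun X hX => h.slice_ne_zero hX.1.2
  refine ⟨K ∩ (S ×ˢ S), fun q hq => (hKO hq.1).1, hKc.inter (hSc.prod hSc), ?_, ?_⟩
  · rintro q ⟨h1, h2, h3⟩
    exact ⟨⟨h2.1.1, h3.1.1, h2.2, h3.2, (hKO h1).2⟩, h2.1.2, h3.1.2⟩
  -- Z is the compact image of the normalised pairs outside the interior of K. By injectivity of
  -- `pt` on vectors with τ = 1 it avoids the given pair, and its complement is the neighbourhood
  -- sought.
  · set Z := Prod.map pt pt '' ((S ×ˢ S) \ interior K) with hZ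
    have hZc : IsClosed Z := by
      refine IsCompact.isClosed (IsCompact.image_of_continuousOn ?_ (hcontS.mono Set.sdiff_subset))
      exact (hSc.prod hSc).diff isOpen_interior
    have hpZ : (pt A, pt B) ∉ Z := by
      rintro ⟨⟨A', B'⟩, ⟨⟨h1, h2⟩, h3⟩, h4⟩
      have e1 := h.pt_injOn_slice h1.1.2 hA (congrArg Prod.fst h4)
      have e2 := h.pt_injOn_slice h2.1.2 hB (congrArg Prod.snd h4)
      simp only at e1 e2
      rw [e1, e2] at h3
      exact h3 (mem_interior_iff_mem_nhds.mpr hK)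
    rw [mem_nhdsWithin]
    refine ⟨Zᶜ, hZc.isOpen_compl, hpZ, ?_⟩
    rintro p ⟨hp1, hp2⟩
    obtain ⟨A', B', c', rfl⟩ := h.mem_geod_iff.mp hp2
    obtain ⟨a1, a2, a3⟩ := h.exists_slice c'.1 (h.chord_left_ne_zero c')
    obtain ⟨b1, b2, b3⟩ := h.exists_slice c'.2 (h.chord_left_ne_zero (h.chord_symm c'))
    have a0 := h.trace_pos c'.1 (h.chord_left_ne_zero c')
    have b0 := h.trace_pos c'.2 (h.chord_left_ne_zero (h.chord_symm c'))
    have c'' := h.chord_smul c' (inv_pos.mpr a0) (inv_pos.mpr b0)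
    have hmem : ((τ A')⁻¹ • A', (τ B')⁻¹ • B') ∈ S ×ˢ S :=
      ⟨⟨⟨a1, a2⟩, c''.3⟩, ⟨⟨b1, b2⟩, c''.4⟩⟩
    have heq : Prod.map pt pt ((τ A')⁻¹ • A', (τ B')⁻¹ • B') = (pt A', pt B') := by
      rw [Prod.map_apply, a3, b3]
    refine ⟨_, ⟨?_, hmem⟩, heq⟩
    by_contra hK'
    exact hp1 ⟨_, ⟨hmem, fun hi => hK' (interior_subset hi)⟩, heq⟩

/-- A straight geodesic with endpoints of ranks `i` and `j`, where `i + j > N`, is wandering. -/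
theorem notMem_nonWandering {A B : V} (c : IsChord C A B) (hA : τ A = 1) (hB : τ B = 1) {i j : ℕ}
    (hiN : i ≤ N) (hi : rk A i) (hj : rk B j) (hij : N < i + j) :
    (pt A, pt B) ∉ nonWandering (AutDom C) (geod C) := by
  borelize V
  rintro ⟨-, hnw⟩
  -- Both k and k + 1 lie between N - i and j: the strict inequality i + j > N is exactly what
  -- leaves room for two positive coefficients.
  set k := N - i with hk
  let cf : ℕ → V × V → ℝ := fun k q => (linePoly C N (dg 1) q.1 q.2).coeff k
  have p0 : 0 < cf k (A, B) := h.linePoly_coeff_pos c.1 c.2 c.5 hi hj (by omega) (by omega)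
  have p1 : 0 < cf (k + 1) (A, B) := h.linePoly_coeff_pos c.1 c.2 c.5 hi hj (by omega) (by omega)
  have hO : {q : V × V | 0 < cf k q ∧ 0 < cf (k + 1) q} ∈ 𝓝 (A, B) :=
    ((h.continuousAt_linePoly_coeff k c.5 c.2).eventually (lt_mem_nhds p0)).and
      ((h.continuousAt_linePoly_coeff (k + 1) c.5 c.2).eventually (lt_mem_nhds p1))
  obtain ⟨U', hU'O, hU'c, hU', hnhds⟩ := h.exists_compact_nhds_geod c hA hB hO
  have hcontU : ContinuousOn (Prod.map pt pt : V × V → ℙ ℝ V × ℙ ℝ V) U' := by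
    refine ContinuousOn.mono (s := {v | v ≠ 0} ×ˢ {v | v ≠ 0})
      (continuousOn_pt.prodMap continuousOn_pt) fun q hq => ?_
    exact ⟨h.slice_ne_zero (hU' q hq).2.1, h.slice_ne_zero (hU' q hq).2.2⟩
  have hUc := hU'c.image_of_continuousOn hcontU
  refine hnw (Prod.map pt pt '' U') ?_ hUc hnhds ?_
  · rintro _ ⟨q, hq, rfl⟩
    exact h.mem_geod_iff.mpr ⟨q.1, q.2, (hU' q hq).1, rfl⟩
  -- the equivariant map to `Ω`
  let M : V × V → V := fun q => q.1 + (cf k q / cf (k + 1) q) • q.2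
  have hMC : ∀ q ∈ U', M q ∈ C := by
    intro q hq
    have := (h.chord_comb_mem_iff (hU' q hq).1 (α := 1) (β := cf k q / cf (k + 1) q)).mpr
      ⟨one_pos, div_pos (hU'O hq).1 (hU'O hq).2⟩
    rwa [one_smul] at this
  have hMcont : ContinuousOn M U' := by
    intro q hq
    have c' := (hU' q hq).1
    refine ContinuousAt.continuousWithinAt ?_
    refine continuousAt_fst.add (ContinuousAt.smul (ContinuousAt.div ?_ ?_ (hU'O hq).2.ne')
      continuousAt_snd)
    · exact h.continuousAt_linePoly_coeff k c'.5 c'.2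
    · exact h.continuousAt_linePoly_coeff (k + 1) c'.5 c'.2
  have hLc : IsCompact (pt '' (M '' U')) := by
    refine (hU'c.image_of_continuousOn hMcont).image_of_continuousOn (continuousOn_pt.mono ?_)
    rintro _ ⟨q, hq, rfl⟩
    exact h.ne_zero (hMC q hq)
  have hLC : pt '' (M '' U') ⊆ dom C := by
    rintro _ ⟨_, ⟨q, hq, rfl⟩, rfl⟩
    exact h.pt_mem_dom (hMC q hq)
  obtain ⟨T, hT, hTL⟩ := h.exists_isCompact_autDom hLc hLC
  refine hT.of_isClosed_subset (h.isClosed_setOf_smul_inter hUc) ?_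
  rintro g ⟨_, ⟨_, ⟨q, hq, rfl⟩, rfl⟩, ⟨q', hq', hqq'⟩⟩
  obtain ⟨g, rfl⟩ := QuotientGroup.mk_surjective g
  refine hTL _ ⟨pt (M q), ⟨_, ⟨q, hq, rfl⟩, rfl⟩, ⟨_, ⟨q', hq', rfl⟩, ?_⟩⟩
  change pt (M q') = (g : AutDom C) • pt (M q)
  obtain ⟨c1, t1, t2⟩ := hU' q hq
  obtain ⟨c2, t3, t4⟩ := hU' q' hq'
  -- Equality in projective space gives a scalar of unknown sign; it is positive because g preserves
  -- the closed cone, on which τ is positive away from 0.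
  have hpos : ∀ {X Y : V}, X ∈ closure C → Y ∈ closure C → X ≠ 0 → Y ≠ 0 →
      pt Y = (g : AutDom C) • pt X → ∃ r : ℝ, 0 < r ∧ g • X = r • Y := by
    intro X Y hX hY hX0 hY0 he
    rw [autDom_smul_pt g hX0] at he
    obtain ⟨r, hr, e⟩ := (pt_eq_pt_iff ((smul_ne_zero_iff_ne g).mpr hX0) hY0).mp he.symm
    refine ⟨r, ?_, e⟩
    have h1 := h.trace_pos ((h.mem_closure_smul_of_autCone g).mpr hX)
      ((smul_ne_zero_iff_ne g).mpr hX0)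
    rw [e, map_smul, smul_eq_mul] at h1
    exact pos_of_mul_pos_left h1 (h.trace_nonneg hY)
  obtain ⟨a, ha, ea⟩ := hpos c1.1 c2.1 (h.slice_ne_zero t1) (h.slice_ne_zero t3)
    (congrArg Prod.fst hqq')
  obtain ⟨b, hb, eb⟩ := hpos c1.2 c2.2 (h.slice_ne_zero t2) (h.slice_ne_zero t4)
    (congrArg Prod.snd hqq')
  -- Passing to (aA, bB) multiplies the coefficient of s^k by a^(N-k) b^k, hence the ratio of two
  -- consecutive ones by a/b, while the factor χ of an automorphism cancels. So `g • M q` is `a • M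
  -- q'`.
  have hratio : b * (cf k q / cf (k + 1) q) = a * (cf k q' / cf (k + 1) q') := by
    obtain ⟨χ, hχ, hχe⟩ := h.linePoly_smul_aut g
    have e1 := hχe q.1 q.2 c1.1 c1.2 c1.5
    rw [ea, eb, h.linePoly_smul_smul c2.1 c2.2 c2.5 ha hb] at e1
    have e2 : ∀ k, a ^ N * (cf k q' * (b / a) ^ k) = χ * cf k q := by
      intro k
      have := congrArg (fun P => Polynomial.coeff P k) e1
      simpa only [Polynomial.coeff_C_mul, Polynomial.comp_C_mul_X_coeff] using this
    have e3 := e2 k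
    have e4 := e2 (k + 1)
    have n1 := (hU'O hq).1
    have n2 := (hU'O hq).2
    have n3 := (hU'O hq').1
    have n4 := (hU'O hq').2
    have f1 : cf k q = a ^ N * (cf k q' * (b / a) ^ k) / χ := by
      rw [e3, mul_div_cancel_left₀ _ hχ.ne']
    have f2 : cf (k + 1) q = a ^ N * (cf (k + 1) q' * (b / a) ^ (k + 1)) / χ := by
      rw [e4, mul_div_cancel_left₀ _ hχ.ne']
    have n5 : cf (k + 1) q' ≠ 0 := n4.ne'
    rw [f1, f2, pow_succ]
    field_simp
  rw [autDom_smul_pt g (h.ne_zero (hMC q hq))]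
  have : g • M q = a • M q' := by
    change g • (q.1 + (cf k q / cf (k + 1) q) • q.2) =
      a • (q'.1 + (cf k q' / cf (k + 1) q') • q'.2)
    rw [smul_add, smul_add, ea, smul_comm g, eb, smul_smul, smul_smul, ← hratio, mul_comm]
  rw [this, pt_smul ha.ne']

theorem nonWandering_eq :
    nonWandering (AutDom C) (geod C) = ⋃ i ∈ Set.Icc 1 (N - 1), lineStratum C rk i (N - i) := by
  ext p
  simp only [Set.mem_iUnion]
  constructor
  · intro hp
    obtain ⟨A, B, c, rfl⟩ := h.mem_geod_iff.mp hp.1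
    have hA0 := h.chord_left_ne_zero c
    have hB0 := h.chord_left_ne_zero (h.chord_symm c)
    obtain ⟨i, hi1, hi2, hi⟩ := h.exists_rk c.1 hA0 c.3
    obtain ⟨j, hj1, hj2, hj⟩ := h.exists_rk c.2 hB0 c.4
    have hij := h.le_add_of_chord c hi hj
    rcases hij.eq_or_lt with he | hlt
    · refine ⟨i, ⟨hi1, hi2⟩, h.mem_lineStratum_iff.mpr ⟨A, B, c, rfl, hi, ?_⟩⟩
      rwa [show N - i = j by omega]
    · exfalso
      have a0 := h.trace_pos c.1 hA0
      have b0 := h.trace_pos c.2 hB0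
      obtain ⟨-, a2, a3⟩ := h.exists_slice c.1 hA0
      obtain ⟨-, b2, b3⟩ := h.exists_slice c.2 hB0
      refine h.notMem_nonWandering (h.chord_smul c (inv_pos.mpr a0) (inv_pos.mpr b0)) a2 b2
        (by omega) ((h.rk_smul A i _ (inv_pos.mpr a0).ne').mpr hi)
        ((h.rk_smul B j _ (inv_pos.mpr b0).ne').mpr hj) hlt ?_
      rwa [a3, b3]
  · rintro ⟨i, ⟨hi1, hi2⟩, hp⟩
    exact h.nonWandering_of_lineStratum (by omega) hp

end SymCone

end Strata

end ConvProj

end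

noncomputable section

set_option linter.unusedSectionVars false

/-! ### Composition algebras -/

/-- Composition division algebras over `ℝ`, with their real part. -/
class CompAlg (K : Type) [NormedStarAlg K] where
  re : K →ₗ[ℝ] ℝ
  smul_mul : ∀ (r : ℝ) (a b : K), (r • a) * b = r • (a * b)
  mul_smul : ∀ (r : ℝ) (a b : K), a * (r • b) = r • (a * b)
  add_star : ∀ a : K, a + star a = (2 * re a) • (1 : K)
  star_mul_self : ∀ a : K, star a * a = (‖a‖ ^ 2) • (1 : K)
  re_one : re 1 = 1
  re_mul_comm : ∀ a b : K, re (a * b) = re (b * a)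
  re_mul_assoc : ∀ a b c : K, re (a * b * c) = re (a * (b * c))
  star_mul_mul : ∀ a b : K, star a * (a * b) = (‖a‖ ^ 2) • b
  finite : FiniteDimensional ℝ K

namespace CompAlg

variable {K : Type} [NormedStarAlg K] [CompAlg K]

theorem re_smul (r : ℝ) (a : K) : re (r • a) = r * re a := map_smul re r a

theorem re_star (a : K) : re (star a) = re a := by
  have h := congrArg re (add_star a)
  rw [map_add, re_smul, re_one] at h
  linarith

/-- The Euclidean inner product. -/
def ip (a b : K) : ℝ := re (star a * b)

theorem ip_comm (a b : K) : ip a b = ip b a := by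
  rw [ip, ← re_star, star_mul, star_star, ip]

theorem ip_add_left (a b c : K) : ip (a + b) c = ip a c + ip b c := by
  rw [ip, star_add, add_mul, map_add]; rfl

theorem ip_add_right (a b c : K) : ip a (b + c) = ip a b + ip a c := by
  rw [ip, mul_add, map_add]; rfl

theorem ip_smul_left (r : ℝ) (a b : K) : ip (r • a) b = r * ip a b := by
  rw [ip, star_smul, star_trivial, smul_mul, re_smul]; rfl

theorem ip_smul_right (r : ℝ) (a b : K) : ip a (r • b) = r * ip a b := by
  rw [ip, mul_smul, re_smul]; rfl

theorem ip_neg_left (a b : K) : ip (-a) b = -ip a b := by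
  rw [← neg_one_smul ℝ a, ip_smul_left, neg_one_mul]

theorem ip_neg_right (a b : K) : ip a (-b) = -ip a b := by
  rw [ip_comm, ip_neg_left, ip_comm]

theorem ip_sub_left (a b c : K) : ip (a - b) c = ip a c - ip b c := by
  rw [sub_eq_add_neg, ip_add_left, ip_neg_left, sub_eq_add_neg]

theorem ip_self (a : K) : ip a a = ‖a‖ ^ 2 := by
  rw [ip, star_mul_self, re_smul, re_one, mul_one]

theorem ext_ip {a b : K} (h : ∀ t, ip a t = ip b t) : a = b := by
  have h1 : ip (a - b) (a - b) = 0 := by rw [ip_sub_left, h, sub_self]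
  rw [ip_self, sq_eq_zero_iff, norm_eq_zero, sub_eq_zero] at h1
  exact h1

theorem norm_star_sq (a : K) : ‖star a‖ ^ 2 = ‖a‖ ^ 2 := by
  rw [← ip_self, ← ip_self, ip, ip, star_star, re_mul_comm]

theorem norm_one_sq : ‖(1 : K)‖ ^ 2 = 1 := by
  rw [← ip_self, ip, star_one, one_mul, re_one]

theorem ip_star_star (a b : K) : ip (star a) (star b) = ip a b := by
  rw [ip, star_star, re_mul_comm, ip_comm, ip]

/-- Only associativity under the real part is used, so this survives when the product is not
associative. -/
theorem ip_mul_left (a b c : K) : ip (a * b) c = ip b (star a * c) := by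
  rw [ip, ip, star_mul, re_mul_assoc]

theorem ip_mul_right (a b c : K) : ip (a * b) c = ip a (c * star b) := by
  rw [← ip_star_star, star_mul, ip_mul_left, star_star, ← ip_star_star a, star_mul, star_star]

theorem mul_star_self (a : K) : a * star a = (‖a‖ ^ 2) • (1 : K) := by
  have := star_mul_self (star a)
  rwa [star_star, norm_star_sq] at this

theorem mul_star_mul (a b : K) : a * (star a * b) = (‖a‖ ^ 2) • b := by
  have := star_mul_mul (star a) b
  rwa [star_star, norm_star_sq] at this

theorem mul_mul_star (a b : K) : (b * a) * star a = (‖a‖ ^ 2) • b := by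
  have := congrArg star (mul_star_mul a (star b))
  rwa [star_mul, star_mul, star_smul, star_star, star_star, star_trivial (‖a‖ ^ 2)] at this

theorem norm_add_sq' (a b : K) : ‖a + b‖ ^ 2 = ‖a‖ ^ 2 + 2 * ip a b + ‖b‖ ^ 2 := by
  rw [← ip_self, ip_add_left, ip_add_right, ip_add_right, ip_self, ip_self, ip_comm b a]
  ring

theorem norm_mul_sq (a b : K) : ‖a * b‖ ^ 2 = ‖a‖ ^ 2 * ‖b‖ ^ 2 := by
  rw [← ip_self, ip_mul_left, star_mul_mul, ip_smul_right, ip_self]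

theorem star_mul_mul_add (a b c : K) :
    star a * (b * c) + star b * (a * c) = (2 * ip a b) • c := by
  have h := star_mul_mul (a + b) c
  rw [star_add, add_mul a, mul_add, add_mul, add_mul, star_mul_mul, star_mul_mul, norm_add_sq',
    add_smul, add_smul] at h
  rw [← sub_eq_zero] at h ⊢
  rw [← h]
  abel

theorem mul_star_mul_add (a b c : K) :
    a * (star b * c) + b * (star a * c) = (2 * ip a b) • c := by
  have := star_mul_mul_add (star a) (star b) c
  rwa [star_star, star_star, ip_star_star] at this

/-- Polarised form of the multiplicativity of the norm. -/
theorem ip_exchange (z x q t : K) : ip (z * x) (q * t) + ip (q * x) (z * t) = 2 * ip z q * ip x t := by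
  rw [ip_mul_left, ip_mul_left, ← ip_add_right, star_mul_mul_add, ip_smul_right]

/-- The middle Moufang identity. -/
theorem mul_mul_mul (x y z : K) :
    (x * y) * (star z * x) = (2 * ip x (z * star y)) • x - (‖x‖ ^ 2) • (z * star y) := by
  refine ext_ip fun t => ?_
  rw [ip_mul_left, ip_sub_left, ip_smul_left, ip_smul_left]
  -- The pairing of the left side with t is the first term of this exchange identity; in the second
  -- term, the product of the conjugate of xy with x collapses to ‖x‖² times the conjugate of y.
  have h1 := ip_exchange (star z) x (star (x * y)) t
  have h2 : ip (star (x * y) * x) (star z * t) = ‖x‖ ^ 2 * ip (z * star y) t := by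
    rw [star_mul]
    have h3 : (star y * star x) * x = (‖x‖ ^ 2) • star y := by
      have := mul_mul_star (star x) (star y)
      rwa [star_star, norm_star_sq] at this
    rw [h3, ip_smul_left, ip_mul_left]
  have h4 : ip (star z) (star (x * y)) = ip x (z * star y) := by
    rw [ip_star_star, ip_comm, ip_mul_right]
  rw [h2, h4] at h1
  linarith

theorem eq_re_smul_one {a : K} (h : star a = a) : a = re a • (1 : K) := by
  have h1 := add_star a
  rw [h, ← two_smul ℝ a, ← smul_smul] at h1
  exact smul_right_injective K (two_ne_zero (α := ℝ)) h1

theorem smul_one_mul (r : ℝ) (a : K) : (r • (1 : K)) * a = r • a := by rw [smul_mul, one_mul]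

theorem mul_smul_one (r : ℝ) (a : K) : a * (r • (1 : K)) = r • a := by rw [mul_smul, mul_one]

theorem star_smul_one (r : ℝ) : star (r • (1 : K)) = r • (1 : K) := by
  rw [star_smul, star_one, star_trivial]

theorem re_smul_one (r : ℝ) : re (r • (1 : K)) = r := by rw [re_smul, re_one, mul_one]

theorem one_ne_zero' : (1 : K) ≠ 0 := fun h => by
  have := re_one (K := K)
  rw [h, map_zero] at this
  exact zero_ne_one this

theorem nontrivial : Nontrivial K := ⟨1, 0, one_ne_zero'⟩

end CompAlg

instance : CompAlg ℝ where
  re := LinearMap.id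
  smul_mul r a b := smul_mul_assoc r a b
  mul_smul r a b := mul_smul_comm r a b
  add_star a := by
    change a + star a = (2 * a) • (1 : ℝ)
    simp
    ring
  star_mul_self a := by
    change star a * a = ‖a‖ ^ 2 • (1 : ℝ)
    simp [sq]
  re_one := rfl
  re_mul_comm a b := mul_comm a b
  re_mul_assoc a b c := mul_assoc a b c
  star_mul_mul a b := by
    change star a * (a * b) = ‖a‖ ^ 2 • b
    simp [sq, mul_assoc]
  finite := inferInstanceAs (FiniteDimensional ℝ ℝ)

instance : CompAlg ℂ where
  re := Complex.reLm
  smul_mul r a b := smul_mul_assoc r a b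
  mul_smul r a b := mul_smul_comm r a b
  add_star a := by
    change a + star a = (2 * a.re) • (1 : ℂ)
    apply Complex.ext <;> simp
    ring
  star_mul_self a := by
    change star a * a = ‖a‖ ^ 2 • (1 : ℂ)
    rw [Complex.star_def, ← Complex.normSq_eq_conj_mul_self, Complex.normSq_eq_norm_sq]
    simp
  re_one := rfl
  re_mul_comm a b := congrArg Complex.re (mul_comm a b)
  re_mul_assoc a b c := congrArg Complex.re (mul_assoc a b c)
  star_mul_mul a b := by
    change star a * (a * b) = ‖a‖ ^ 2 • b
    rw [← mul_assoc, Complex.star_def, ← Complex.normSq_eq_conj_mul_self,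
      Complex.normSq_eq_norm_sq]
    simp
  finite := inferInstanceAs (FiniteDimensional ℝ ℂ)

theorem Quaternion.star_mul_self_eq_smul (a : Quaternion ℝ) :
    star a * a = (‖a‖ ^ 2) • (1 : Quaternion ℝ) := by
  rw [Quaternion.star_mul_self, Quaternion.normSq_eq_norm_mul_self, sq]
  ext <;> simp

theorem Quaternion.mul_star_self_eq_smul (a : Quaternion ℝ) :
    a * star a = (‖a‖ ^ 2) • (1 : Quaternion ℝ) := by
  rw [Quaternion.self_mul_star, Quaternion.normSq_eq_norm_mul_self, sq]
  ext <;> simp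

theorem Quaternion.add_star_eq_smul (a : Quaternion ℝ) :
    a + star a = (2 * a.re) • (1 : Quaternion ℝ) := by
  ext <;> simp
  ring

/-- The real part of a quaternion, as a linear map. -/
def Quaternion.reLm : Quaternion ℝ →ₗ[ℝ] ℝ where
  toFun a := a.re
  map_add' _ _ := rfl
  map_smul' _ _ := rfl

instance : CompAlg (Quaternion ℝ) where
  re := Quaternion.reLm
  smul_mul r a b := smul_mul_assoc r a b
  mul_smul r a b := mul_smul_comm r a b
  add_star a := Quaternion.add_star_eq_smul a
  star_mul_self a := Quaternion.star_mul_self_eq_smul a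
  re_one := rfl
  re_mul_comm a b := by
    change (a * b).re = (b * a).re
    simp only [Quaternion.re_mul]
    ring
  re_mul_assoc a b c := congrArg _ (mul_assoc a b c)
  star_mul_mul a b := by
    change star a * (a * b) = ‖a‖ ^ 2 • b
    rw [← mul_assoc, Quaternion.star_mul_self_eq_smul, smul_mul_assoc, one_mul]
  finite := inferInstanceAs (FiniteDimensional ℝ (Quaternion ℝ))

namespace Octonion

theorem norm_sq_eq (x : Octonion) : ‖x‖ ^ 2 = ‖x.fst‖ ^ 2 + ‖x.snd‖ ^ 2 :=
  WithLp.prod_norm_sq_eq_of_L2 x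

/-- The real part of an octonion, as a linear map. -/
def reLm : Octonion →ₗ[ℝ] ℝ where
  toFun x := x.fst.re
  map_add' _ _ := rfl
  map_smul' _ _ := rfl

theorem star_mul_self_eq_smul (a : Octonion) : star a * a = (‖a‖ ^ 2) • (1 : Octonion) := by
  rw [norm_sq_eq]
  refine ext' ?_ ?_
  · simp only [fst_mul, fst_star, snd_star, fst_smul, fst_one, mul_neg, sub_neg_eq_add,
      Quaternion.star_mul_self_eq_smul]
    rw [add_smul]
  · simp

/-- Expanding the Cayley-Dickson product twice, the mixed terms cancel by associativity of the
quaternions and only norms remain. -/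
theorem star_mul_mul_eq_smul (a b : Octonion) : star a * (a * b) = (‖a‖ ^ 2) • b := by
  rw [norm_sq_eq]
  refine ext' ?_ ?_
  · have : (star a * (a * b)).fst =
        (star a.fst * a.fst) * b.fst + b.fst * (star a.snd * a.snd) := by
      simp only [fst_mul, snd_mul, fst_star, snd_star, star_add, star_mul, star_star]
      noncomm_ring
    rw [this, Quaternion.star_mul_self_eq_smul, Quaternion.star_mul_self_eq_smul, smul_mul_assoc,
      mul_smul_comm, one_mul, mul_one, fst_smul, add_smul]
  · have : (star a * (a * b)).snd =
        b.snd * (a.fst * star a.fst) + (a.snd * star a.snd) * b.snd := by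
      simp only [fst_mul, snd_mul, fst_star, snd_star, star_mul, star_star, star_sub]
      noncomm_ring
    rw [this, Quaternion.mul_star_self_eq_smul, Quaternion.mul_star_self_eq_smul, smul_mul_assoc,
      mul_smul_comm, one_mul, mul_one, snd_smul, add_smul]

end Octonion

instance : CompAlg Octonion where
  re := Octonion.reLm
  smul_mul r a b := Octonion.ext' (by simp [smul_sub]) (by simp)
  mul_smul r a b := Octonion.ext' (by simp [smul_sub]) (by simp)
  add_star a := by
    refine Octonion.ext' ?_ ?_
    · exact Quaternion.add_star_eq_smul a.fst
    · simp
  star_mul_self := Octonion.star_mul_self_eq_smul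
  re_one := rfl
  re_mul_comm a b := by
    change (a * b).fst.re = (b * a).fst.re
    simp
    ring
  re_mul_assoc a b c := by
    change (a * b * c).fst.re = (a * (b * c)).fst.re
    simp
    ring
  star_mul_mul := Octonion.star_mul_mul_eq_smul
  finite := inferInstanceAs (FiniteDimensional ℝ (WithLp 2 (Quaternion ℝ × Quaternion ℝ)))

end

noncomputable section

set_option linter.unusedSectionVars false

/-! ### Hermitian matrices over a composition algebra -/

namespace CompAlg

variable {K : Type} [NormedStarAlg K] [CompAlg K]

instance : IsScalarTower ℝ K K := ⟨smul_mul⟩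

instance : SMulCommClass ℝ K K := ⟨fun r a b => (mul_smul r a b).symm⟩

instance : FiniteDimensional ℝ K := finite

theorem continuous_mul' : Continuous fun p : K × K => p.1 * p.2 := by
  have : IsBoundedBilinearMap ℝ fun p : K × K => p.1 * p.2 :=
    { add_left := fun x y z => add_mul x y z
      smul_left := fun c x y => smul_mul c x y
      add_right := fun x y z => mul_add x y z
      smul_right := fun c x y => mul_smul c x y
      bound := ⟨1, one_pos, fun x y => by
        have h := norm_mul_sq x y
        rw [← mul_pow] at h
        rw [one_mul]
        exact ((sq_eq_sq₀ (norm_nonneg _) (by positivity)).mp h).le⟩ }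
  exact this.continuous

theorem continuous_re : Continuous (re : K → ℝ) :=
  LinearMap.continuous_of_finiteDimensional (re : K →ₗ[ℝ] ℝ)

theorem continuous_star' : Continuous (star : K → K) :=
  LinearMap.continuous_of_finiteDimensional
    ({ toFun := star, map_add' := star_add, map_smul' := fun r a => by
        rw [star_smul, star_trivial r]; rfl } : K →ₗ[ℝ] K)

theorem ip_zero_left (a : K) : ip 0 a = 0 := by
  rw [← zero_smul ℝ (0 : K), ip_smul_left, zero_mul]

theorem ip_zero_right (a : K) : ip a 0 = 0 := by rw [ip_comm, ip_zero_left]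

theorem ip_sum_left {ι : Type*} (s : Finset ι) (f : ι → K) (b : K) :
    ip (∑ i ∈ s, f i) b = ∑ i ∈ s, ip (f i) b := by
  classical
  induction s using Finset.induction_on with
  | empty => simp [ip_zero_left]
  | insert a s ha ih => rw [Finset.sum_insert ha, Finset.sum_insert ha, ip_add_left, ih]

theorem ip_sum_right {ι : Type*} (s : Finset ι) (f : ι → K) (b : K) :
    ip b (∑ i ∈ s, f i) = ∑ i ∈ s, ip b (f i) := by
  rw [ip_comm, ip_sum_left]
  exact Finset.sum_congr rfl fun i _ => ip_comm _ _

theorem ip_smul_one_right (r : ℝ) (a : K) : ip a (r • 1) = r * re a := by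
  rw [ip_smul_right, ip, mul_one, re_star]

end CompAlg

namespace Herm

open CompAlg

variable {K : Type} [NormedStarAlg K] {N : ℕ}

theorem ext_mat {X Y : Herm K N} (h : ∀ i j, X.mat i j = Y.mat i j) : X = Y :=
  Subtype.ext (Matrix.ext h)

theorem mat_add (X Y : Herm K N) : (X + Y).mat = X.mat + Y.mat := rfl
theorem mat_sub (X Y : Herm K N) : (X - Y).mat = X.mat - Y.mat := rfl
theorem mat_smul (r : ℝ) (X : Herm K N) : (r • X).mat = r • X.mat := rfl
theorem add_apply (X Y : Herm K N) (i j : Fin N) : (X + Y).mat i j = X.mat i j + Y.mat i j := rfl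
theorem smul_apply (r : ℝ) (X : Herm K N) (i j : Fin N) : (r • X).mat i j = r • X.mat i j := rfl

/-- The entries of a Hermitian matrix, as linear maps. -/
def entry (i j : Fin N) : Herm K N →ₗ[ℝ] K where
  toFun X := X.mat i j
  map_add' _ _ := rfl
  map_smul' _ _ := rfl

theorem star_mat (X : Herm K N) (i j : Fin N) : star (X.mat i j) = X.mat j i := by
  have h : star X.mat = X.mat := X.2
  conv_rhs => rw [← h]
  rfl

/-- A Hermitian matrix from its entries. -/
def ofMat (M : Matrix (Fin N) (Fin N) K) (h : ∀ i j, star (M i j) = M j i) : Herm K N :=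
  ⟨M, by
    change star M = M
    ext i j
    exact h j i⟩

theorem mat_ofMat (M : Matrix (Fin N) (Fin N) K) (h : ∀ i j, star (M i j) = M j i) :
    (ofMat M h).mat = M := rfl

theorem diag_apply (d : Fin N → ℝ) (i j : Fin N) :
    (diag d : Herm K N).mat i j = if i = j then d i • (1 : K) else 0 :=
  Matrix.diagonal_apply _ _ _

variable (K N) in
/-- The diagonal matrices, as a linear map. -/
def diagₗ : (Fin N → ℝ) →ₗ[ℝ] Herm K N where
  toFun := diag
  map_add' d e := ext_mat fun i j => by
    rw [add_apply, diag_apply, diag_apply, diag_apply]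
    split_ifs
    · rw [Pi.add_apply, add_smul]
    · rw [add_zero]
  map_smul' r d := ext_mat fun i j => by
    rw [RingHom.id_apply, smul_apply, diag_apply, diag_apply]
    split_ifs
    · rw [Pi.smul_apply, smul_assoc]
    · rw [smul_zero]

theorem diagₗ_apply (d : Fin N → ℝ) : diagₗ K N d = diag d := rfl

variable [CompAlg K]

instance : FiniteDimensional ℝ (Herm K N) :=
  inferInstanceAs (FiniteDimensional ℝ (selfAdjoint.submodule ℝ (Matrix (Fin N) (Fin N) K)))

theorem continuous_entry (i j : Fin N) : Continuous fun X : Herm K N => X.mat i j :=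
  LinearMap.continuous_of_finiteDimensional (entry i j : Herm K N →ₗ[ℝ] K)

theorem continuous_of_entries {Z : Type*} [TopologicalSpace Z] {f : Z → Herm K N}
    (h : ∀ i j, Continuous fun z => (f z).mat i j) : Continuous f :=
  Continuous.subtype_mk (continuous_pi fun i => continuous_pi fun j => h i j) _

/-- The diagonal entries. -/
def dre (X : Herm K N) (i : Fin N) : ℝ := re (X.mat i i)

theorem mat_self (X : Herm K N) (i : Fin N) : X.mat i i = dre X i • (1 : K) :=
  eq_re_smul_one (star_mat X i i)

theorem dre_add (X Y : Herm K N) (i : Fin N) : dre (X + Y) i = dre X i + dre Y i :=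
  map_add re _ _

theorem dre_smul (r : ℝ) (X : Herm K N) (i : Fin N) : dre (r • X) i = r * dre X i :=
  re_smul r _

theorem dre_diag (d : Fin N → ℝ) (i : Fin N) : dre (diag d : Herm K N) i = d i := by
  rw [dre, diag_apply, if_pos rfl, re_smul_one]

/-- The trace. -/
def tr (X : Herm K N) : ℝ := ∑ i, dre X i

theorem tr_add (X Y : Herm K N) : tr (X + Y) = tr X + tr Y := by
  simp only [tr, dre_add, Finset.sum_add_distrib]

theorem tr_smul (r : ℝ) (X : Herm K N) : tr (r • X) = r * tr X := by
  simp only [tr, dre_smul, Finset.mul_sum]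

theorem tr_diag (d : Fin N → ℝ) : tr (diag d : Herm K N) = ∑ i, d i := by
  simp only [tr, dre_diag]

variable (K N) in
/-- The trace, as a continuous linear form. -/
def trL : Herm K N →L[ℝ] ℝ :=
  LinearMap.toContinuousLinearMap { toFun := tr, map_add' := tr_add, map_smul' := tr_smul }

theorem trL_apply (X : Herm K N) : trL K N X = tr X := rfl

/-- The Euclidean inner product of matrices. -/
def mip (A B : Matrix (Fin N) (Fin N) K) : ℝ := ∑ i, ∑ j, ip (A i j) (B i j)

theorem mip_comm (A B : Matrix (Fin N) (Fin N) K) : mip A B = mip B A :=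
  Finset.sum_congr rfl fun _ _ => Finset.sum_congr rfl fun _ _ => ip_comm _ _

theorem mip_add_left (A B D : Matrix (Fin N) (Fin N) K) : mip (A + B) D = mip A D + mip B D := by
  simp only [mip, Matrix.add_apply, ip_add_left, Finset.sum_add_distrib]

theorem mip_smul_left (r : ℝ) (A B : Matrix (Fin N) (Fin N) K) : mip (r • A) B = r * mip A B := by
  simp only [mip, Matrix.smul_apply, ip_smul_left, Finset.mul_sum]

theorem mip_mul_left (X : Herm K N) (B D : Matrix (Fin N) (Fin N) K) :
    mip (X.mat * B) D = mip B (X.mat * D) := by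
  simp only [mip, Matrix.mul_apply, ip_sum_left, ip_sum_right, ip_mul_left, star_mat]
  rw [Finset.sum_comm]
  conv_rhs => rw [Finset.sum_comm]
  refine Finset.sum_congr rfl fun j _ => ?_
  rw [Finset.sum_comm]

theorem mip_mul_right (X : Herm K N) (A D : Matrix (Fin N) (Fin N) K) :
    mip (A * X.mat) D = mip A (D * X.mat) := by
  simp only [mip, Matrix.mul_apply, ip_sum_left, ip_sum_right, ip_mul_right, star_mat]
  refine Finset.sum_congr rfl fun i _ => ?_
  rw [Finset.sum_comm]

/-- The trace form. -/
def hip (X Y : Herm K N) : ℝ := mip X.mat Y.mat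

theorem hip_comm (X Y : Herm K N) : hip X Y = hip Y X := mip_comm _ _

theorem hip_add_left (X Y Z : Herm K N) : hip (X + Y) Z = hip X Z + hip Y Z := mip_add_left _ _ _

theorem hip_add_right (X Y Z : Herm K N) : hip X (Y + Z) = hip X Y + hip X Z := by
  rw [hip_comm, hip_add_left, hip_comm Y, hip_comm Z]

theorem hip_smul_left (r : ℝ) (X Y : Herm K N) : hip (r • X) Y = r * hip X Y := mip_smul_left _ _ _

theorem hip_smul_right (r : ℝ) (X Y : Herm K N) : hip X (r • Y) = r * hip X Y := by
  rw [hip_comm, hip_smul_left, hip_comm]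

theorem hip_sum_left {ι : Type*} (s : Finset ι) (f : ι → Herm K N) (Y : Herm K N) :
    hip (∑ i ∈ s, f i) Y = ∑ i ∈ s, hip (f i) Y := by
  classical
  induction s using Finset.induction_on with
  | empty => rw [Finset.sum_empty, Finset.sum_empty, ← zero_smul ℝ (0 : Herm K N), hip_smul_left,
      zero_mul]
  | insert a s ha ih => rw [Finset.sum_insert ha, Finset.sum_insert ha, hip_add_left, ih]

theorem hip_self (X : Herm K N) : hip X X = ∑ i, ∑ j, ‖X.mat i j‖ ^ 2 := by
  simp only [hip, mip, ip_self]

theorem hip_self_nonneg (X : Herm K N) : 0 ≤ hip X X := by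
  rw [hip_self]
  positivity

theorem norm_sq_le_hip (X : Herm K N) (i j : Fin N) : ‖X.mat i j‖ ^ 2 ≤ hip X X := by
  rw [hip_self]
  have h1 : ‖X.mat i j‖ ^ 2 ≤ ∑ j, ‖X.mat i j‖ ^ 2 :=
    Finset.single_le_sum (f := fun j => ‖X.mat i j‖ ^ 2) (fun _ _ => by positivity)
      (Finset.mem_univ j)
  exact h1.trans (Finset.single_le_sum (f := fun i => ∑ j, ‖X.mat i j‖ ^ 2)
    (fun _ _ => by positivity) (Finset.mem_univ i))

theorem eq_zero_of_hip_self {X : Herm K N} (h : hip X X = 0) : X = 0 := by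
  refine ext_mat fun i j => ?_
  have h1 := norm_sq_le_hip X i j
  rw [h] at h1
  have h2 : ‖X.mat i j‖ ^ 2 = 0 := le_antisymm h1 (by positivity)
  rwa [sq_eq_zero_iff, norm_eq_zero] at h2

theorem hip_diag (X : Herm K N) (d : Fin N → ℝ) : hip X (diag d) = ∑ i, d i * dre X i := by
  simp only [hip, mip]
  refine Finset.sum_congr rfl fun i _ => ?_
  rw [Finset.sum_eq_single i]
  · rw [diag_apply, if_pos rfl, ip_smul_one_right, dre]
  · intro j _ hj
    rw [diag_apply, if_neg hj.symm, ip_zero_right]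
  · simp

theorem hip_one (X : Herm K N) : hip X (diag 1) = tr X := by
  rw [hip_diag]
  simp [tr]

theorem continuous_hip {Z : Type*} [TopologicalSpace Z] {f g : Z → Herm K N} (hf : Continuous f)
    (hg : Continuous g) : Continuous fun z => hip (f z) (g z) := by
  unfold hip mip ip
  refine continuous_finsetSum _ fun i _ => continuous_finsetSum _ fun j _ => ?_
  refine continuous_re.comp (continuous_mul'.comp (Continuous.prodMk ?_ ?_))
  · exact continuous_star'.comp ((continuous_entry i j).comp hf)
  · exact (continuous_entry i j).comp hg

/-- The Jordan product. -/
def jmul (X Y : Herm K N) : Herm K N :=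
  ofMat ((1 / 2 : ℝ) • (X.mat * Y.mat + Y.mat * X.mat)) (fun i j => by
    simp only [Matrix.smul_apply, Matrix.add_apply, Matrix.mul_apply, star_smul, star_add,
      star_sum, star_mul, star_mat, star_trivial (1 / 2 : ℝ)]
    rw [add_comm])

theorem mat_jmul (X Y : Herm K N) :
    (jmul X Y).mat = (1 / 2 : ℝ) • (X.mat * Y.mat + Y.mat * X.mat) := rfl

theorem jmul_comm (X Y : Herm K N) : jmul X Y = jmul Y X := by
  refine ext_mat fun i j => ?_
  rw [mat_jmul, mat_jmul, add_comm]

theorem mat_jmul_self (X : Herm K N) : (jmul X X).mat = X.mat * X.mat := by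
  rw [mat_jmul, ← two_smul ℝ, smul_smul]
  norm_num

theorem jmul_add_left (X Y Z : Herm K N) : jmul (X + Y) Z = jmul X Z + jmul Y Z := by
  refine Subtype.ext ?_
  change (jmul (X + Y) Z).mat = (jmul X Z).mat + (jmul Y Z).mat
  simp only [mat_jmul, mat_add, Matrix.add_mul, Matrix.mul_add, smul_add]
  abel

theorem jmul_add_right (X Y Z : Herm K N) : jmul X (Y + Z) = jmul X Y + jmul X Z := by
  rw [jmul_comm, jmul_add_left, jmul_comm Y, jmul_comm Z]

theorem jmul_smul_left (r : ℝ) (X Y : Herm K N) : jmul (r • X) Y = r • jmul X Y := by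
  refine Subtype.ext ?_
  change (jmul (r • X) Y).mat = r • (jmul X Y).mat
  simp only [mat_jmul, mat_smul, Matrix.smul_mul, Matrix.mul_smul, ← smul_add]
  rw [smul_comm]

theorem jmul_smul_right (r : ℝ) (X Y : Herm K N) : jmul X (r • Y) = r • jmul X Y := by
  rw [jmul_comm, jmul_smul_left, jmul_comm]

theorem jmul_one (X : Herm K N) : jmul X (diag 1) = X := by
  refine Subtype.ext ?_
  change (jmul X (diag 1)).mat = X.mat
  have : (diag 1 : Herm K N).mat = 1 := by
    ext i j
    rw [diag_apply, Matrix.one_apply]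
    simp
  rw [mat_jmul, this, mul_one, one_mul, ← two_smul ℝ, smul_smul]
  norm_num

/-- Left and right multiplication by a Hermitian matrix are self-adjoint for the Euclidean product
of matrices, hence so is Jordan multiplication. -/
theorem hip_jmul (X Y Z : Herm K N) : hip (jmul X Y) Z = hip X (jmul Y Z) := by
  rw [hip, hip, mat_jmul, mip_smul_left, mip_add_left, mip_mul_left Y, mip_mul_right Y,
    mat_jmul, mip_comm X.mat ((1 / 2 : ℝ) • _), mip_smul_left, mip_add_left,
    mip_comm X.mat, mip_comm X.mat, add_comm]

theorem hip_eq_tr (X Y : Herm K N) : hip X Y = tr (jmul X Y) := by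
  rw [← hip_one, hip_jmul, jmul_one]

theorem dre_jmul_self (X : Herm K N) (i : Fin N) : dre (jmul X X) i = ∑ j, ‖X.mat i j‖ ^ 2 := by
  rw [dre, mat_jmul_self, Matrix.mul_apply, map_sum]
  refine Finset.sum_congr rfl fun j _ => ?_
  rw [← star_mat X i j, mul_star_self, re_smul_one]

theorem jmul_diag (d e : Fin N → ℝ) : jmul (diag d) (diag e) = (diag (d * e) : Herm K N) := by
  refine Subtype.ext ?_
  change (jmul (diag d) (diag e)).mat = (diag (d * e) : Herm K N).mat
  have : ∀ d e : Fin N → ℝ, (diag d : Herm K N).mat * (diag e : Herm K N).mat =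
      (diag (d * e) : Herm K N).mat := by
    intro d e
    change Matrix.diagonal _ * Matrix.diagonal _ = Matrix.diagonal _
    rw [Matrix.diagonal_mul_diagonal]
    congr 1
    funext i
    rw [CompAlg.smul_one_mul, smul_smul, Pi.mul_apply]
  rw [mat_jmul, this, this, mul_comm e d, ← two_smul ℝ, smul_smul]
  norm_num

theorem continuous_jmul {Z : Type*} [TopologicalSpace Z] {f g : Z → Herm K N} (hf : Continuous f)
    (hg : Continuous g) : Continuous fun z => jmul (f z) (g z) := by
  refine continuous_of_entries fun i j => ?_
  simp only [mat_jmul, Matrix.smul_apply, Matrix.add_apply, Matrix.mul_apply]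
  refine Continuous.const_smul (Continuous.add ?_ ?_) _ <;>
  refine continuous_finsetSum _ fun k _ => continuous_mul'.comp (Continuous.prodMk ?_ ?_)
  · exact (continuous_entry i k).comp hf
  · exact (continuous_entry k j).comp hg
  · exact (continuous_entry i k).comp hg
  · exact (continuous_entry k j).comp hf

/-- The conjugation `X ↦ D X D` by a real diagonal matrix. -/
def scale (d : Fin N → ℝ) : Herm K N →ₗ[ℝ] Herm K N where
  toFun X := ofMat (Matrix.of fun i j => (d i * d j) • X.mat i j) (fun i j => by
    rw [Matrix.of_apply, Matrix.of_apply, star_smul, star_trivial (d i * d j), star_mat, mul_comm])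
  map_add' X Y := ext_mat fun i j => smul_add _ _ _
  map_smul' r X := ext_mat fun i j => smul_comm _ _ _

theorem scale_apply (d : Fin N → ℝ) (X : Herm K N) (i j : Fin N) :
    (scale d X).mat i j = (d i * d j) • X.mat i j := rfl

theorem mat_scale (d : Fin N → ℝ) (X : Herm K N) :
    (scale d X).mat = (diag d : Herm K N).mat * X.mat * (diag d : Herm K N).mat := by
  ext i j
  have h : ∀ d : Fin N → ℝ, (diag d : Herm K N).mat = Matrix.diagonal fun k => d k • (1 : K) :=
    fun _ => rfl
  rw [h, Matrix.mul_diagonal, Matrix.diagonal_mul, CompAlg.smul_one_mul, CompAlg.mul_smul_one, scale_apply, smul_smul,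
    mul_comm]

theorem scale_scale (d e : Fin N → ℝ) (X : Herm K N) : scale d (scale e X) = scale (d * e) X := by
  refine ext_mat fun i j => ?_
  rw [scale_apply, scale_apply, scale_apply, smul_smul, Pi.mul_apply, Pi.mul_apply]
  congr 1
  ring

theorem scale_one (X : Herm K N) : scale 1 X = X := by
  refine ext_mat fun i j => ?_
  simp [scale_apply]

theorem scale_diag (d e : Fin N → ℝ) : scale d (diag e : Herm K N) = diag (d * d * e) := by
  refine ext_mat fun i j => ?_
  rw [scale_apply, diag_apply, diag_apply]
  split_ifs with h
  · rw [smul_smul, h]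
    rfl
  · rw [smul_zero]

theorem hip_scale (d : Fin N → ℝ) (X Y : Herm K N) : hip (scale d X) Y = hip X (scale d Y) := by
  simp only [hip, mip, scale_apply, ip_smul_left, ip_smul_right]

end Herm

end

/-! ### Automorphisms of the Jordan algebra and diagonalisation. -/

noncomputable section

set_option linter.unusedSectionVars false

/-- Endpoints of a path of invertible maps starting at the identity. -/
theorem exists_mem_connectedComponent_of_path {V : Type*} [NormedAddCommGroup V] [NormedSpace ℝ V]
    [FiniteDimensional ℝ V] (S : Subgroup (V →L[ℝ] V)ˣ) (F : ℝ → V →ₗ[ℝ] V)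
    (hcont : ∀ X, Continuous fun θ => F θ X) (hinj : ∀ θ, Function.Injective (F θ))
    (h0 : ∀ X, F 0 X = X) (hS : ∀ θ (u : (V →L[ℝ] V)ˣ), (∀ X, u • X = F θ X) → u ∈ S) (θ : ℝ) :
    ∃ g ∈ Subgroup.connectedComponentOfOne S, ∀ X, g • X = F θ X := by
  have : CompleteSpace V := FiniteDimensional.complete ℝ V
  let u : ℝ → (V →L[ℝ] V)ˣ := fun θ =>
    ContinuousLinearEquiv.toUnit (LinearEquiv.ofInjectiveEndo (F θ) (hinj θ)).toContinuousLinearEquiv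
  have hu : ∀ θ X, u θ • X = F θ X := fun θ X => rfl
  have hcu : Continuous u := by
    -- In finite dimension the units have the topology induced by the operators, and continuity of
    -- operators can be tested vector by vector.
    rw [Units.isOpenEmbedding_val.isInducing.continuous_iff, continuous_clm_apply]
    exact hcont
  let w : ℝ → S := fun θ => ⟨u θ, hS θ _ (hu θ)⟩
  have hcw : Continuous w := hcu.subtype_mk _
  have hw0 : w 0 = 1 := by
    refine Subtype.ext (Units.ext (ContinuousLinearMap.ext fun X => ?_))
    exact h0 X
  refine ⟨w θ, ?_, hu θ⟩
  have h1 : w θ ∈ connectedComponent (w 0) :=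
    (isPreconnected_range hcw).subset_connectedComponent ⟨0, rfl⟩ ⟨θ, rfl⟩
  rw [hw0] at h1
  exact h1

namespace Herm

open CompAlg hiding mul_smul smul_mul smul_one_mul mul_smul_one mul_mul_mul

variable {K : Type} [NormedStarAlg K] [CompAlg K] {N : ℕ}

variable (K N) in
/-- The compact group of automorphisms of the Euclidean Jordan algebra of Hermitian matrices. -/
def jGroup : Subgroup (Herm K N →L[ℝ] Herm K N)ˣ where
  carrier := {g | (∀ X Y : Herm K N, jmul (g • X) (g • Y) = g • jmul X Y) ∧
    ∀ X Y : Herm K N, hip (g • X) (g • Y) = hip X Y}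
  one_mem' := ⟨fun X Y => by simp, fun X Y => by simp⟩
  mul_mem' := by
    rintro g k ⟨h1, h2⟩ ⟨h3, h4⟩
    exact ⟨fun X Y => by rw [mul_smul, mul_smul, mul_smul, h1, h3],
      fun X Y => by rw [mul_smul, mul_smul, h2, h4]⟩
  inv_mem' := by
    rintro g ⟨h1, h2⟩
    refine ⟨fun X Y => ?_, fun X Y => ?_⟩
    · rw [eq_inv_smul_iff, ← h1, smul_inv_smul, smul_inv_smul]
    · rw [← h2, smul_inv_smul, smul_inv_smul]

theorem jmul_smul (g : jGroup K N) (X Y : Herm K N) : jmul (g • X) (g • Y) = g • jmul X Y :=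
  g.2.1 X Y

theorem hip_smul_smul (g : jGroup K N) (X Y : Herm K N) : hip (g • X) (g • Y) = hip X Y :=
  g.2.2 X Y

theorem hip_smul (g : jGroup K N) (X Y : Herm K N) : hip (g • X) Y = hip X (g⁻¹ • Y) := by
  conv_lhs => rw [← smul_inv_smul g Y]
  exact hip_smul_smul g _ _

theorem smul_diag_one (g : jGroup K N) : g • (diag 1 : Herm K N) = diag 1 := by
  have h1 := jmul_smul g (g⁻¹ • (diag 1 : Herm K N)) (diag 1)
  rw [jmul_one, smul_inv_smul, jmul_comm, jmul_one] at h1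
  exact h1

theorem tr_smul_jGroup (g : jGroup K N) (X : Herm K N) : tr (g • X) = tr X := by
  rw [← hip_one, ← hip_one]
  conv_lhs => rw [← smul_diag_one g]
  exact hip_smul_smul g _ _

attribute [local instance] Matrix.normedAddCommGroup Matrix.normedSpace in
theorem norm_sq_le_hip_self (X : Herm K N) : ‖X‖ ^ 2 ≤ hip X X := by
  have h : ‖X‖ ≤ √(hip X X) := by
    change ‖X.mat‖ ≤ _
    refine (Matrix.norm_le_iff (Real.sqrt_nonneg _)).mpr fun i j => ?_
    exact Real.le_sqrt_of_sq_le (norm_sq_le_hip X i j)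
  calc ‖X‖ ^ 2 ≤ √(hip X X) ^ 2 := by gcongr
    _ = hip X X := Real.sq_sqrt (hip_self_nonneg X)

attribute [local instance] Matrix.normedAddCommGroup Matrix.normedSpace in
theorem hip_self_le (X : Herm K N) : hip X X ≤ (N * ‖X‖) ^ 2 := by
  have h : ∀ i j, ‖X.mat i j‖ ≤ ‖X‖ := fun i j =>
    Matrix.norm_entry_le_entrywise_sup_norm X.mat
  rw [hip_self]
  calc ∑ i, ∑ j, ‖X.mat i j‖ ^ 2 ≤ ∑ _i : Fin N, ∑ _j : Fin N, ‖X‖ ^ 2 := by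
        gcongr with i _ j _
        exact h i j
    _ = (N * ‖X‖) ^ 2 := by
        simp
        ring

theorem isClosed_jGroup : IsClosed (jGroup K N : Set (Herm K N →L[ℝ] Herm K N)ˣ) := by
  have hc : ∀ X : Herm K N, Continuous fun g : (Herm K N →L[ℝ] Herm K N)ˣ => g • X :=
    fun X => Units.continuous_val.clm_apply continuous_const
  have : (jGroup K N : Set (Herm K N →L[ℝ] Herm K N)ˣ) =
      (⋂ X : Herm K N, ⋂ Y : Herm K N, {g | jmul (g • X) (g • Y) = g • jmul X Y}) ∩
        ⋂ X : Herm K N, ⋂ Y : Herm K N, {g | hip (g • X) (g • Y) = hip X Y} := by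
    ext g
    simp only [Set.mem_inter_iff, Set.mem_iInter, Set.mem_ofPred_eq]
    rfl
  rw [this]
  refine IsClosed.inter ?_ ?_ <;> refine isClosed_iInter fun X => isClosed_iInter fun Y => ?_
  · exact isClosed_eq (continuous_jmul (hc X) (hc Y)) (hc _)
  · exact isClosed_eq (continuous_hip (hc X) (hc Y)) continuous_const

/-- These maps preserve the trace form, whose norm lies between the largest entry and N times it; so
g and g⁻¹ have operator norm at most N. -/
instance compactSpace_jGroup : CompactSpace (jGroup K N) := by
  refine isCompact_iff_compactSpace.mp ?_
  have hb : ∀ g ∈ jGroup K N, ‖((g : (Herm K N →L[ℝ] Herm K N)ˣ) : Herm K N →L[ℝ] Herm K N)‖ ≤ N := by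
    intro g hg
    refine ContinuousLinearMap.opNorm_le_bound _ (by positivity) fun X => ?_
    refine (sq_le_sq₀ (norm_nonneg _) (by positivity)).mp ?_
    calc ‖((g : (Herm K N →L[ℝ] Herm K N)ˣ) : Herm K N →L[ℝ] Herm K N) X‖ ^ 2
        ≤ hip (g • X) (g • X) := norm_sq_le_hip_self _
      _ = hip X X := hg.2 X X
      _ ≤ _ := hip_self_le X
  exact ConvProj.isCompact_units_of_norm_le isClosed_jGroup N hb fun g hg => hb _ (inv_mem hg)

theorem jmul_of_sq {F : Herm K N →ₗ[ℝ] Herm K N} (h : ∀ X, jmul (F X) (F X) = F (jmul X X))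
    (X Y : Herm K N) : jmul (F X) (F Y) = F (jmul X Y) := by
  have h1 := h (X + Y)
  simp only [map_add, jmul_add_left, jmul_add_right, h, jmul_comm Y X, jmul_comm (F Y) (F X)] at h1
  have h2 : (2 : ℝ) • jmul (F X) (F Y) = (2 : ℝ) • F (jmul X Y) := by
    rw [two_smul, two_smul]
    have h3 : ∀ a b c d : Herm K N, a + b + (b + d) = a + c + (c + d) → b + b = c + c := by
      intro a b c d h
      have : b + b = (a + b + (b + d)) - a - d := by abel
      rw [this, h]
      abel
    exact h3 _ _ _ _ h1
  exact smul_right_injective _ (two_ne_zero (α := ℝ)) h2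

variable (K N) in
/-- Existence of plane rotations among the automorphisms of the Jordan algebra: for all `j ≠ k` and
all units `a`, there is a path of automorphisms which acts on the diagonal entries as the conjugation
by the plane rotations with coefficients `cos θ`, `sin θ a`. -/
def HasRot : Prop := ∀ j k : Fin N, j ≠ k → ∀ a : K, ‖a‖ = 1 →
  ∃ F : ℝ → Herm K N →ₗ[ℝ] Herm K N, (∀ X, Continuous fun θ => F θ X) ∧ (∀ X, F 0 X = X) ∧
    (∀ θ X, jmul (F θ X) (F θ X) = F θ (jmul X X)) ∧
    (∀ θ X, dre (F θ X) j = Real.cos θ ^ 2 * dre X j + Real.sin θ ^ 2 * dre X k +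
      2 * Real.cos θ * Real.sin θ * ip a (X.mat j k)) ∧
    (∀ θ X, dre (F θ X) k = Real.sin θ ^ 2 * dre X j + Real.cos θ ^ 2 * dre X k -
      2 * Real.cos θ * Real.sin θ * ip a (X.mat j k)) ∧
    ∀ θ X l, l ≠ j → l ≠ k → dre (F θ X) l = dre X l

variable (K N) in
/-- The identity component of the group of automorphisms of the Jordan algebra. -/
abbrev jGroupId : Subgroup (jGroup K N) := Subgroup.connectedComponentOfOne (jGroup K N)

theorem HasRot.exists_mem (hrot : HasRot K N) {j k : Fin N} (hjk : j ≠ k) {a : K} (ha : ‖a‖ = 1)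
    (θ : ℝ) : ∃ g ∈ jGroupId K N, ∀ X : Herm K N,
      dre (g • X) j = Real.cos θ ^ 2 * dre X j + Real.sin θ ^ 2 * dre X k +
        2 * Real.cos θ * Real.sin θ * ip a (X.mat j k) ∧
      dre (g • X) k = Real.sin θ ^ 2 * dre X j + Real.cos θ ^ 2 * dre X k -
        2 * Real.cos θ * Real.sin θ * ip a (X.mat j k) ∧
      ∀ l, l ≠ j → l ≠ k → dre (g • X) l = dre X l := by
  obtain ⟨F, hF1, hF2, hF3, hF4, hF5, hF6⟩ := hrot j k hjk a ha
  -- The rotation redistributes two diagonal entries without changing their sum. The trace form is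
  -- the trace of the Jordan product, so it is preserved as well.
  have htr : ∀ θ X, tr (F θ X) = tr X := by
    intro θ X
    rw [← sub_eq_zero, tr, tr, ← Finset.sum_sub_distrib,
      Finset.sum_eq_add j k hjk (fun l _ hl => by rw [hF6 θ X l hl.1 hl.2, sub_self])
        (fun h => absurd (Finset.mem_univ _) h) (fun h => absurd (Finset.mem_univ _) h), hF4, hF5]
    linear_combination (dre X j + dre X k) * Real.cos_sq_add_sin_sq θ
  have hjm : ∀ θ X Y, jmul (F θ X) (F θ Y) = F θ (jmul X Y) := fun θ => jmul_of_sq (hF3 θ)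
  have hhip : ∀ θ X Y, hip (F θ X) (F θ Y) = hip X Y := by
    intro θ X Y
    rw [hip_eq_tr, hjm, htr, hip_eq_tr]
  obtain ⟨g, hg, hgF⟩ := exists_mem_connectedComponent_of_path (jGroup K N) F hF1 (fun θ => by
    rw [injective_iff_map_eq_zero]
    intro X hX
    refine eq_zero_of_hip_self ?_
    rw [← hhip θ, hX, ← zero_smul ℝ (0 : Herm K N), hip_smul_left, zero_mul]) hF2 (fun θ u hu => by
    refine ⟨fun X Y => ?_, fun X Y => ?_⟩
    · rw [hu, hu, hu, hjm]
    · rw [hu, hu, hhip]) θ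
  refine ⟨g, hg, fun X => ?_⟩
  rw [hgF]
  exact ⟨hF4 θ X, hF5 θ X, hF6 θ X⟩

/-- Diagonalization of Hermitian matrices by the identity component of the automorphism group. -/
theorem HasRot.exists_diag (hrot : HasRot K N) (X : Herm K N) :
    ∃ g ∈ jGroupId K N, ∃ l, g • X = diag l := by
  have hcl : IsClosed (jGroupId K N : Set (jGroup K N)) := isClosed_connectedComponent
  have hcont : Continuous fun g : jGroup K N => ∑ i, dre (g • X) i ^ 2 := by
    refine continuous_finsetSum _ fun i _ => Continuous.pow ?_ 2
    refine continuous_re.comp ((continuous_entry i i).comp ?_)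
    change Continuous fun g : jGroup K N =>
      ((g : (Herm K N →L[ℝ] Herm K N)ˣ) : Herm K N →L[ℝ] Herm K N) X
    exact (Units.continuous_val.comp continuous_subtype_val).clm_apply continuous_const
  -- Jacobi's method: on the compact identity component, maximise the sum of the squares of the
  -- diagonal entries. A nonzero off-diagonal entry would allow it to increase.
  obtain ⟨g, hg, hmax⟩ := hcl.isCompact.exists_isMaxOn ⟨1, one_mem _⟩ hcont.continuousOn
  refine ⟨g, hg, dre (g • X), ext_mat fun j k => ?_⟩
  rw [diag_apply]
  split_ifs with hjk
  · rw [hjk, mat_self]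
  by_contra hne
  set Y := g • X with hY
  set m := ‖Y.mat j k‖ with hm
  have hm0 : 0 < m := norm_pos_iff.mpr hne
  set a : K := m⁻¹ • Y.mat j k with ha
  have ha1 : ‖a‖ = 1 := by
    rw [ha, norm_smul, norm_inv, norm_norm, inv_mul_cancel₀ hm0.ne']
  have hip : ip a (Y.mat j k) = m := by
    rw [ha, ip_smul_left, ip_self, ← hm]
    field_simp
  -- The rotation by θ changes the difference of the two diagonal entries to cos 2θ times the old
  -- one plus sin 2θ times 2m. Taking 2θ to be the argument of z makes the new difference equal to
  -- ‖z‖.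
  set z : ℂ := ⟨dre Y j - dre Y k, 2 * m⟩ with hz
  set θ := z.arg / 2 with hθ
  have hcos : ‖z‖ * Real.cos (2 * θ) = dre Y j - dre Y k := by
    rw [hθ, mul_div_cancel₀ _ two_ne_zero]
    exact Complex.norm_mul_cos_arg z
  have hsin : ‖z‖ * Real.sin (2 * θ) = 2 * m := by
    rw [hθ, mul_div_cancel₀ _ two_ne_zero]
    exact Complex.norm_mul_sin_arg z
  have hnorm : ‖z‖ ^ 2 = (dre Y j - dre Y k) ^ 2 + (2 * m) ^ 2 := by
    rw [Complex.sq_norm, Complex.normSq_apply]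
    ring
  obtain ⟨r, hr, hrY⟩ := hrot.exists_mem hjk ha1 θ
  obtain ⟨e1, e2, e3⟩ := hrY Y
  rw [hip] at e1 e2
  have hsum : dre (r • Y) j + dre (r • Y) k = dre Y j + dre Y k := by
    rw [e1, e2]
    linear_combination (dre Y j + dre Y k) * Real.cos_sq_add_sin_sq θ
  have hdiff : dre (r • Y) j - dre (r • Y) k = ‖z‖ := by
    rw [e1, e2]
    have h1 : ‖z‖ = ‖z‖ * (Real.cos (2 * θ) ^ 2 + Real.sin (2 * θ) ^ 2) := by
      rw [Real.cos_sq_add_sin_sq, mul_one]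
    have h2 : Real.cos (2 * θ) = Real.cos θ ^ 2 - Real.sin θ ^ 2 := Real.cos_two_mul' θ
    have h3 : Real.sin (2 * θ) = 2 * Real.sin θ * Real.cos θ := Real.sin_two_mul θ
    calc _ = Real.cos (2 * θ) * (dre Y j - dre Y k) + Real.sin (2 * θ) * (2 * m) := by
          rw [h2, h3]
          ring
      _ = ‖z‖ := by
          rw [← hcos, ← hsin]
          conv_rhs => rw [h1]
          ring
  -- The sum of the two entries is unchanged and the square of their difference grows by 4m², so the
  -- sum of their squares grows by 2m².
  have hlt : ∑ i, dre Y i ^ 2 < ∑ i, dre (r • Y) i ^ 2 := by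
    rw [← sub_pos, ← Finset.sum_sub_distrib,
      Finset.sum_eq_add j k hjk (fun l _ hl => by rw [e3 l hl.1 hl.2, sub_self])
        (fun h => absurd (Finset.mem_univ _) h) (fun h => absurd (Finset.mem_univ _) h)]
    have h5 : (dre (r • Y) j - dre (r • Y) k) ^ 2 = (dre Y j - dre Y k) ^ 2 + (2 * m) ^ 2 := by
      rw [hdiff, hnorm]
    have h6 : (dre (r • Y) j + dre (r • Y) k) ^ 2 = (dre Y j + dre Y k) ^ 2 := by rw [hsum]
    have h7 : 0 < m ^ 2 := by positivity
    nlinarith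
  have h8 := hmax (mul_mem hr hg)
  simp only [Set.mem_ofPred_eq, mul_smul] at h8
  exact absurd h8 (not_le.mpr hlt)

theorem HasRot.exists_smul_diag (hrot : HasRot K N) (X : Herm K N) :
    ∃ g ∈ jGroupId K N, ∃ l, g • diag l = X := by
  obtain ⟨g, hg, l, hl⟩ := hrot.exists_diag X
  exact ⟨g⁻¹, inv_mem hg, l, by rw [← hl, inv_smul_smul]⟩

/-- The trace form of X is the sum of the squares of all entries; if the diagonal accounts for all
of it, nothing remains elsewhere. -/
theorem eq_diag_of_hip {X : Herm K N} {l : Fin N → ℝ} (h1 : dre X = l)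
    (h2 : hip X X = ∑ i, l i ^ 2) : X = diag l := by
  have h3 : hip (X + (-1 : ℝ) • diag l) (X + (-1 : ℝ) • diag l) = 0 := by
    simp only [hip_add_left, hip_add_right, hip_smul_left, hip_smul_right, h2, hip_comm (diag l) X]
    rw [hip_diag, hip_diag, h1]
    have : dre (diag l : Herm K N) = l := funext fun i => dre_diag l i
    rw [this]
    simp only [← sq]
    ring
  have h4 := eq_zero_of_hip_self h3
  rw [neg_one_smul, ← sub_eq_add_neg, sub_eq_zero] at h4
  exact h4

/-- A rotation by π/2 exchanges two diagonal entries. `HasRot` says nothing of the other entries,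
but preservation of the trace form makes the image of a diagonal matrix diagonal. -/
theorem HasRot.exists_perm (hrot : HasRot K N) (σ : Equiv.Perm (Fin N)) :
    ∃ g ∈ jGroupId K N, ∀ l, g • (diag l : Herm K N) = diag (l ∘ σ) := by
  induction σ using Equiv.Perm.swap_induction_on with
  | one => exact ⟨1, one_mem _, fun l => by rw [one_smul]; rfl⟩
  | swap_mul σ j k hjk ih =>
    obtain ⟨g, hg, hgl⟩ := ih
    have h1 : ‖(1 : K)‖ = 1 :=
      (pow_eq_one_iff_of_nonneg (norm_nonneg _) two_ne_zero).mp (norm_one_sq (K := K))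
    obtain ⟨r, hr, hrX⟩ := hrot.exists_mem hjk h1 (Real.pi / 2)
    refine ⟨g * r, mul_mem hg hr, fun l => ?_⟩
    have h2 : r • (diag l : Herm K N) = diag (l ∘ Equiv.swap j k) := by
      obtain ⟨e1, e2, e3⟩ := hrX (diag l)
      simp only [Real.cos_pi_div_two, Real.sin_pi_div_two, dre_diag] at e1 e2 e3
      refine eq_diag_of_hip (funext fun i => ?_) ?_
      · rw [Function.comp_apply]
        rcases eq_or_ne i j with rfl | hij
        · rw [Equiv.swap_apply_left, e1]
          ring
        rcases eq_or_ne i k with rfl | hik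
        · rw [Equiv.swap_apply_right, e2]
          ring
        rw [Equiv.swap_apply_of_ne_of_ne hij hik, e3 i hij hik]
      · rw [hip_smul_smul, hip_diag]
        simp only [dre_diag, Function.comp_apply, ← sq]
        exact (Equiv.sum_comp (Equiv.swap j k) fun i => l i ^ 2).symm
    rw [mul_smul, h2, hgl, Equiv.Perm.coe_mul, Function.comp_assoc]

end Herm

end

/-! ### Plane rotations with a coefficient in 𝕂 are Jordan automorphisms. -/

noncomputable section

set_option linter.unusedSectionVars false

namespace Herm

open CompAlg hiding mul_smul smul_mul smul_one_mul mul_smul_one mul_mul_mul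

variable {K : Type} [NormedStarAlg K] [CompAlg K] {N : ℕ}

theorem sum_eq_add_add_sum {M : Type*} [AddCommMonoid M] {j k : Fin N} (hjk : j ≠ k)
    (f : Fin N → M) :
    ∑ l, f l = f j + f k + ∑ l ∈ ({j, k} : Finset (Fin N))ᶜ, f l := by
  rw [← Finset.sum_pair hjk, Finset.sum_add_sum_compl]

theorem mem_compl_pair {j k l : Fin N} : l ∈ ({j, k} : Finset (Fin N))ᶜ ↔ l ≠ j ∧ l ≠ k := by
  simp

/-- The new diagonal entry after a plane rotation. -/
def rotDiag (c s : ℝ) (a : K) (j k : Fin N) (X : Herm K N) : ℝ :=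
  c ^ 2 * dre X j + s ^ 2 * dre X k + 2 * c * s * ip a (X.mat j k)

/-- The new off-diagonal entry in the plane of a rotation. -/
def rotOff (c s : ℝ) (a : K) (j k : Fin N) (X : Herm K N) : K :=
  X.mat j k + (c * s * (dre X k - dre X j) - 2 * s ^ 2 * ip a (X.mat j k)) • a

/-- The new entry outside of the plane of a rotation. -/
def rotRow (c s : ℝ) (a : K) (j k : Fin N) (X : Herm K N) (q : Fin N) : K :=
  c • X.mat j q + s • (a * X.mat k q)

/-- The entries of the image of a Hermitian matrix by a plane rotation. -/
def rotMat (c s : ℝ) (a : K) (j k : Fin N) (X : Herm K N) : Matrix (Fin N) (Fin N) K := fun p q =>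
  if p = j then
    if q = j then rotDiag c s a j k X • 1
    else if q = k then rotOff c s a j k X
    else rotRow c s a j k X q
  else if p = k then
    if q = j then star (rotOff c s a j k X)
    else if q = k then rotDiag c s (-star a) k j X • 1
    else rotRow c s (-star a) k j X q
  else if q = j then star (rotRow c s a j k X p)
  else if q = k then star (rotRow c s (-star a) k j X p)
  else X.mat p q

theorem rotDiag_add (c s : ℝ) (a : K) (j k : Fin N) (X Y : Herm K N) :
    rotDiag c s a j k (X + Y) = rotDiag c s a j k X + rotDiag c s a j k Y := by
  simp only [rotDiag, dre_add, add_apply, ip_add_right]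
  ring

theorem rotDiag_smul (c s : ℝ) (a : K) (j k : Fin N) (r : ℝ) (X : Herm K N) :
    rotDiag c s a j k (r • X) = r * rotDiag c s a j k X := by
  simp only [rotDiag, dre_smul, smul_apply, ip_smul_right]
  ring

theorem rotOff_add (c s : ℝ) (a : K) (j k : Fin N) (X Y : Herm K N) :
    rotOff c s a j k (X + Y) = rotOff c s a j k X + rotOff c s a j k Y := by
  simp only [rotOff, dre_add, add_apply, ip_add_right]
  module

theorem rotOff_smul (c s : ℝ) (a : K) (j k : Fin N) (r : ℝ) (X : Herm K N) :
    rotOff c s a j k (r • X) = r • rotOff c s a j k X := by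
  simp only [rotOff, dre_smul, smul_apply, ip_smul_right]
  module

theorem rotRow_add (c s : ℝ) (a : K) (j k : Fin N) (X Y : Herm K N) (q : Fin N) :
    rotRow c s a j k (X + Y) q = rotRow c s a j k X q + rotRow c s a j k Y q := by
  simp only [rotRow, add_apply, mul_add]
  module

theorem rotRow_smul (c s : ℝ) (a : K) (j k : Fin N) (r : ℝ) (X : Herm K N) (q : Fin N) :
    rotRow c s a j k (r • X) q = r • rotRow c s a j k X q := by
  simp only [rotRow, smul_apply, CompAlg.mul_smul]
  module

theorem star_rotMat {c s : ℝ} {a : K} {j k : Fin N} (hjk : j ≠ k) (X : Herm K N) (p q : Fin N) :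
    star (rotMat c s a j k X p q) = rotMat c s a j k X q p := by
  unfold rotMat
  by_cases hpj : p = j <;> by_cases hpk : p = k <;> by_cases hqj : q = j <;> by_cases hqk : q = k <;>
    first
    | exact absurd (hpj.symm.trans hpk) hjk
    | exact absurd (hqj.symm.trans hqk) hjk
    | simp only [hpj, hpk, hqj, hqk, if_true, if_false, hjk.symm, star_star, star_smul_one, star_mat]

/-- The plane rotations, acting on Hermitian matrices. -/
def rot (c s : ℝ) (a : K) {j k : Fin N} (hjk : j ≠ k) : Herm K N →ₗ[ℝ] Herm K N where
  toFun X := ofMat (rotMat c s a j k X) (star_rotMat hjk X)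
  map_add' X Y := ext_mat fun p q => by
    rw [mat_ofMat, add_apply, mat_ofMat, mat_ofMat]
    unfold rotMat
    split_ifs <;> simp only [rotDiag_add, rotOff_add, rotRow_add, add_smul, star_add, add_apply]
  map_smul' r X := ext_mat fun p q => by
    rw [mat_ofMat, RingHom.id_apply, smul_apply, mat_ofMat]
    unfold rotMat
    split_ifs <;> simp only [rotDiag_smul, rotOff_smul, rotRow_smul, mul_smul, star_smul,
      star_trivial r, smul_apply]

section

variable (c s : ℝ) (a : K) {j k : Fin N} (hjk : j ≠ k) (X : Herm K N)

theorem rot_apply (p q : Fin N) : (rot c s a hjk X).mat p q = rotMat c s a j k X p q := rfl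

theorem rot_row {q : Fin N} (hqj : q ≠ j) (hqk : q ≠ k) :
    (rot c s a hjk X).mat j q = rotRow c s a j k X q := by
  rw [rot_apply, rotMat, if_pos rfl, if_neg hqj, if_neg hqk]

theorem rot_off : (rot c s a hjk X).mat j k = rotOff c s a j k X := by
  rw [rot_apply, rotMat, if_pos rfl, if_neg hjk.symm, if_pos rfl]

theorem dre_rot_left : dre (rot c s a hjk X) j = rotDiag c s a j k X := by
  rw [dre, rot_apply, rotMat, if_pos rfl, if_pos rfl, re_smul_one]

theorem rot_other {p q : Fin N} (hpj : p ≠ j) (hpk : p ≠ k) (hqj : q ≠ j) (hqk : q ≠ k) :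
    (rot c s a hjk X).mat p q = X.mat p q := by
  rw [rot_apply, rotMat, if_neg hpj, if_neg hpk, if_neg hqj, if_neg hqk]

/-- Exchanging the two indices amounts to replacing a by minus its conjugate, so every computation
on row j also serves for row k. -/
theorem rot_symm : rot c s a hjk X = rot c s (-star a) hjk.symm X := by
  have h1 : -star (-star a) = a := by rw [star_neg, star_star, neg_neg]
  have h2 : star (rotOff c s a j k X) = rotOff c s (-star a) k j X := by
    have : ip (star a) (X.mat k j) = ip a (X.mat j k) := by rw [← star_mat X j k, ip_star_star]
    rw [rotOff, rotOff, star_add, star_mat, star_smul,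
      star_trivial (c * s * (dre X k - dre X j) - 2 * s ^ 2 * ip a (X.mat j k)), ip_neg_left, this]
    module
  refine ext_mat fun p q => ?_
  rw [rot_apply, rot_apply]
  unfold rotMat
  rw [h1, ← h2, star_star]
  by_cases hpj : p = j <;> by_cases hpk : p = k <;> by_cases hqj : q = j <;> by_cases hqk : q = k <;>
    first
    | exact absurd (hpj.symm.trans hpk) hjk
    | exact absurd (hqj.symm.trans hqk) hjk
    | simp only [hpj, hpk, hqj, hqk, if_true, if_false, hjk.symm, hjk]

theorem dre_rot_right : dre (rot c s a hjk X) k = rotDiag c s (-star a) k j X := by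
  rw [rot_symm, dre_rot_left]

theorem rot_row_right {q : Fin N} (hqj : q ≠ j) (hqk : q ≠ k) :
    (rot c s a hjk X).mat k q = rotRow c s (-star a) k j X q := by
  rw [rot_symm, rot_row c s _ hjk.symm X hqk hqj]

end

theorem jmul_self_apply (X : Herm K N) (p q : Fin N) :
    (jmul X X).mat p q = ∑ l, X.mat p l * X.mat l q := by
  rw [mat_jmul_self, Matrix.mul_apply]

section

variable {c s : ℝ} (hcs : c ^ 2 + s ^ 2 = 1) {a : K} (ha : ‖a‖ = 1) {j k : Fin N} (hjk : j ≠ k)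
  (X : Herm K N)
include hcs ha

theorem rot_sq_diag : dre (jmul (rot c s a hjk X) (rot c s a hjk X)) j =
    rotDiag c s a j k (jmul X X) := by
  have hm : ip a ((jmul X X).mat j k) = (dre X j + dre X k) * ip a (X.mat j k) +
      ∑ l ∈ ({j, k} : Finset (Fin N))ᶜ, ip (X.mat j l) (a * X.mat k l) := by
    rw [jmul_self_apply, sum_eq_add_add_sum hjk, ip_add_right, ip_add_right, ip_sum_right, mat_self,
      mat_self, CompAlg.smul_one_mul, CompAlg.mul_smul_one, ip_smul_right, ip_smul_right, ← add_mul]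
    congr 1
    refine Finset.sum_congr rfl fun l _ => ?_
    rw [ip_comm, ip_mul_right, star_mat]
  rw [rotDiag, hm, dre_jmul_self, dre_jmul_self, dre_jmul_self, sum_eq_add_add_sum hjk,
    sum_eq_add_add_sum hjk (fun l => ‖X.mat j l‖ ^ 2), sum_eq_add_add_sum hjk (fun l => ‖X.mat k l‖ ^ 2)]
  have h1 : ∀ l ∈ ({j, k} : Finset (Fin N))ᶜ, ‖(rot c s a hjk X).mat j l‖ ^ 2 =
      c ^ 2 * ‖X.mat j l‖ ^ 2 + s ^ 2 * ‖X.mat k l‖ ^ 2 +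
        2 * c * s * ip (X.mat j l) (a * X.mat k l) := by
    intro l hl
    obtain ⟨hlj, hlk⟩ := mem_compl_pair.mp hl
    rw [rot_row c s a hjk X hlj hlk, rotRow, norm_add_sq', ← ip_self, ip_smul_left, ip_smul_right,
      ip_smul_left, ip_smul_right, ip_self, ← ip_self (s • _), ip_smul_left, ip_smul_right, ip_self,
      norm_mul_sq, ha]
    ring
  rw [Finset.sum_congr rfl h1, Finset.sum_add_distrib, Finset.sum_add_distrib, ← Finset.mul_sum,
    ← Finset.mul_sum, ← Finset.mul_sum]
  have h2 : ∀ (Y : Herm K N) (i : Fin N), ‖Y.mat i i‖ ^ 2 = dre Y i ^ 2 := by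
    intro Y i
    rw [mat_self, ← ip_self, ip_smul_left, ip_smul_right, ip_self, norm_one_sq]
    ring
  rw [h2, h2, h2, dre_rot_left, rot_off, rotOff, norm_add_sq', ip_smul_right, ← ip_self (_ • a),
    ip_smul_left, ip_smul_right, ip_self a, ha, ip_comm _ a, ← star_mat X j k, norm_star_sq, rotDiag]
  generalize ip a (X.mat j k) = m
  generalize dre X j = p
  generalize dre X k = q
  have h3 : m + (c * s * (q - p) - 2 * s ^ 2 * m) = (c ^ 2 - s ^ 2) * m + c * s * (q - p) := by
    linear_combination (-m) * hcs
  linear_combination (m + (c * s * (q - p) - 2 * s ^ 2 * m) + (c ^ 2 - s ^ 2) * m +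
    c * s * (q - p)) * h3 + (c ^ 2 * (p ^ 2 + m ^ 2) + s ^ 2 * (q ^ 2 + m ^ 2) +
      2 * c * s * (p + q) * m + m ^ 2 - ‖X.mat j k‖ ^ 2) * hcs

/-- For each index outside the plane, the only threefold products that occur are covered by
alternativity and by the middle Moufang identity. Hence no condition on N or associativity is
needed. -/
theorem rot_sq_off : (jmul (rot c s a hjk X) (rot c s a hjk X)).mat j k =
    rotOff c s a j k (jmul X X) := by
  rw [rotOff, dre_jmul_self, dre_jmul_self, jmul_self_apply, jmul_self_apply,
    sum_eq_add_add_sum hjk, sum_eq_add_add_sum hjk (fun l => X.mat j l * X.mat l k),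
    sum_eq_add_add_sum hjk (fun l => ‖X.mat j l‖ ^ 2), sum_eq_add_add_sum hjk (fun l => ‖X.mat k l‖ ^ 2)]
  have h1 : ∀ l ∈ ({j, k} : Finset (Fin N))ᶜ,
      (rot c s a hjk X).mat j l * (rot c s a hjk X).mat l k =
      X.mat j l * X.mat l k + (c * s) • (‖X.mat k l‖ ^ 2) • a - (c * s) • (‖X.mat j l‖ ^ 2) • a -
        (2 * s ^ 2) • ip a (X.mat j l * X.mat l k) • a := by
    intro l hl
    obtain ⟨hlj, hlk⟩ := mem_compl_pair.mp hl
    rw [rot_row c s a hjk X hlj hlk, ← star_mat _ k l, rot_row_right c s a hjk X hlj hlk, rotRow,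
      rotRow, ← star_mat X k l]
    set y := X.mat j l
    set z := X.mat k l
    have e1 : y * (star y * a) = (‖y‖ ^ 2) • a := mul_star_mul y a
    have e2 : (a * z) * star z = (‖z‖ ^ 2) • a := mul_mul_star z a
    have e3 := CompAlg.mul_mul_mul a z y
    rw [ha] at e3
    simp only [star_add, star_smul, star_mul, star_neg, star_star, star_trivial c, star_trivial s,
      add_mul, mul_add, CompAlg.mul_smul, CompAlg.smul_mul, mul_neg, neg_mul, e1, e2, e3]
    match_scalars <;> first | ring1 | linear_combination hcs
  rw [Finset.sum_congr rfl h1]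
  simp only [Finset.sum_add_distrib, Finset.sum_sub_distrib, ← Finset.smul_sum, ← Finset.sum_smul,
    ip_add_right, ip_sum_right]
  have h2 : ∀ (Y : Herm K N) (i : Fin N), ‖Y.mat i i‖ ^ 2 = dre Y i ^ 2 := by
    intro Y i
    rw [mat_self, ← ip_self, ip_smul_left, ip_smul_right, ip_self, norm_one_sq]
    ring
  rw [h2, h2, ← star_mat X j k, norm_star_sq, mat_self, mat_self, mat_self, mat_self, rot_off,
    dre_rot_left, dre_rot_right, rotOff, rotDiag, rotDiag, ip_neg_left, ← star_mat X j k,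
    ip_star_star]
  simp only [CompAlg.smul_one_mul, CompAlg.mul_smul_one, ip_smul_right]
  match_scalars <;>
    first
    | ring1
    | linear_combination (dre X j + dre X k) * hcs
    | linear_combination (dre X j + dre X k) *
        (c * s * (dre X k - dre X j) - 2 * s ^ 2 * ip a (X.mat j k)) * hcs

/-- Terms with l = q involve a diagonal entry, which is real. Other terms need associativity, but
then j, k, l, q are distinct, which is impossible if N ≤ 3. -/
theorem rot_sq_row (hK : N ≤ 3 ∨ ∀ a b c : K, a * b * c = a * (b * c)) {q : Fin N} (hqj : q ≠ j)
    (hqk : q ≠ k) : (jmul (rot c s a hjk X) (rot c s a hjk X)).mat j q =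
      rotRow c s a j k (jmul X X) q := by
  rw [rotRow, jmul_self_apply, jmul_self_apply, jmul_self_apply, sum_eq_add_add_sum hjk,
    sum_eq_add_add_sum hjk (fun l => X.mat j l * X.mat l q),
    sum_eq_add_add_sum hjk (fun l => X.mat k l * X.mat l q)]
  have h1 : ∀ l ∈ ({j, k} : Finset (Fin N))ᶜ,
      (rot c s a hjk X).mat j l * (rot c s a hjk X).mat l q =
      c • (X.mat j l * X.mat l q) + s • (a * (X.mat k l * X.mat l q)) := by
    intro l hl
    obtain ⟨hlj, hlk⟩ := mem_compl_pair.mp hl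
    rw [rot_row c s a hjk X hlj hlk, rot_other c s a hjk X hlj hlk hqj hqk, rotRow, add_mul,
      CompAlg.smul_mul, CompAlg.smul_mul]
    congr 2
    by_cases hlq : l = q
    · rw [hlq, mat_self, CompAlg.mul_smul_one, CompAlg.mul_smul_one, CompAlg.mul_smul]
    · refine hK.elim (fun hN => ?_) fun h => h _ _ _
      exfalso
      simp only [ne_eq, Fin.ext_iff] at hjk hqj hqk hlj hlk hlq
      omega
  rw [Finset.sum_congr rfl h1, mat_self _ j, rot_off, dre_rot_left, rot_row c s a hjk X hqj hqk,
    rot_row_right c s a hjk X hqj hqk, Finset.sum_add_distrib, ← Finset.smul_sum, ← Finset.smul_sum,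
    ← Finset.mul_sum, rotDiag, rotOff, rotRow, rotRow, mat_self X j, mat_self X k,
    ← star_mat X j k]
  set x := X.mat j k
  set y := X.mat j q
  set z := X.mat k q
  have e1 : x * (star a * y) + a * (star x * y) = (2 * ip a x) • y := by
    rw [mul_star_mul_add, ip_comm]
  have e2 : a * (star a * y) = y := by rw [mul_star_mul, ha, one_pow, one_smul]
  have e3 : a * (star x * y) = (2 * ip a x) • y - x * (star a * y) := by
    rw [← e1, add_sub_cancel_left]
  simp only [add_mul, mul_add, CompAlg.smul_mul, CompAlg.mul_smul, neg_mul, mul_neg, one_mul, e2, e3]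
  match_scalars <;>
    first
    | ring1
    | linear_combination (c * dre X j + 2 * s * ip a x) * hcs
    | linear_combination (s * dre X k) * hcs

omit hcs in
-- On the diagonal, only norms matter. Off the diagonal, j, k, p, q are distinct, so N ≥ 4 and the
-- algebra is associative.
theorem rot_sq_other (hcs : c ^ 2 + s ^ 2 = 1)
    (hK : N ≤ 3 ∨ ∀ a b c : K, a * b * c = a * (b * c)) {p q : Fin N} (hpj : p ≠ j)
    (hpk : p ≠ k) (hqj : q ≠ j) (hqk : q ≠ k) :
    (jmul (rot c s a hjk X) (rot c s a hjk X)).mat p q = (jmul X X).mat p q := by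
  have h1 : ∀ l ∈ ({j, k} : Finset (Fin N))ᶜ,
      (rot c s a hjk X).mat p l * (rot c s a hjk X).mat l q = X.mat p l * X.mat l q := by
    intro l hl
    obtain ⟨hlj, hlk⟩ := mem_compl_pair.mp hl
    rw [rot_other c s a hjk X hlj hlk hqj hqk, rot_other c s a hjk X hpj hpk hlj hlk]
  rw [jmul_self_apply, jmul_self_apply, sum_eq_add_add_sum hjk,
    sum_eq_add_add_sum hjk (fun l => X.mat p l * X.mat l q), Finset.sum_congr rfl h1]
  congr 1
  rw [← star_mat _ j p, ← star_mat _ k p, rot_row c s a hjk X hpj hpk,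
    rot_row_right c s a hjk X hpj hpk, rot_row c s a hjk X hqj hqk,
    rot_row_right c s a hjk X hqj hqk, ← star_mat X j p, ← star_mat X k p]
  by_cases hpq : p = q
  · rw [hpq, star_mul_self, star_mul_self, star_mul_self, star_mul_self, ← add_smul, ← add_smul]
    congr 1
    have e1 : ip (X.mat k q) (star a * X.mat j q) = ip (X.mat j q) (a * X.mat k q) := by
      rw [← ip_mul_left, ip_comm]
    have e2 : ∀ (r : ℝ) (b : K), ‖r • b‖ ^ 2 = r ^ 2 * ‖b‖ ^ 2 := fun r b => by
      rw [norm_smul, mul_pow, Real.norm_eq_abs, sq_abs]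
    rw [rotRow, rotRow, norm_add_sq', norm_add_sq', e2, e2, e2, e2, norm_mul_sq, norm_mul_sq,
      norm_neg, norm_star_sq, neg_mul, ip_smul_left, ip_smul_left, ip_smul_right, ip_smul_right,
      ip_neg_right, e1, ha]
    linear_combination (‖X.mat j q‖ ^ 2 + ‖X.mat k q‖ ^ 2) * hcs
  · have hA : ∀ a b c : K, a * b * c = a * (b * c) := by
      refine hK.elim (fun hN => ?_) fun h => h
      exfalso
      simp only [ne_eq, Fin.ext_iff] at hjk hqj hqk hpj hpk hpq
      omega
    have e1 : ∀ b, a * (star a * b) = b := fun b => by rw [mul_star_mul, ha, one_pow, one_smul]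
    have e2 : ∀ b, star a * (a * b) = b := fun b => by rw [star_mul_mul, ha, one_pow, one_smul]
    simp only [rotRow, star_add, star_smul, star_mul, star_neg, star_star, star_trivial c,
      star_trivial s, add_mul, mul_add, CompAlg.smul_mul, CompAlg.mul_smul, neg_mul, mul_neg, hA, e1,
      e2]
    match_scalars <;> first | ring1 | linear_combination hcs

/-- Row k follows from row j by `rot_symm`, and the columns by Hermitian symmetry. -/
theorem rot_sq (hK : N ≤ 3 ∨ ∀ a b c : K, a * b * c = a * (b * c)) :
    jmul (rot c s a hjk X) (rot c s a hjk X) = rot c s a hjk (jmul X X) := by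
  have hstar : ∀ {Y Z : Herm K N} {p q : Fin N}, Y.mat p q = Z.mat p q → Y.mat q p = Z.mat q p := by
    intro Y Z p q h
    rw [← star_mat Y p q, h, star_mat]
  have key : ∀ {j k : Fin N} (hjk : j ≠ k) {a : K}, ‖a‖ = 1 →
      (∀ q, (jmul (rot c s a hjk X) (rot c s a hjk X)).mat j q =
        (rot c s a hjk (jmul X X)).mat j q) := by
    intro j k hjk a ha q
    by_cases hqj : q = j
    · rw [hqj, mat_self, mat_self, rot_sq_diag hcs ha, dre_rot_left]
    by_cases hqk : q = k
    · rw [hqk, rot_sq_off hcs ha, rot_off]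
    rw [rot_sq_row hcs ha hjk X hK hqj hqk, rot_row c s a hjk _ hqj hqk]
  have ha' : ‖-star a‖ = 1 := by
    rw [norm_neg, ← pow_eq_one_iff_of_nonneg (norm_nonneg _) two_ne_zero, norm_star_sq, ha, one_pow]
  have keyk : ∀ q, (jmul (rot c s a hjk X) (rot c s a hjk X)).mat k q =
        (rot c s a hjk (jmul X X)).mat k q := by
    rw [rot_symm c s a hjk X, rot_symm c s a hjk (jmul X X)]
    exact key hjk.symm ha'
  refine ext_mat fun p q => ?_
  by_cases hpj : p = j
  · rw [hpj, key hjk ha]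
  by_cases hpk : p = k
  · rw [hpk, keyk]
  by_cases hqj : q = j
  · rw [hqj]
    exact hstar (key hjk ha p)
  by_cases hqk : q = k
  · rw [hqk]
    exact hstar (keyk p)
  rw [rot_sq_other ha hjk X hcs hK hpj hpk hqj hqk, rot_other c s a hjk _ hpj hpk hqj hqk]

end

theorem rot_one_zero (a : K) {j k : Fin N} (hjk : j ≠ k) (X : Herm K N) : rot 1 0 a hjk X = X := by
  refine ext_mat fun p q => ?_
  rw [rot_apply]
  unfold rotMat
  split_ifs with h1 h2 h3 h4 h5 h6 h7 h8
  all_goals simp [*, rotDiag, rotOff, rotRow, mat_self, star_mat]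

theorem continuous_rot {a : K} {j k : Fin N} (hjk : j ≠ k) (X : Herm K N) :
    Continuous fun θ => rot (Real.cos θ) (Real.sin θ) a hjk X := by
  refine continuous_of_entries fun p q => ?_
  simp only [rot_apply, rotMat, rotDiag, rotOff, rotRow]
  split_ifs
  all_goals first
    | fun_prop
    | exact continuous_star'.comp (by fun_prop)

theorem hasRot (hK : N ≤ 3 ∨ ∀ a b c : K, a * b * c = a * (b * c)) : HasRot K N := by
  intro j k hjk a ha
  refine ⟨fun θ => rot (Real.cos θ) (Real.sin θ) a hjk, continuous_rot hjk, fun X => ?_,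
    fun θ X => rot_sq (Real.cos_sq_add_sin_sq θ) ha hjk X hK, fun θ X => dre_rot_left _ _ _ _ _,
    fun θ X => ?_, fun θ X l hlj hlk => ?_⟩
  · simp only [Real.cos_zero, Real.sin_zero, rot_one_zero]
  · rw [dre_rot_right, rotDiag, ip_neg_left, ← star_mat X j k, ip_star_star]
    ring
  · rw [dre, rot_other _ _ _ _ _ hlj hlk hlj hlk, dre]

end Herm

end

/-! ### Positive elements of rank one and their stability under X ↦ DXD. -/

noncomputable section

set_option linter.unusedSectionVars false

namespace Herm

open CompAlg hiding mul_smul smul_mul smul_one_mul mul_smul_one mul_mul_mul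

variable {K : Type} [NormedStarAlg K] [CompAlg K] {N : ℕ}

variable (K N) in
/-- The positive Hermitian matrices of rank one. -/
def rankOne : Set (Herm K N) := {Y | jmul Y Y = tr Y • Y ∧ 0 < tr Y}

variable (K N) in
/-- The dual cone of the set of positive Hermitian matrices of rank one. -/
def dualCone : Set (Herm K N) := {X | ∀ Y ∈ rankOne K N, 0 < hip X Y}

theorem smul_mem_rankOne (g : jGroup K N) {Y : Herm K N} (hY : Y ∈ rankOne K N) :
    g • Y ∈ rankOne K N := by
  refine ⟨?_, by rw [tr_smul_jGroup]; exact hY.2⟩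
  rw [jmul_smul, hY.1, tr_smul_jGroup, smul_comm]

theorem smul_mem_rankOne_of_pos {r : ℝ} (hr : 0 < r) {Y : Herm K N} (hY : Y ∈ rankOne K N) :
    r • Y ∈ rankOne K N := by
  refine ⟨?_, by rw [tr_smul]; exact mul_pos hr hY.2⟩
  rw [jmul_smul_left, jmul_smul_right, hY.1, tr_smul, smul_smul, smul_smul, smul_smul]
  congr 1
  ring

theorem diag_single_mem_rankOne (i : Fin N) : diag (Pi.single i 1) ∈ rankOne K N := by
  have h : tr (diag (Pi.single i 1) : Herm K N) = 1 := by
    rw [tr_diag, Finset.sum_pi_single']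
    simp
  refine ⟨?_, by rw [h]; exact one_pos⟩
  rw [h, one_smul, jmul_diag]
  congr 1
  ext j
  by_cases hj : j = i <;> simp [hj]

theorem dre_nonneg_of_mem_rankOne {Y : Herm K N} (hY : Y ∈ rankOne K N) (i : Fin N) :
    0 ≤ dre Y i := by
  have h := dre_jmul_self Y i
  rw [hY.1, dre_smul] at h
  refine nonneg_of_mul_nonneg_right (a := tr Y) ?_ hY.2
  rw [h]
  positivity

/-- Each eigenvalue is 0 or the trace, and they add up to the trace, which is positive; so exactly
one is nonzero. -/
theorem HasRot.exists_smul_single (hrot : HasRot K N) {Y : Herm K N} (hY : Y ∈ rankOne K N) :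
    ∃ (g : jGroup K N) (i : Fin N), Y = g • (tr Y • diag (Pi.single i 1) : Herm K N) := by
  obtain ⟨g, -, l, hl⟩ := hrot.exists_smul_diag Y
  have htr : tr Y = ∑ i, l i := by rw [← hl, tr_smul_jGroup, tr_diag]
  have h1 : ∀ i, l i * l i = tr Y * l i := by
    intro i
    have h2 := hY.1
    rw [← hl, jmul_smul, tr_smul_jGroup, smul_comm, smul_left_cancel_iff, jmul_diag] at h2
    have h3 := congrArg (fun Z => dre Z i) h2
    simp only [dre_smul, dre_diag, Pi.mul_apply, tr_diag] at h3
    rw [h3, htr]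
  have h2 : ∀ i, l i = 0 ∨ l i = tr Y := by
    intro i
    rcases eq_or_ne (l i) 0 with h | h
    · exact Or.inl h
    · exact Or.inr (mul_right_cancel₀ h (h1 i))
  have h3 : ∀ i, 0 ≤ l i := fun i => (h2 i).elim (fun h => h.ge) fun h => h ▸ hY.2.le
  obtain ⟨i, -, hi⟩ : ∃ i ∈ Finset.univ, 0 < l i := by
    rw [← Finset.sum_pos_iff_of_nonneg fun i _ => h3 i, ← htr]
    exact hY.2
  refine ⟨g, i, ?_⟩
  have h4 : l = tr Y • Pi.single i 1 := by
    have h5 : l i = tr Y := (h2 i).resolve_left hi.ne'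
    ext j
    by_cases hj : j = i
    · rw [hj, h5]
      simp
    · have h6 : l i + l j ≤ ∑ k, l k := by
        rw [← Finset.sum_pair (Ne.symm hj)]
        exact Finset.sum_le_univ_sum_of_nonneg h3
      have h7 := h3 j
      rw [← htr, h5] at h6
      simp [hj]
      linarith
  conv_lhs => rw [← hl, h4, ← diagₗ_apply, map_smul, diagₗ_apply]

/-- The quadratic map of the Jordan algebra. -/
def quad (Y Z : Herm K N) : Herm K N := (2 : ℝ) • jmul Y (jmul Y Z) - jmul (jmul Y Y) Z

theorem diag_single_mul_apply (i : Fin N) (M : Matrix (Fin N) (Fin N) K) (p q : Fin N) :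
    ((diag (Pi.single i 1) : Herm K N).mat * M) p q = if p = i then M i q else 0 := by
  change ((Matrix.diagonal fun k => (Pi.single i 1 : Fin N → ℝ) k • (1 : K)) * M) p q = _
  rw [Matrix.diagonal_mul]
  by_cases h : p = i <;> simp [h]

theorem mul_diag_single_apply (i : Fin N) (M : Matrix (Fin N) (Fin N) K) (p q : Fin N) :
    (M * (diag (Pi.single i 1) : Herm K N).mat) p q = if q = i then M p i else 0 := by
  change (M * (Matrix.diagonal fun k => (Pi.single i 1 : Fin N → ℝ) k • (1 : K))) p q = _
  rw [Matrix.mul_diagonal]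
  by_cases h : q = i <;> simp [h]

/-- The products of entries in a minor of order two are thus expressed by the Jordan product alone,
so that they can be transported by Jordan automorphisms. -/
theorem quad_single_apply (Y : Herm K N) (i p q : Fin N) :
    (quad Y (diag (Pi.single i 1))).mat p q = Y.mat p i * Y.mat i q := by
  set E : Herm K N := diag (Pi.single i 1) with hE
  have h1 : ∀ p q, (jmul Y E).mat p q =
      (1 / 2 : ℝ) • ((if q = i then Y.mat p i else 0) + if p = i then Y.mat i q else 0) := by
    intro p q
    rw [mat_jmul, Matrix.smul_apply, Matrix.add_apply, diag_single_mul_apply, mul_diag_single_apply]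
  have h2 : ∀ p q, (Y.mat * (jmul Y E).mat) p q =
      (1 / 2 : ℝ) • ((if q = i then (Y.mat * Y.mat) p i else 0) + Y.mat p i * Y.mat i q) := by
    intro p q
    simp only [Matrix.mul_apply, h1, CompAlg.mul_smul, mul_add, ← Finset.smul_sum,
      Finset.sum_add_distrib, mul_ite, mul_zero, Finset.sum_ite_eq', Finset.mem_univ, if_true]
    split_ifs <;> simp
  have h3 : ∀ p q, ((jmul Y E).mat * Y.mat) p q =
      (1 / 2 : ℝ) • (Y.mat p i * Y.mat i q + if p = i then (Y.mat * Y.mat) i q else 0) := by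
    intro p q
    simp only [Matrix.mul_apply, h1, CompAlg.smul_mul, add_mul, ← Finset.smul_sum,
      Finset.sum_add_distrib, ite_mul, zero_mul, Finset.sum_ite_eq', Finset.mem_univ, if_true]
    split_ifs <;> simp
  rw [quad, mat_sub, mat_smul, mat_jmul Y (jmul Y E), mat_jmul (jmul Y Y) E, mat_jmul_self]
  simp only [Matrix.sub_apply, Matrix.smul_apply, Matrix.add_apply, h2, h3]
  rw [hE, diag_single_mul_apply, mul_diag_single_apply]
  split_ifs <;> module

theorem quad_smul_smul (g : jGroup K N) (Y Z : Herm K N) : quad (g • Y) (g • Z) = g • quad Y Z := by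
  rw [quad, quad, jmul_smul, jmul_smul, jmul_smul, jmul_smul, smul_sub, smul_comm g (2 : ℝ)]

theorem quad_smul_left (r : ℝ) (Y Z : Herm K N) : quad (r • Y) Z = (r ^ 2) • quad Y Z := by
  rw [quad, quad]
  simp only [jmul_smul_left, jmul_smul_right]
  module

theorem quad_single_left (i : Fin N) (Z : Herm K N) :
    quad (diag (Pi.single i 1)) Z = dre Z i • diag (Pi.single i 1) := by
  set E : Herm K N := diag (Pi.single i 1) with hE
  have hEE : jmul E E = E := by
    have := (diag_single_mem_rankOne (K := K) i).1
    rwa [tr_diag, Finset.sum_pi_single', if_pos (Finset.mem_univ i), one_smul] at this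
  refine ext_mat fun p q => ?_
  rw [quad, hEE, mat_sub, mat_smul, mat_jmul E (jmul E Z), mat_jmul E Z, smul_apply, hE, diag_apply]
  simp only [Matrix.sub_apply, Matrix.smul_apply, Matrix.add_apply, diag_single_mul_apply,
    mul_diag_single_apply]
  by_cases hp : p = i <;> by_cases hq : q = i
  · simp [hp, hq, mat_self]
    module
  · simp [hp, hq, Ne.symm hq]
  · simp [hp, hq]
  · simp [hp, hq]

/-- The minors of order two of a Hermitian matrix of rank one vanish. -/
theorem HasRot.mul_eq_of_mem_rankOne (hrot : HasRot K N) {Y : Herm K N} (hY : Y ∈ rankOne K N)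
    (p i q : Fin N) : Y.mat p i * Y.mat i q = dre Y i • Y.mat p q := by
  rw [← quad_single_apply, ← smul_apply]
  congr 2
  -- The identity to prove is now invariant under Jordan automorphisms, which reduces it to a
  -- diagonal idempotent, where `quad_single_left` gives it.
  obtain ⟨g, k, hg⟩ := hrot.exists_smul_single hY
  set t := tr Y
  set E : Herm K N := diag (Pi.single k 1) with hE
  have h1 : dre Y i = t * dre (g⁻¹ • (diag (Pi.single i 1) : Herm K N)) k := by
    have h2 : dre Y i = hip Y (diag (Pi.single i 1)) := by
      rw [hip_diag, Finset.sum_eq_single i] <;> simp +contextual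
    rw [h2, hg, hip_smul, hip_smul_left, hip_comm, hE, hip_diag, Finset.sum_eq_single k] <;>
      simp +contextual
  rw [h1, hg, ← smul_inv_smul g (diag (Pi.single i 1) : Herm K N), quad_smul_smul, quad_smul_left,
    hE, quad_single_left, inv_smul_smul]
  simp only [smul_comm g]
  rw [smul_smul, smul_smul]
  congr 1
  ring

/-- The map X ↦ DXD is not a Jordan automorphism. But it multiplies both sides of the relation Y_pi
Y_iq = Y_ii Y_pq by the same factor, and summing this relation over i says that the square of DYD is
its trace times itself. -/
theorem HasRot.scale_mem_rankOne (hrot : HasRot K N) {d : Fin N → ℝ} (hd : ∀ i, 0 < d i)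
    {Y : Herm K N} (hY : Y ∈ rankOne K N) : scale d Y ∈ rankOne K N := by
  have htr : tr (scale d Y) = ∑ i, d i ^ 2 * dre Y i := by
    refine Finset.sum_congr rfl fun i _ => ?_
    rw [dre, scale_apply, re_smul, dre, sq]
  constructor
  · refine ext_mat fun p q => ?_
    rw [mat_jmul_self, Matrix.mul_apply, smul_apply, htr, Finset.sum_smul]
    refine Finset.sum_congr rfl fun i _ => ?_
    rw [scale_apply, scale_apply, scale_apply, CompAlg.smul_mul, CompAlg.mul_smul,
      hrot.mul_eq_of_mem_rankOne hY, smul_smul, smul_smul, smul_smul]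
    congr 1
    ring
  · rw [htr]
    have h1 : ∀ i ∈ Finset.univ, 0 ≤ dre Y i := fun i _ => dre_nonneg_of_mem_rankOne hY i
    obtain ⟨i, hi, hi'⟩ := (Finset.sum_pos_iff_of_nonneg h1).mp hY.2
    exact (Finset.sum_pos_iff_of_nonneg fun i hi => mul_nonneg (sq_nonneg _) (h1 i hi)).mpr
      ⟨i, hi, mul_pos (pow_pos (hd i) 2) hi'⟩

end Herm

end

/-! ### The dual cone is a symmetric cone. -/

noncomputable section

set_option linter.unusedSectionVars false

namespace Herm

open CompAlg hiding mul_smul smul_mul smul_one_mul mul_smul_one mul_mul_mul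

variable {K : Type} [NormedStarAlg K] [CompAlg K] {N : ℕ}

theorem smul_mem_dualCone (g : jGroup K N) {X : Herm K N} :
    g • X ∈ dualCone K N ↔ X ∈ dualCone K N := by
  have key : ∀ (g : jGroup K N) {X : Herm K N}, X ∈ dualCone K N → g • X ∈ dualCone K N := by
    intro g X hX Y hY
    rw [hip_smul]
    exact hX _ (smul_mem_rankOne _ hY)
  refine ⟨fun h => ?_, key g⟩
  have := key g⁻¹ h
  rwa [inv_smul_smul] at this

theorem diag_mem_dualCone {l : Fin N → ℝ} : diag l ∈ dualCone K N ↔ ∀ i, 0 < l i := by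
  constructor
  · intro h i
    have := h _ (diag_single_mem_rankOne i)
    simpa [hip_diag, dre_diag, Pi.single_apply] using this
  · intro h Y hY
    rw [hip_comm, hip_diag]
    have h1 : ∀ i ∈ Finset.univ, 0 ≤ dre Y i := fun i _ => dre_nonneg_of_mem_rankOne hY i
    obtain ⟨i, hi, hi'⟩ := (Finset.sum_pos_iff_of_nonneg h1).mp hY.2
    exact (Finset.sum_pos_iff_of_nonneg fun i hi => mul_nonneg (h i).le (h1 i hi)).mpr
      ⟨i, hi, mul_pos (h i) hi'⟩

theorem hip_nonneg_of_mem_closure {X Y : Herm K N} (hX : X ∈ closure (dualCone K N))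
    (hY : Y ∈ rankOne K N) : 0 ≤ hip X Y := by
  have hc : IsClosed {X : Herm K N | 0 ≤ hip X Y} :=
    isClosed_le continuous_const (continuous_hip continuous_id continuous_const)
  exact closure_minimal (fun X hX => (hX Y hY).le) hc hX

theorem nonneg_of_smul_diag_mem_closure {g : jGroup K N} {l : Fin N → ℝ}
    (h : g • (diag l : Herm K N) ∈ closure (dualCone K N)) (i : Fin N) : 0 ≤ l i := by
  have := hip_nonneg_of_mem_closure h (smul_mem_rankOne g (diag_single_mem_rankOne i))
  rw [hip_smul_smul] at this
  simpa [hip_diag, dre_diag, Pi.single_apply] using this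

theorem continuous_diag : Continuous (diag : (Fin N → ℝ) → Herm K N) :=
  LinearMap.continuous_of_finiteDimensional (diagₗ K N)

theorem diag_mem_closure_dualCone {l : Fin N → ℝ} :
    diag l ∈ closure (dualCone K N) ↔ ∀ i, 0 ≤ l i := by
  constructor
  · intro h i
    rw [← one_smul (jGroup K N) (diag l)] at h
    exact nonneg_of_smul_diag_mem_closure h i
  · intro h
    have h1 : Tendsto (fun ε : ℝ => (diag (fun i => l i + ε) : Herm K N)) (𝓝[>] 0) (𝓝 (diag l)) := by
      have : Continuous fun ε : ℝ => (diag (fun i => l i + ε) : Herm K N) :=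
        continuous_diag.comp (by fun_prop)
      have h2 := (this.tendsto 0).mono_left (nhdsWithin_le_nhds (s := Set.Ioi 0))
      simpa using h2
    refine mem_closure_of_tendsto h1 ?_
    filter_upwards [self_mem_nhdsWithin] with ε hε
    exact diag_mem_dualCone.mpr fun i => add_pos_of_nonneg_of_pos (h i) hε

/-- These are the idempotents of trace one: a closed set, bounded because the trace form of an
idempotent is its trace. -/
theorem isCompact_rankOne_tr_one : IsCompact {Y : Herm K N | Y ∈ rankOne K N ∧ tr Y = 1} := by
  have : {Y : Herm K N | Y ∈ rankOne K N ∧ tr Y = 1} = {Y | jmul Y Y = Y} ∩ {Y | tr Y = 1} := by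
    ext Y
    constructor
    · rintro ⟨⟨h1, -⟩, h2⟩
      rw [h2, one_smul] at h1
      exact ⟨h1, h2⟩
    · rintro ⟨h1, h2⟩
      have h2' : tr Y = 1 := h2
      exact ⟨⟨by rw [h2', one_smul]; exact h1, by rw [h2']; exact one_pos⟩, h2⟩
  rw [this]
  have hb : {Y : Herm K N | jmul Y Y = Y} ∩ {Y | tr Y = 1} ⊆ Metric.closedBall 0 1 := by
    rintro Y ⟨h1, h2⟩
    have h1' : jmul Y Y = Y := h1
    have h2' : tr Y = 1 := h2
    rw [mem_closedBall_zero_iff]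
    have := norm_sq_le_hip_self Y
    rw [hip_eq_tr, h1', h2'] at this
    exact (sq_le_one_iff₀ (norm_nonneg _)).mp this
  refine ((isCompact_closedBall (0 : Herm K N) 1).of_isClosed_subset (IsClosed.inter ?_ ?_) hb)
  · exact isClosed_eq (continuous_jmul continuous_id continuous_id) continuous_id
  · exact isClosed_eq (trL K N).continuous continuous_const

/-- By homogeneity it suffices to test against elements of trace one, which form a compact set. -/
theorem isOpen_dualCone : IsOpen (dualCone K N) := by
  have : dualCone K N = {X | ∀ Y ∈ {Y : Herm K N | Y ∈ rankOne K N ∧ tr Y = 1}, 0 < hip X Y} := by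
    ext X
    refine ⟨fun h Y hY => h Y hY.1, fun h Y hY => ?_⟩
    have h1 := h ((tr Y)⁻¹ • Y) ⟨smul_mem_rankOne_of_pos (inv_pos.mpr hY.2) hY, by
      rw [tr_smul, inv_mul_cancel₀ hY.2.ne']⟩
    rw [hip_smul_right] at h1
    exact pos_of_mul_pos_right h1 (inv_pos.mpr hY.2).le
  rw [this, isOpen_iff_eventually]
  intro X hX
  refine isCompact_rankOne_tr_one.eventually_forall_of_forall_eventually fun Y hY => ?_
  have hc : Continuous fun z : Herm K N × Herm K N => hip z.1 z.2 :=
    continuous_hip continuous_fst continuous_snd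
  exact (isOpen_lt continuous_const hc).mem_nhds (hX Y hY)

theorem HasRot.isSharpCone (hrot : HasRot K N) (hN : N ≠ 0) :
    ConvProj.IsSharpCone (dualCone K N) (trL K N) where
  isOpen := isOpen_dualCone
  nonempty := ⟨diag 1, diag_mem_dualCone.mpr fun _ => one_pos⟩
  add_mem := fun hX hY Z hZ => by
    rw [hip_add_left]
    exact add_pos_of_pos_of_nonneg (hX Z hZ) (hip_nonneg_of_mem_closure hY hZ)
  smul_mem := fun hr hX Z hZ => by
    rw [hip_smul_left]
    exact mul_pos hr (hX Z hZ)
  trace_pos := by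
    intro X hX hX0
    obtain ⟨g, -, l, rfl⟩ := hrot.exists_smul_diag X
    have h1 := nonneg_of_smul_diag_mem_closure hX
    rw [trL_apply, tr_smul_jGroup, tr_diag]
    refine lt_of_le_of_ne (Finset.sum_nonneg fun i _ => h1 i) fun h0 => hX0 ?_
    have h2 := (Finset.sum_eq_zero_iff_of_nonneg fun i _ => h1 i).mp h0.symm
    have h3 : l = 0 := funext fun i => h2 i (Finset.mem_univ i)
    rw [h3, ← diagₗ_apply, map_zero, smul_zero]
  zero_notMem := fun h => by
    have h1 := h _ (diag_single_mem_rankOne ⟨0, Nat.pos_of_ne_zero hN⟩)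
    rw [← zero_smul ℝ (0 : Herm K N), hip_smul_left, zero_mul] at h1
    exact lt_irrefl _ h1

theorem mem_stabilizer_dualCone {u : (Herm K N →L[ℝ] Herm K N)ˣ}
    (h : ∀ X : Herm K N, u • X ∈ dualCone K N ↔ X ∈ dualCone K N) :
    u ∈ MulAction.stabilizer (Herm K N →L[ℝ] Herm K N)ˣ (dualCone K N) := by
  rw [MulAction.mem_stabilizer_iff]
  ext X
  rw [Set.mem_smul_set_iff_inv_smul_mem, ← h, smul_inv_smul]

/-- The automorphisms of the Jordan algebra, as automorphisms of the cone. -/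
def jGroupToAut (g : jGroup K N) : ConvProj.AutCone (dualCone K N) :=
  ⟨g, mem_stabilizer_dualCone fun _ => smul_mem_dualCone g⟩

theorem jGroupToAut_mem {g : jGroup K N} (hg : g ∈ jGroupId K N) :
    jGroupToAut g ∈ ConvProj.autConeId (dualCone K N) := by
  have hc : Continuous (jGroupToAut : jGroup K N → ConvProj.AutCone (dualCone K N)) :=
    continuous_subtype_val.subtype_mk _
  exact hc.image_connectedComponent_subset 1 ⟨g, hg, rfl⟩

theorem HasRot.scale_mem_dualCone (hrot : HasRot K N) {d : Fin N → ℝ} (hd : ∀ i, 0 < d i)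
    {X : Herm K N} : scale d X ∈ dualCone K N ↔ X ∈ dualCone K N := by
  have key : ∀ {d : Fin N → ℝ}, (∀ i, 0 < d i) → ∀ {X : Herm K N}, X ∈ dualCone K N →
      scale d X ∈ dualCone K N := by
    intro d hd X hX Y hY
    rw [hip_scale]
    exact hX _ (hrot.scale_mem_rankOne hd hY)
  refine ⟨fun h => ?_, key hd⟩
  have h1 := key (d := d⁻¹) (fun i => inv_pos.mpr (hd i)) h
  rwa [scale_scale, show d⁻¹ * d = 1 from funext fun i => inv_mul_cancel₀ (hd i).ne', scale_one]
    at h1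

/-- The powers d^θ, for θ from 0 to 1, join the identity to the given scaling. -/
theorem HasRot.exists_scale (hrot : HasRot K N) {d : Fin N → ℝ} (hd : ∀ i, 0 < d i) :
    ∃ g ∈ ConvProj.autConeId (dualCone K N), ∀ X : Herm K N, g • X = scale d X := by
  have hpos : ∀ (θ : ℝ) (i : Fin N), 0 < Real.exp (θ * Real.log (d i)) := fun _ _ => Real.exp_pos _
  obtain ⟨g, hg, hgX⟩ := exists_mem_connectedComponent_of_path (ConvProj.AutCone (dualCone K N))
    (fun θ => scale fun i => Real.exp (θ * Real.log (d i)))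
    (fun X => continuous_of_entries fun i j => by
      simp only [scale_apply]
      fun_prop)
    (fun θ => by
      refine Function.LeftInverse.injective
        (g := scale fun i => (Real.exp (θ * Real.log (d i)))⁻¹) fun X => ?_
      rw [scale_scale]
      refine Eq.trans ?_ (scale_one X)
      congr 2
      exact funext fun i => inv_mul_cancel₀ (hpos θ i).ne')
    (fun X => by
      refine Eq.trans ?_ (scale_one X)
      congr 2
      exact funext fun i => by simp)
    (fun θ u hu => mem_stabilizer_dualCone fun X => by
      rw [hu]
      exact hrot.scale_mem_dualCone (hpos θ)) 1
  refine ⟨g, hg, fun X => ?_⟩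
  rw [hgX]
  congr 2
  exact funext fun i => by rw [one_mul, Real.exp_log (hd i)]

/-- The cone of positive Hermitian matrices is a symmetric cone. -/
theorem HasRot.symCone (hrot : HasRot K N) (hN : N ≠ 0) {rk : Herm K N → ℕ → Prop}
    (hrk : ∀ (g : jGroup K N) (l : Fin N → ℝ), (∀ i, 0 ≤ l i) → ∀ r,
      (rk (g • diag l) r ↔ (Finset.univ.filter fun i => l i ≠ 0).card = r))
    (hsmul : ∀ (X : Herm K N) (r : ℕ) (c : ℝ), c ≠ 0 → (rk (c • X) r ↔ rk X r)) :
    ConvProj.SymCone (dualCone K N) N (diagₗ K N) (trL K N) rk where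
  __ := hrot.isSharpCone hN
  dg_mem := fun _ => diag_mem_dualCone
  dg_mem_closure := fun _ => diag_mem_closure_dualCone
  spectral := fun X => by
    obtain ⟨g, hg, l, hl⟩ := hrot.exists_smul_diag X
    refine ⟨jGroupToAut g, jGroupToAut_mem hg, smul_diag_one g, l, hl, fun h r => ?_⟩
    rw [← hl]
    exact hrk g l h r
  scale := fun d hd => by
    -- Square roots, because X ↦ DXD multiplies the diagonal entries by the squares of those of D.
    obtain ⟨g, hg, hgX⟩ := hrot.exists_scale (d := fun i => √(d i)) fun i => Real.sqrt_pos.mpr (hd i)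
    refine ⟨g, hg, fun l => ?_⟩
    rw [hgX, diagₗ_apply, diagₗ_apply, scale_diag]
    congr 1
    ext i
    simp [Real.mul_self_sqrt (hd i).le]
  perm := fun σ => by
    obtain ⟨g, hg, hgl⟩ := hrot.exists_perm σ
    exact ⟨jGroupToAut g, jGroupToAut_mem hg, hgl⟩
  rk_smul := hsmul

end Herm

end

/-! ### Associative case: positivity by the Hermitian form, rank by the image. -/

noncomputable section

set_option linter.unusedSectionVars false

namespace Herm

open CompAlg hiding mul_smul smul_mul smul_one_mul mul_smul_one mul_mul_mul

variable {K : Type} [NormedStarAlg K] [CompAlg K] {N : ℕ}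

/-- The Hermitian matrix `x x^*`. -/
def outer (x : Fin N → K) : Herm K N :=
  ofMat (Matrix.of fun i j => x i * star (x j)) (fun i j => by simp)

theorem outer_apply (x : Fin N → K) (i j : Fin N) : (outer x).mat i j = x i * star (x j) := rfl

theorem dre_outer (x : Fin N → K) (i : Fin N) : dre (outer x) i = ‖x i‖ ^ 2 := by
  rw [dre, outer_apply, mul_star_self, re_smul_one]

theorem outer_mem_rankOne (hA : ∀ a b c : K, a * b * c = a * (b * c)) {x : Fin N → K}
    (hx : x ≠ 0) : outer x ∈ rankOne K N := by
  have htr : tr (outer x) = ∑ i, ‖x i‖ ^ 2 := Finset.sum_congr rfl fun i _ => dre_outer x i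
  constructor
  · refine ext_mat fun p q => ?_
    rw [mat_jmul_self, Matrix.mul_apply, smul_apply, htr, Finset.sum_smul]
    refine Finset.sum_congr rfl fun i _ => ?_
    rw [outer_apply, outer_apply, outer_apply, hA, star_mul_mul, CompAlg.mul_smul]
  · rw [htr]
    obtain ⟨i, hi⟩ := Function.ne_iff.mp hx
    exact (Finset.sum_pos_iff_of_nonneg fun i _ => sq_nonneg _).mpr
      ⟨i, Finset.mem_univ i, pow_pos (norm_pos_iff.mpr hi) 2⟩

theorem dotProduct_mulVec_eq (hA : ∀ a b c : K, a * b * c = a * (b * c)) (X : Herm K N)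
    (x : Fin N → K) : star x ⬝ᵥ (X.mat *ᵥ x) = hip X (outer x) • (1 : K) := by
  have h1 : star (star x ⬝ᵥ (X.mat *ᵥ x)) = star x ⬝ᵥ (X.mat *ᵥ x) := by
    simp only [dotProduct, mulVec, Pi.star_apply, star_sum, star_mul, star_star, star_mat,
      Finset.mul_sum, hA]
    exact Finset.sum_comm
  rw [eq_re_smul_one h1]
  congr 1
  simp only [dotProduct, mulVec, Pi.star_apply, hip, mip, map_sum, Finset.mul_sum]
  refine Finset.sum_congr rfl fun i _ => Finset.sum_congr rfl fun j _ => ?_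
  rw [outer_apply, ← ip_mul_right, ip_comm, ip]

/-- Take for x a column through a nonzero diagonal entry; the vanishing of the minors of order two
recovers the other entries. -/
theorem HasRot.exists_smul_outer (hrot : HasRot K N) {Y : Herm K N} (hY : Y ∈ rankOne K N) :
    ∃ (r : ℝ) (x : Fin N → K), 0 < r ∧ x ≠ 0 ∧ Y = r • outer x := by
  have h1 : ∀ i ∈ Finset.univ, 0 ≤ dre Y i := fun i _ => dre_nonneg_of_mem_rankOne hY i
  obtain ⟨i, -, hi⟩ := (Finset.sum_pos_iff_of_nonneg h1).mp hY.2
  refine ⟨(dre Y i)⁻¹, fun p => Y.mat p i, inv_pos.mpr hi, fun h => ?_, ?_⟩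
  · have h2 : Y.mat i i = 0 := congrFun h i
    rw [dre, h2, map_zero] at hi
    exact lt_irrefl _ hi
  · refine ext_mat fun p q => ?_
    rw [smul_apply, outer_apply, star_mat, hrot.mul_eq_of_mem_rankOne hY, smul_smul,
      inv_mul_cancel₀ hi.ne', one_smul]

/-- The value of the form at x is the pairing of X with x x^*, and up to positive factors these
matrices are all the positive elements of rank one. -/
theorem HasRot.formPosDef_iff (hrot : HasRot K N) (hA : ∀ a b c : K, a * b * c = a * (b * c))
    (X : Herm K N) : X.FormPosDef ↔ X ∈ dualCone K N := by
  constructor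
  · intro h Y hY
    obtain ⟨r, x, hr, hx, rfl⟩ := hrot.exists_smul_outer hY
    obtain ⟨s, hs, hs'⟩ := h x hx
    rw [dotProduct_mulVec_eq hA] at hs'
    have h1 := congrArg re hs'
    rw [re_smul_one, re_smul_one] at h1
    rw [hip_smul_right, h1]
    exact mul_pos hr hs
  · intro h x hx
    exact ⟨_, h _ (outer_mem_rankOne hA hx), dotProduct_mulVec_eq hA X x⟩

theorem mat_mul_assoc (hA : ∀ a b c : K, a * b * c = a * (b * c))
    (A B D : Matrix (Fin N) (Fin N) K) : A * B * D = A * (B * D) := by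
  ext i j
  simp only [Matrix.mul_apply, Finset.sum_mul, Finset.mul_sum, hA]
  exact Finset.sum_comm

/-- The action of a matrix on vectors, as a real-linear map. -/
def act (M : Matrix (Fin N) (Fin N) K) : (Fin N → K) →ₗ[ℝ] (Fin N → K) where
  toFun x := M *ᵥ x
  map_add' x y := Matrix.mulVec_add M x y
  map_smul' r x := Matrix.mulVec_smul M r x

theorem act_mul (hA : ∀ a b c : K, a * b * c = a * (b * c)) (A B : Matrix (Fin N) (Fin N) K) :
    act (A * B) = act A * act B := by
  refine LinearMap.ext fun x => funext fun i => ?_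
  change ((A * B) *ᵥ x) i = (A *ᵥ (B *ᵥ x)) i
  simp only [mulVec, dotProduct, Matrix.mul_apply, Finset.sum_mul, Finset.mul_sum, hA]
  exact Finset.sum_comm

theorem mat_quad (hA : ∀ a b c : K, a * b * c = a * (b * c)) (X Y : Herm K N) :
    (quad X Y).mat = X.mat * (Y.mat * X.mat) := by
  rw [quad, mat_sub, mat_smul, mat_jmul X (jmul X Y), mat_jmul (jmul X X) Y, mat_jmul_self, mat_jmul]
  simp only [Matrix.mul_smul, Matrix.smul_mul, Matrix.mul_add, Matrix.add_mul, mat_mul_assoc hA]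
  module

theorem quad_diag (d e : Fin N → ℝ) : quad (diag d) (diag e) = (diag (d * (e * d)) : Herm K N) := by
  rw [quad, jmul_diag, jmul_diag, jmul_diag, jmul_diag]
  simp only [← diagₗ_apply, ← map_smul, ← map_sub]
  congr 1
  ext i
  simp
  ring

/-- The rank of a projection is its trace. Diagonal entries are real, so each contributes its value
once for every vector of a real basis of 𝕂. -/
theorem finrank_range_act (hA : ∀ a b c : K, a * b * c = a * (b * c)) {E : Herm K N}
    (hE : jmul E E = E) :
    (Module.finrank ℝ (LinearMap.range (act E.mat)) : ℝ) = tr E * Module.finrank ℝ K := by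
  have h1 : IsIdempotentElem (act E.mat) := by
    rw [IsIdempotentElem, ← act_mul hA, ← mat_jmul_self, hE]
  let b := Module.finBasis ℝ K
  rw [← (LinearMap.IsIdempotentElem.isProj_range _ h1).trace,
    LinearMap.trace_eq_matrix_trace ℝ (Pi.basis fun _ : Fin N => b), Matrix.trace,
    Fintype.sum_sigma, tr, Finset.sum_mul]
  refine Finset.sum_congr rfl fun i _ => ?_
  have h2 : ∀ k, (LinearMap.toMatrix (Pi.basis fun _ : Fin N => b) (Pi.basis fun _ : Fin N => b)
      (act E.mat)).diag ⟨i, k⟩ = dre E i := by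
    intro k
    rw [Matrix.diag_apply, LinearMap.toMatrix_apply, Pi.basis_apply, Pi.basis_repr]
    change b.repr ((E.mat *ᵥ Pi.single i (b k)) i) k = _
    have h3 : (E.mat *ᵥ Pi.single i (b k)) i = dre E i • b k := by
      rw [mulVec, dotProduct, Finset.sum_eq_single i]
      · rw [Pi.single_eq_same, mat_self, CompAlg.smul_one_mul]
      · intro j _ hj
        rw [Pi.single_eq_of_ne hj, mul_zero]
      · simp
    rw [h3, map_smul]
    simp
  simp only [h2, Finset.sum_const, Finset.card_univ, Fintype.card_fin, nsmul_eq_mul]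
  ring

/-- A Jordan automorphism need not come from a map of 𝕂^N, so images are compared through the
quadratic map: X = EXE and E = XZX for the support idempotent E and a suitable Z, hence X and E have
the same image. -/
theorem imageRank_smul_diag (hA : ∀ a b c : K, a * b * c = a * (b * c)) (g : jGroup K N)
    (l : Fin N → ℝ) (r : ℕ) :
    ImageRank (g • (diag l : Herm K N)) r ↔ (Finset.univ.filter fun i => l i ≠ 0).card = r := by
  set χ : Fin N → ℝ := fun i => if l i ≠ 0 then 1 else 0 with hχ
  set X : Herm K N := g • diag l with hX
  set E : Herm K N := g • diag χ with hE
  have h1 : quad E X = X := by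
    rw [hE, hX, quad_smul_smul, quad_diag]
    congr 2
    ext i
    by_cases h : l i = 0 <;> simp [hχ, h]
  -- The convention 0⁻¹ = 0 makes this a pseudo-inverse of the square.
  have h2 : quad X (g • diag (fun i => (l i)⁻¹ ^ 2)) = E := by
    rw [hE, hX, quad_smul_smul, quad_diag]
    congr 2
    ext i
    by_cases h : l i = 0
    · simp [hχ, h]
    · simp [hχ, h]
      field_simp
  have hr : LinearMap.range (act X.mat) = LinearMap.range (act E.mat) := by
    refine le_antisymm ?_ ?_
    · rw [← h1, mat_quad hA, act_mul hA]
      exact LinearMap.range_comp_le_range _ _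
    · rw [← h2, mat_quad hA, act_mul hA]
      exact LinearMap.range_comp_le_range _ _
  have hs : Submodule.span ℝ (Set.range fun x : Fin N → K => X.mat *ᵥ x) =
      LinearMap.range (act X.mat) :=
    Submodule.span_eq (LinearMap.range (act X.mat))
  have hEE : jmul E E = E := by
    rw [hE, jmul_smul, jmul_diag]
    congr 2
    ext i
    by_cases h : l i = 0 <;> simp [hχ, h]
  have h3 := finrank_range_act hA hEE
  have h4 : tr E = ((Finset.univ.filter fun i => l i ≠ 0).card : ℝ) := by
    rw [hE, tr_smul_jGroup, tr_diag, hχ, Finset.sum_boole]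
  have : Nontrivial K := CompAlg.nontrivial
  have h5 : 0 < Module.finrank ℝ K := Module.finrank_pos
  rw [h4, ← Nat.cast_mul, Nat.cast_inj] at h3
  rw [ImageRank, hs, hr, h3]
  exact ⟨fun h => Nat.eq_of_mul_eq_mul_right h5 h, fun h => by rw [h]⟩

theorem imageRank_smul (X : Herm K N) (r : ℕ) {c : ℝ} (hc : c ≠ 0) :
    ImageRank (c • X) r ↔ ImageRank X r := by
  have : (Set.range fun x : Fin N → K => (c • X).mat *ᵥ x) =
      Set.range fun x : Fin N → K => X.mat *ᵥ x := by
    ext y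
    constructor
    · rintro ⟨x, rfl⟩
      refine ⟨c • x, ?_⟩
      simp only [mat_smul]
      rw [Matrix.mulVec_smul, Matrix.smul_mulVec]
    · rintro ⟨x, rfl⟩
      refine ⟨c⁻¹ • x, ?_⟩
      simp only [mat_smul]
      rw [Matrix.mulVec_smul, Matrix.smul_mulVec, inv_smul_smul₀ hc]
  rw [ImageRank, ImageRank, this]

end Herm

end

/-! ### Positivity and rank by Jordan frames. -/

noncomputable section

set_option linter.unusedSectionVars false

namespace Herm

open CompAlg hiding mul_smul smul_mul smul_one_mul mul_smul_one mul_mul_mul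

variable {K : Type} [NormedStarAlg K] [CompAlg K] {N : ℕ}

theorem isJordanFrame_iff (c : Fin N → Herm K N) : IsJordanFrame c ↔
    (∀ k, c k ≠ 0) ∧ (∑ k, c k = diag 1) ∧ ∀ k l, jmul (c k) (c l) = if k = l then c k else 0 := by
  refine and_congr_right fun _ => and_congr_right fun _ => forall_congr' fun k =>
    forall_congr' fun l => ?_
  rw [← mat_jmul]
  constructor
  · intro h
    refine Subtype.ext (h.trans ?_)
    split_ifs <;> rfl
  · intro h
    rw [h]
    split_ifs <;> rfl

theorem sum_smul_diag_single (l : Fin N → ℝ) :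
    ∑ k, l k • (diag (Pi.single k 1) : Herm K N) = diag l := by
  simp only [← diagₗ_apply, ← map_smul, ← map_sum]
  congr 1
  ext i
  simp [Pi.single_apply]

theorem isJordanFrame_diag_single :
    IsJordanFrame fun k : Fin N => (diag (Pi.single k 1) : Herm K N) := by
  rw [isJordanFrame_iff]
  refine ⟨fun k h => ?_, ?_, fun k l => ?_⟩
  · have := (diag_single_mem_rankOne (K := K) k).2
    rw [h, ← zero_smul ℝ (0 : Herm K N), tr_smul, zero_mul] at this
    exact lt_irrefl _ this
  · simpa using sum_smul_diag_single (K := K) (1 : Fin N → ℝ)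
  · rw [jmul_diag, ← diagₗ_apply, ← diagₗ_apply]
    split_ifs with h
    · congr 1
      ext i
      by_cases hi : i = l <;> simp [h, hi]
    · convert map_zero (diagₗ K N)
      ext i
      by_cases hi : i = k
      · simp [hi, h]
      · simp [hi]

theorem IsJordanFrame.smul {c : Fin N → Herm K N} (hc : IsJordanFrame c) (g : jGroup K N) :
    IsJordanFrame fun k => g • c k := by
  rw [isJordanFrame_iff] at hc ⊢
  refine ⟨fun k => (smul_ne_zero_iff_ne g).mpr (hc.1 k), ?_, fun k l => ?_⟩
  · rw [← Finset.smul_sum, hc.2.1, smul_diag_one]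
  · rw [jmul_smul, hc.2.2]
    split_ifs
    · rfl
    · rw [smul_zero]

theorem isSpectrum_smul_diag (g : jGroup K N) (l : Fin N → ℝ) :
    IsSpectrum (g • (diag l : Herm K N)) l := by
  refine ⟨_, isJordanFrame_diag_single.smul g, ?_⟩
  rw [← sum_smul_diag_single, Finset.smul_sum]
  exact Finset.sum_congr rfl fun k _ => smul_comm _ _ _

theorem HasRot.exists_idempotent (hrot : HasRot K N) {E : Herm K N} (hE : jmul E E = E) :
    ∃ (g : jGroup K N) (n : Fin N → ℝ), E = g • diag n ∧ ∀ i, n i = 0 ∨ n i = 1 := by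
  obtain ⟨g, -, n, rfl⟩ := hrot.exists_smul_diag E
  refine ⟨g, n, rfl, fun i => ?_⟩
  rw [jmul_smul, smul_left_cancel_iff, jmul_diag] at hE
  have h3 := congrArg (fun Z => dre Z i) hE
  simp only [dre_diag, Pi.mul_apply] at h3
  have : n i * (n i - 1) = 0 := by linarith
  rcases mul_eq_zero.mp this with h | h
  · exact Or.inl h
  · exact Or.inr (sub_eq_zero.mp h)

theorem HasRot.hip_idempotent_nonneg (hrot : HasRot K N) {E Y : Herm K N} (hE : jmul E E = E)
    (hY : Y ∈ rankOne K N) : 0 ≤ hip E Y := by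
  obtain ⟨g, n, rfl, hn⟩ := hrot.exists_idempotent hE
  rw [hip_smul, hip_comm, hip_diag]
  refine Finset.sum_nonneg fun i _ => mul_nonneg ?_
    (dre_nonneg_of_mem_rankOne (smul_mem_rankOne g⁻¹ hY) i)
  rcases hn i with h | h <;> simp [h]

theorem HasRot.one_le_tr_idempotent (hrot : HasRot K N) {E : Herm K N} (hE : jmul E E = E)
    (hE0 : E ≠ 0) : 1 ≤ tr E := by
  obtain ⟨g, n, rfl, hn⟩ := hrot.exists_idempotent hE
  have h0 : ∀ i, 0 ≤ n i := fun i => by rcases hn i with h | h <;> simp [h]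
  obtain ⟨i, hi⟩ : ∃ i, n i ≠ 0 := by
    by_contra! h
    have h1 : n = 0 := funext h
    rw [h1, ← diagₗ_apply, map_zero, smul_zero] at hE0
    exact hE0 rfl
  rw [tr_smul_jGroup, tr_diag, ← (hn i).resolve_left hi]
  exact Finset.single_le_sum (fun i _ => h0 i) (Finset.mem_univ i)

/-- The frame is arbitrary, not a rotated standard one. Its members pair nonnegatively with Y of
rank one, and these pairings add up to the trace of Y, so at least one is positive. -/
theorem HasRot.specPosDef_iff (hrot : HasRot K N) (X : Herm K N) :
    X.SpecPosDef ↔ X ∈ dualCone K N := by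
  constructor
  · rintro ⟨l, ⟨c, hc, rfl⟩, hl⟩ Y hY
    rw [isJordanFrame_iff] at hc
    have h1 : ∀ k ∈ Finset.univ, 0 ≤ hip (c k) Y := fun k _ =>
      hrot.hip_idempotent_nonneg (by rw [hc.2.2, if_pos rfl]) hY
    have h2 : 0 < ∑ k, hip (c k) Y := by
      rw [← hip_sum_left, hc.2.1, hip_comm, hip_one]
      exact hY.2
    obtain ⟨k, hk, hk'⟩ := (Finset.sum_pos_iff_of_nonneg h1).mp h2
    rw [hip_sum_left]
    simp only [hip_smul_left]
    exact (Finset.sum_pos_iff_of_nonneg fun k hk => mul_nonneg (hl k).le (h1 k hk)).mpr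
      ⟨k, hk, mul_pos (hl k) hk'⟩
  · intro h
    obtain ⟨g, -, l, rfl⟩ := hrot.exists_smul_diag X
    rw [smul_mem_dualCone, diag_mem_dualCone] at h
    exact ⟨l, isSpectrum_smul_diag g l, h⟩

/-- N nonzero idempotents have traces at least 1, and these add up to the trace N of the identity.
-/
theorem HasRot.tr_eq_one_of_isJordanFrame (hrot : HasRot K N) {c : Fin N → Herm K N}
    (hc : IsJordanFrame c) (k : Fin N) : tr (c k) = 1 := by
  rw [isJordanFrame_iff] at hc
  have h1 : ∀ k ∈ Finset.univ, 1 ≤ tr (c k) := fun k _ =>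
    hrot.one_le_tr_idempotent (by rw [hc.2.2, if_pos rfl]) (hc.1 k)
  have h2 : ∑ _k : Fin N, (1 : ℝ) = ∑ k, tr (c k) := by
    have h3 : ∑ k, tr (c k) = hip (∑ k, c k) (diag 1) := by
      rw [hip_sum_left]
      exact Finset.sum_congr rfl fun k _ => (hip_one _).symm
    rw [h3, hc.2.1, hip_one, tr_diag]
    rfl
  exact ((Finset.sum_eq_sum_iff_of_le h1).mp h2 k (Finset.mem_univ k)).symm

/-- If two nonnegative families are exchanged by a doubly stochastic matrix and its transpose, they
have as many nonzero terms. -/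
theorem card_ne_zero_eq_of_doublyStochastic {ι : Type*} [Fintype ι] [DecidableEq ι]
    {P : ι → ι → ℝ} (hP : ∀ k i, 0 ≤ P k i) (hrow : ∀ k, ∑ i, P k i = 1) (hcol : ∀ i, ∑ k, P k i = 1)
    {l m : ι → ℝ} (hl : ∀ i, 0 ≤ l i) (hlm : ∀ i, l i = ∑ k, m k * P k i)
    (hml : ∀ k, m k = ∑ i, l i * P k i) :
    (Finset.univ.filter fun k => m k ≠ 0).card = (Finset.univ.filter fun i => l i ≠ 0).card := by
  have hm : ∀ k, 0 ≤ m k := fun k => by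
    rw [hml]
    exact Finset.sum_nonneg fun i _ => mul_nonneg (hl i) (hP k i)
  have h1 : ∀ k ∈ Finset.univ.filter fun k => m k ≠ 0,
      ∑ i ∈ Finset.univ.filter fun i => l i ≠ 0, P k i = 1 := by
    intro k hk
    rw [← hrow k]
    refine Finset.sum_subset (Finset.subset_univ _) fun i _ hi => ?_
    have hli : l i = 0 := by simpa using hi
    have h0 := hlm i
    rw [hli, eq_comm, Finset.sum_eq_zero_iff_of_nonneg fun k _ => mul_nonneg (hm k) (hP k i)] at h0
    exact (mul_eq_zero.mp (h0 k (Finset.mem_univ k))).resolve_left (by simpa using hk)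
  have h2 : ∀ i ∈ Finset.univ.filter fun i => l i ≠ 0,
      ∑ k ∈ Finset.univ.filter fun k => m k ≠ 0, P k i = 1 := by
    intro i hi
    rw [← hcol i]
    refine Finset.sum_subset (Finset.subset_univ _) fun k _ hk => ?_
    have hmk : m k = 0 := by simpa using hk
    have h0 := hml k
    rw [hmk, eq_comm, Finset.sum_eq_zero_iff_of_nonneg fun i _ => mul_nonneg (hl i) (hP k i)] at h0
    exact (mul_eq_zero.mp (h0 i (Finset.mem_univ i))).resolve_left (by simpa using hi)
  have h3 := Finset.sum_congr rfl h1
  have h4 := Finset.sum_congr rfl h2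
  -- The sum of the entries over the product of the two supports, counted by rows and by columns.
  rw [Finset.sum_comm, h4] at h3
  simp only [Finset.sum_const, nsmul_eq_mul, mul_one, Nat.cast_inj] at h3
  exact h3.symm

/-- `SpecRank` allows any frame, so the number of nonzero eigenvalues must be shown independent of
it. The diagonal entries of the members of a frame form a doubly stochastic matrix, which exchanges
the two lists of eigenvalues. -/
theorem HasRot.specRank_smul_diag (hrot : HasRot K N) (g : jGroup K N) {l : Fin N → ℝ}
    (hl : ∀ i, 0 ≤ l i) (r : ℕ) :
    SpecRank (g • (diag l : Herm K N)) r ↔ (Finset.univ.filter fun i => l i ≠ 0).card = r := by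
  refine ⟨?_, fun h => ⟨l, isSpectrum_smul_diag g l, h⟩⟩
  rintro ⟨m, ⟨c, hc, hcX⟩, rfl⟩
  have hX : diag l = ∑ k, m k • (g⁻¹ • c k) := by
    rw [← inv_smul_smul g (diag l : Herm K N), hcX, Finset.smul_sum]
    exact Finset.sum_congr rfl fun k _ => smul_comm _ _ _
  have hc' := hc.smul g⁻¹
  have htr := hrot.tr_eq_one_of_isJordanFrame hc'
  have hc'' := (isJordanFrame_iff _).mp hc'
  have hmem : ∀ k, g⁻¹ • c k ∈ rankOne K N := fun k =>
    ⟨by rw [hc''.2.2, if_pos rfl, htr, one_smul], by rw [htr]; exact one_pos⟩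
  refine (card_ne_zero_eq_of_doublyStochastic (P := fun k i => dre (g⁻¹ • c k) i)
    (fun k i => dre_nonneg_of_mem_rankOne (hmem k) i) htr (fun i => ?_) hl (fun i => ?_)
    fun k => ?_).symm
  · have h1 := congrArg (fun Z : Herm K N => re (Z.mat i i)) hc''.2.1
    have h2 : ∀ s : Finset (Fin N), re ((∑ k ∈ s, g⁻¹ • c k).mat i i) = ∑ k ∈ s, dre (g⁻¹ • c k) i :=
      fun s => map_sum (re ∘ₗ entry i i) _ s
    rw [← h2, h1]
    exact dre_diag 1 i
  · have h1 := congrArg (fun Z : Herm K N => re (Z.mat i i)) hX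
    have h2 : re ((∑ k, m k • g⁻¹ • c k).mat i i) = ∑ k, dre (m k • g⁻¹ • c k) i :=
      map_sum (re ∘ₗ entry i i) _ _
    rw [h2] at h1
    simp only [dre_smul] at h1
    rw [← h1]
    exact (dre_diag l i).symm
  · rw [← hip_diag, hip_comm, hX, hip_sum_left, Finset.sum_eq_single k]
    · rw [hip_smul_left, hip_eq_tr, hc''.2.2, if_pos rfl, htr, mul_one]
    · intro j _ hj
      rw [hip_smul_left, hip_eq_tr, hc''.2.2, if_neg hj, ← zero_smul ℝ (0 : Herm K N), tr_smul,
        zero_mul, mul_zero]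
    · simp

theorem isSpectrum_smul {X : Herm K N} {l : Fin N → ℝ} (h : IsSpectrum X l) (c : ℝ) :
    IsSpectrum (c • X) (c • l) := by
  obtain ⟨e, he, rfl⟩ := h
  refine ⟨e, he, ?_⟩
  rw [Finset.smul_sum]
  exact Finset.sum_congr rfl fun k _ => smul_smul _ _ _

theorem specRank_smul (X : Herm K N) (r : ℕ) {c : ℝ} (hc : c ≠ 0) :
    SpecRank (c • X) r ↔ SpecRank X r := by
  have key : ∀ {c : ℝ} {X : Herm K N}, c ≠ 0 → SpecRank X r → SpecRank (c • X) r := by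
    rintro c X hc ⟨l, hl, rfl⟩
    refine ⟨c • l, isSpectrum_smul hl c, ?_⟩
    congr 1
    ext k
    simp [hc]
  refine ⟨fun h => ?_, key hc⟩
  have := key (inv_ne_zero hc) h
  rwa [inv_smul_smul₀ hc] at this

end Herm

end

/-! ### The four algebras, and the final assembly. -/

noncomputable section

set_option linter.unusedSectionVars false

instance : ∀ 𝔸 : DivAlg, CompAlg 𝔸.Carrier
  | .real => inferInstanceAs (CompAlg ℝ)
  | .complex => inferInstanceAs (CompAlg ℂ)
  | .quaternion => inferInstanceAs (CompAlg (Quaternion ℝ))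
  | .octonion => inferInstanceAs (CompAlg Octonion)

theorem DivAlg.mul_assoc_of_ne {𝔸 : DivAlg} (h : 𝔸 ≠ .octonion) (a b c : 𝔸.Carrier) :
    a * b * c = a * (b * c) := by
  cases 𝔸 with
  | real => exact mul_assoc (G := ℝ) a b c
  | complex => exact mul_assoc (G := ℂ) a b c
  | quaternion => exact mul_assoc (G := Quaternion ℝ) a b c
  | octonion => exact absurd rfl h

section

variable {𝔸 : DivAlg} {N : ℕ} (h𝕆 : 𝔸 = DivAlg.octonion → N = 3)
include h𝕆

theorem hasRot_carrier : Herm.HasRot 𝔸.Carrier N := by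
  by_cases h : 𝔸 = .octonion
  · exact Herm.hasRot (Or.inl (h𝕆 h).le)
  · exact Herm.hasRot (Or.inr (DivAlg.mul_assoc_of_ne h))

theorem posCone_eq_dualCone : posCone 𝔸 N = Herm.dualCone 𝔸.Carrier N := by
  have hrot := hasRot_carrier h𝕆
  ext X
  cases 𝔸 with
  | octonion => exact hrot.specPosDef_iff X
  | _ => exact hrot.formPosDef_iff (DivAlg.mul_assoc_of_ne (by simp)) X

theorem hasRank_smul_diag (g : Herm.jGroup 𝔸.Carrier N) (l : Fin N → ℝ) (hl : ∀ i, 0 ≤ l i) (r : ℕ) :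
    HasRank 𝔸 (g • (Herm.diag l : HermV 𝔸 N)) r ↔
      (Finset.univ.filter fun i => l i ≠ 0).card = r := by
  have hrot := hasRot_carrier h𝕆
  cases 𝔸 with
  | octonion => exact hrot.specRank_smul_diag g hl r
  | _ => exact Herm.imageRank_smul_diag (DivAlg.mul_assoc_of_ne (by simp)) g l r

omit h𝕆 in
theorem hasRank_smul (X : HermV 𝔸 N) (r : ℕ) (c : ℝ) (hc : c ≠ 0) :
    HasRank 𝔸 (c • X) r ↔ HasRank 𝔸 X r := by
  cases 𝔸 with
  | octonion => exact Herm.specRank_smul X r hc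
  | _ => exact Herm.imageRank_smul X r hc

theorem symCone_posCone (hN : N ≠ 0) : ConvProj.SymCone (posCone 𝔸 N) N (Herm.diagₗ 𝔸.Carrier N)
    (Herm.trL 𝔸.Carrier N) (HasRank 𝔸) := by
  rw [posCone_eq_dualCone h𝕆]
  exact (hasRot_carrier h𝕆).symCone hN (hasRank_smul_diag h𝕆) hasRank_smul

theorem exists_smul_eq_scale {d : Fin N → ℝ} (hd : ∀ i, 0 < d i) :
    ∃ g ∈ ConvProj.autConeId (posCone 𝔸 N), ∀ X : HermV 𝔸 N, g • X = Herm.scale d X := by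
  rw [posCone_eq_dualCone h𝕆]
  exact (hasRot_carrier h𝕆).exists_scale hd

end

end

theorem proposition7p1 (𝔸 : DivAlg) (N : ℕ) (hN : 3 ≤ N) (h𝕆 : 𝔸 = DivAlg.octonion → N = 3) :
    -- non-emptiness of the strata
    (∀ i j : ℕ, 1 ≤ i → i ≤ N - 1 → 1 ≤ j → j ≤ N - 1 →
      ((unitTangentStratum 𝔸 N i j).Nonempty ↔ N ≤ i + j)) ∧
    -- the strata of type `(i, N - i)` as homogeneous spaces
    (∀ i : ℕ, 1 ≤ i → i ≤ N - 1 →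
      -- `G₀` acts on the stratum, transitively
      (∀ g : ConvProj.autDomId (posCone 𝔸 N), ∀ v ∈ unitTangentStratum 𝔸 N i (N - i),
        g • v ∈ unitTangentStratum 𝔸 N i (N - i)) ∧
      (∀ v ∈ unitTangentStratum 𝔸 N i (N - i), ∀ w ∈ unitTangentStratum 𝔸 N i (N - i),
        ∃ g : ConvProj.autDomId (posCone 𝔸 N), g • v = w) ∧
      -- the base point `v₀`
      ∃ v₀ ∈ unitTangentStratum 𝔸 N i (N - i),
        ConvProj.Rep (v₀ 0) (Herm.diag 1) ∧
        (∃ x, Tendsto v₀ atBot (𝓝 x) ∧ ConvProj.Rep x (Herm.diag (blockVec i 1 0))) ∧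
        (∃ y, Tendsto v₀ atTop (𝓝 y) ∧ ConvProj.Rep y (Herm.diag (blockVec i 0 1))) ∧
        -- the one-parameter group `a_t` of (classes of) diagonal matrices, contained in `G₀`
        ∃ a : ℝ → ConvProj.autDomId (posCone 𝔸 N),
          (∀ t, ∃ g : ConvProj.AutCone (posCone 𝔸 N),
            IsDiagAction (blockVec i (Real.exp (-t / 2)) (Real.exp (t / 2))) g ∧
            (a t : ConvProj.AutDom (posCone 𝔸 N)) = (g : ConvProj.AutDom (posCone 𝔸 N))) ∧
          -- it normalises the stabiliser of `v₀`
          (∀ t, ∀ k ∈ MulAction.stabilizer (ConvProj.autDomId (posCone 𝔸 N)) v₀,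
            (a t)⁻¹ * k * a t ∈ MulAction.stabilizer (ConvProj.autDomId (posCone 𝔸 N)) v₀) ∧
          -- the identification of the stratum with `G₀ / K`, and the flow in terms of it
          ∃ e : (ConvProj.autDomId (posCone 𝔸 N) ⧸
              MulAction.stabilizer (ConvProj.autDomId (posCone 𝔸 N)) v₀) ≃ₜ
              unitTangentStratum 𝔸 N i (N - i),
            ∀ g : ConvProj.autDomId (posCone 𝔸 N),
              (e (QuotientGroup.mk g) : ℝ → ℙ ℝ (HermV 𝔸 N)) = g • v₀ ∧
              ∀ t : ℝ, ConvProj.geodFlow t (e (QuotientGroup.mk g) : ℝ → ℙ ℝ (HermV 𝔸 N)) =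
                e (QuotientGroup.mk (g * a t))) ∧
    -- the non-wandering set
    ConvProj.nonWandering (ConvProj.AutDom (posCone 𝔸 N)) (ConvProj.geod (posCone 𝔸 N)) =
      ⋃ i ∈ Set.Icc 1 (N - 1), geodStratum 𝔸 N i (N - i) := by
  have hS := symCone_posCone (𝔸 := 𝔸) h𝕆 (by omega)
  have : Nontrivial (HermV 𝔸 N) := hS.nontrivial
  refine ⟨fun i j _ hi _ hj => hS.stratum_nonempty_iff (by omega) (by omega), fun i hi hiN => ?_,
    hS.nonWandering_eq⟩
  have hiN' : i + 1 ≤ N := by omega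
  refine ⟨fun g v hv => hS.smul_mem_stratum g hv,
    fun v hv w hw => hS.transitive_stratum hi hiN' hv hw, ?_⟩
  obtain ⟨c, hA, hB⟩ := hS.exists_chord_blockVec (j := N - i) hiN' (by omega) (by omega)
  rw [Nat.sub_sub_self (by omega)] at c hB
  have hv₀ := (hS.chordGeod_mem_stratum_iff c i (N - i)).mpr ⟨hA, hB⟩
  have hsum : Herm.diagₗ 𝔸.Carrier N (blockVec i 1 0) + Herm.diagₗ 𝔸.Carrier N (blockVec i 0 1) =
      Herm.diag 1 := by
    rw [← map_add, Herm.diagₗ_apply]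
    congr 1
    ext k
    simp only [blockVec, Pi.add_apply, Pi.one_apply]
    split_ifs <;> norm_num
  set v₀ := ConvProj.chordGeod (Herm.diagₗ 𝔸.Carrier N (blockVec i 1 0))
    (Herm.diagₗ 𝔸.Carrier N (blockVec i 0 1)) with hv₀_def
  have hd : ∀ (t : ℝ) (k : Fin N), 0 < blockVec i (Real.exp (-t / 2)) (Real.exp (t / 2)) k := by
    intro t k
    simp only [blockVec]
    split_ifs <;> exact Real.exp_pos _
  choose g hg hgX using fun t => exists_smul_eq_scale (𝔸 := 𝔸) h𝕆 (hd t)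
  have hflow : ∀ t, (g t : ConvProj.AutDom (posCone 𝔸 N)) • v₀ = ConvProj.geodFlow t v₀ := by
    intro t
    -- D_t acts on diagonal matrices through its square, so the exponents ±t/2 produce the factors
    -- e^(-t) and e^t of the geodesic flow.
    have h1 : (-t / 2) + (-t / 2) = -t := by ring
    have h2 : (t / 2) + (t / 2) = t := by ring
    rw [hv₀_def, hS.smul_chordGeod (g t) c, ConvProj.geodFlow_chordGeod, hgX, hgX,
      Herm.diagₗ_apply, Herm.diagₗ_apply, Herm.scale_diag, Herm.scale_diag, ← Herm.diagₗ_apply,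
      ← Herm.diagₗ_apply, ← Herm.diagₗ_apply, ← Herm.diagₗ_apply, ← map_smul, ← map_smul]
    congr 2 <;>
    · ext k
      simp only [blockVec, Pi.mul_apply, Pi.smul_apply, smul_eq_mul]
      split_ifs <;> simp [← Real.exp_add, h1, h2]
  let a : ℝ → ConvProj.autDomId (posCone 𝔸 N) := fun t => ⟨g t, ConvProj.mk_mem_autDomId (hg t)⟩
  have ha : ∀ t, a t • v₀ = ConvProj.geodFlow t v₀ := hflow
  -- The group acts on the values of curves and the flow on their parameter, so they commute by
  -- definition. This yields both the normalisation of the stabiliser and the formula for the flow.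
  have hcomm : ∀ (k : ConvProj.autDomId (posCone 𝔸 N)) (t : ℝ) (v : ℝ → ℙ ℝ (HermV 𝔸 N)),
      k • ConvProj.geodFlow t v = ConvProj.geodFlow t (k • v) := fun _ _ _ => rfl
  refine ⟨v₀, hv₀, ?_, ⟨_, hS.tendsto_chordGeod_atBot c, ConvProj.rep_pt (hS.chord_left_ne_zero c)⟩,
    ⟨_, hS.tendsto_chordGeod_atTop c,
      ConvProj.rep_pt (hS.chord_left_ne_zero (hS.chord_symm c))⟩, a, fun t => ⟨g t, fun X => ?_, rfl⟩,
    fun t k hk => ?_, ?_⟩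
  · rw [hv₀_def, ConvProj.chordGeod_zero, hsum]
    exact ConvProj.rep_pt (hsum ▸ hS.ne_zero c.add_mem)
  · rw [hgX, Herm.mat_scale]
  · rw [MulAction.mem_stabilizer_iff] at hk ⊢
    rw [mul_smul, mul_smul, inv_smul_eq_iff, ha, hcomm, hk]
  · obtain ⟨e, he⟩ := hS.exists_homeomorph hi hiN' hv₀
    refine ⟨e, fun k => ⟨he k, fun t => ?_⟩⟩
    refine (congrArg _ (he k)).trans (Eq.trans ?_ (he _).symm)
    rw [mul_smul, ha, hcomm]
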